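/- Let $m$ be a natural number. An $m$-diagram consists of two rows of $m$ dots joined by $m$ edges so that each dot lies on exactly one edge. For a field $K$ and $\omega\in K$, the Brauer algebra $\mathcal B_m(\omega)$ over $K$ has the $m$-diagrams as a basis; the product $d_1d_2$ is $\omega^s$ times the diagram obtained by placing $d_1$ above $d_2$, identifying the bottom row of $d_1$ with the top row of $d_2$ and removing the $s$ closed loops that arise. For $a<b$ let $s_{ab}$ be the diagram of the transposition $(a\,b)$, and let $\epsilon_{ab}$ be the diagram with an edge joining the dots $a,b$ of the top row, an edge joining the dots $a,b$ of the bottom row, and vertical edges elsewhere. Let $\omega$ be an indeterminate and work in $\mathcal B_m(\omega)$ over $\mathbb C(\omega)$. Put $x_b=\frac{\omega-1}{2}+\sum_{a<b}(s_{ab}-\epsilon_{ab})$ and $c_b=\frac{\omega-1}{2}+b-1$ for $b=1,\dots,m$. The symmetrizer $S^{(m)}$ is the primitive idempotent attached to the unique standard tableau of the row shape $(m)$, that is, $S^{(m)}=E_m$, where $E_0=1$ and $$E_r=E_{r-1}\,\frac{u-c_r}{u-x_r}\Big|_{u=c_r},\qquad r=1,\dots,m.$$ Let $n$ be a natural number,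 let $e_{ij}$ be the matrix units of $\operatorname{End}\mathbb C^{2n}$, put $i'=2n-i+1$, $\varepsilon_i=1$ for $i\le n$ and $\varepsilon_i=-1$ for $i>n$. For $X\in\operatorname{End}\mathbb C^{2n}$ let $X_a=1^{\otimes(a-1)}\otimes X\otimes 1^{\otimes(m-a)}$ act on $(\mathbb C^{2n})^{\otimes m}$, and put $$P_{ab}=\sum_{i,j=1}^{2n}(e_{ij})_a(e_{ji})_b,\qquad Q_{ab}=\sum_{i,j=1}^{2n}\varepsilon_i\varepsilon_j\,(e_{ij})_a(e_{i'j'})_b\qquad(a<b).$$ The algebra $\mathcal B_m(-2n)$ over $\mathbb C$ acts on $(\mathbb C^{2n})^{\otimes m}$ by the algebra homomorphism determined by $s_{ab}\mapsto-P_{ab}$, $\epsilon_{ab}\mapsto-Q_{ab}$ for $a<b$. The characteristic map (symplectic case) is $$\mathrm{ch}:\mathcal B_m(-2n)\to\mathbb C[y_1,\dots,y_n],\qquad \mathrm{ch}(C)=\frac1{m!}\operatorname{tr}\,C\,Y_1\cdots Y_m,\qquad Y=\operatorname{diag}(y_1,\dots,y_n,-y_n,\dots,-y_1).$$ **Statement.**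 Let $2l\le n$. The recurrence for $S^{(2l)}$ is well defined over $\mathbb C(\omega)$ (at each step $u-x_r$ is invertible over $\mathbb C(\omega)(u)$, and $E_{r-1}\frac{u-c_r}{u-x_r}$ has no pole at $u=c_r$), the coefficients of $S^{(2l)}$ have no pole at $\omega=-2n$, so that $S^{(2l)}$ specializes to an element of $\mathcal B_{2l}(-2n)$; the homomorphism of $\mathcal B_{2l}(-2n)$ described above exists and is unique; and $$\mathrm{ch}(S^{(2l)})=\frac{(-1)^l\,(n-2l+1)}{(2l)!\,(n-l+1)}\sum_{1\le i_1<\dots<i_l\le n}y_{i_1}^2\cdots y_{i_l}^2 .$$ -/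

import Mathlib

/-! ### Two involutions and the graph they generate -/

/-- The graph on `X` joining `v` to `σ v` and to `τ v`. -/
def glueGraph {X : Type*} (σ τ : X → X) : SimpleGraph X :=
  SimpleGraph.fromRel (fun v w => σ v = w ∨ τ v = w)

theorem glueGraph_reachable_left {X : Type*} (σ τ : X → X) (v : X) :
    (glueGraph σ τ).Reachable v (σ v) := by
  by_cases h : v = σ v
  · rw [← h]
  · exact SimpleGraph.Adj.reachable (by simp [glueGraph, h])

theorem glueGraph_reachable_right {X : Type*} (σ τ : X → X) (v : X) :
    (glueGraph σ τ).Reachable v (τ v) := by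
  by_cases h : v = τ v
  · rw [← h]
  · exact SimpleGraph.Adj.reachable (by simp [glueGraph, h])

theorem glueGraph_comm {X : Type*} (σ τ : X → X) : glueGraph σ τ = glueGraph τ σ := by
  ext v w; simp [glueGraph, or_comm]

/-- A predicate preserved by both involutions is preserved along paths. -/
theorem glueGraph_reachable_induction {X : Type*} {σ τ : X → X}
    (hσ : Function.Involutive σ) (hτ : Function.Involutive τ) (p : X → Prop)
    (h1 : ∀ v, p v → p (σ v)) (h2 : ∀ v, p v → p (τ v)) {v w : X}
    (h : (glueGraph σ τ).Reachable v w) (hv : p v) : p w := by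
  obtain ⟨q⟩ := h
  induction q with
  | nil => exact hv
  | cons hadj _ ih =>
    apply ih
    simp only [glueGraph, SimpleGraph.fromRel_adj] at hadj
    rcases hadj.2 with (h | h) | (h | h)
    · exact h ▸ h1 _ hv
    · exact h ▸ h2 _ hv
    · rw [← h] at hv; simpa [hσ _] using h1 _ hv
    · rw [← h] at hv; simpa [hτ _] using h2 _ hv

theorem glueGraph_existsUnique_aux {X : Type*} [Finite X] {σ τ : X → X}
    (hσ : Function.Involutive σ) (hτ : Function.Involutive τ)
    (hne : ∀ x, ¬ (σ x = x ∧ τ x = x)) (v : X) (hv : τ v = v) :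
    ∃! w, w ≠ v ∧ (glueGraph σ τ).Reachable v w ∧ (σ w = w ∨ τ w = w) := by
  let s : Equiv.Perm X := hσ.toPerm
  let t : Equiv.Perm X := hτ.toPerm
  have ss : s * s = 1 := by ext x; exact hσ x
  have tt : t * t = 1 := by ext x; exact hτ x
  have si : s⁻¹ = s := inv_eq_of_mul_eq_one_left ss
  have ti : t⁻¹ = t := inv_eq_of_mul_eq_one_left tt
  set f : Equiv.Perm X := t * s with hf
  have hconj : ∀ a : ℤ, t * f ^ a = f ^ (-a) * t := by
    intro a
    have h1 : t * f * t⁻¹ = f⁻¹ := by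
      rw [hf, mul_inv_rev, ti, si, ← mul_assoc, tt, one_mul]
    have h2 : t * f ^ a * t⁻¹ = f ^ (-a) := by
      rw [← conj_zpow, h1, zpow_neg, inv_zpow]
    rw [← h2]; group
  have htv : t v = v := hv
  have hT : ∀ a : ℤ, τ ((f ^ a) v) = (f ^ (-a)) v := by
    intro a
    have := congrArg (fun g : Equiv.Perm X => g v) (hconj a)
    simp only [Equiv.Perm.mul_apply, htv] at this
    exact this
  have hsf : s = t * f := by rw [hf, ← mul_assoc, tt, one_mul]
  have hS : ∀ a : ℤ, σ ((f ^ a) v) = (f ^ (-(a + 1))) v := by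
    intro a
    rw [← hT (a + 1)]
    change s _ = t _
    rw [hsf, add_comm, zpow_add, zpow_one]; rfl
  have hreach : ∀ w, (glueGraph σ τ).Reachable v w ↔ ∃ a : ℤ, w = (f ^ a) v := by
    intro w
    constructor
    · intro h
      refine glueGraph_reachable_induction hσ hτ (fun w => ∃ a : ℤ, w = (f ^ a) v) ?_ ?_ h
        ⟨0, by simp⟩
      · rintro _ ⟨a, rfl⟩; exact ⟨_, hS a⟩
      · rintro _ ⟨a, rfl⟩; exact ⟨_, hT a⟩
    · rintro ⟨a, rfl⟩
      have step : ∀ x, (glueGraph σ τ).Reachable x (f x) := fun x =>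
        (glueGraph_reachable_left σ τ x).trans (glueGraph_reachable_right σ τ _)
      induction a using Int.induction_on with
      | zero => exact SimpleGraph.Reachable.refl _
      | succ i ih =>
        refine ih.trans ?_
        rw [add_comm, zpow_add, zpow_one]; exact step _
      | pred i ih =>
        refine ih.trans (SimpleGraph.Reachable.symm ?_)
        have := step ((f ^ (-(i : ℤ) - 1)) v)
        rwa [← Equiv.Perm.mul_apply, ← zpow_one_add, add_sub_cancel] at this
  set k : ℕ := Function.minimalPeriod f v with hk
  have hkpos : 0 < k := Function.minimalPeriod_pos_of_mem_periodicPts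
    (Function.Injective.mem_periodicPts f.injective v)
  have hper : ∀ a b : ℤ, (f ^ a) v = (f ^ b) v ↔ (k : ℤ) ∣ a - b := by
    intro a b
    have h0 : ∀ c : ℤ, (f ^ c) v = v ↔ (k : ℤ) ∣ c := by
      intro c
      have := MulAction.zpow_smul_eq_iff_minimalPeriod_dvd (a := f) (b := v) (n := c)
      exact this
    have h1 : (f ^ a) v = (f ^ b) ((f ^ (a - b)) v) := by
      rw [← Equiv.Perm.mul_apply, ← zpow_add, add_sub_cancel]
    rw [← h0, h1]
    exact (f ^ b).injective.eq_iff
  have hfix : ∀ a : ℤ, (σ ((f ^ a) v) = (f ^ a) v ∨ τ ((f ^ a) v) = (f ^ a) v) ↔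
      ((k : ℤ) ∣ 2 * a + 1 ∨ (k : ℤ) ∣ 2 * a) := by
    intro a
    rw [hS, hT, hper, hper, ← dvd_neg, ← dvd_neg (b := -a - a)]
    ring_nf
  have hself : ∀ a : ℤ, (f ^ a) v = v ↔ (k : ℤ) ∣ a := by
    intro a; simpa using hper a 0
  have hk1 : k ≠ 1 := by
    intro h
    have h1 : f v = v := by simpa [h] using (hself 1)
    refine hne v ⟨?_, hv⟩
    have h2 := hS 0
    have h3 : (f ^ (-((0 : ℤ) + 1))) v = v := (hself _).2 (by simp [h])
    rw [h3] at h2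
    simpa using h2
  refine ⟨(f ^ ((k / 2 : ℕ) : ℤ)) v, ⟨?_, ?_, ?_⟩, ?_⟩
  · rw [Ne, hself, Int.natCast_dvd_natCast]
    intro h
    have := Nat.le_of_dvd (by omega) h
    omega
  · exact (hreach _).2 ⟨_, rfl⟩
  · rw [hfix]
    rcases Nat.even_or_odd' k with ⟨c, hc | hc⟩
    · right; exact ⟨1, by push_cast; omega⟩
    · left; exact ⟨1, by push_cast; omega⟩
  · rintro w ⟨hw1, hw2, hw3⟩
    obtain ⟨a, rfl⟩ := (hreach _).1 hw2
    rw [hfix] at hw3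
    rw [Ne, hself] at hw1
    rw [hper]
    rcases hw3 with ⟨q, hq⟩ | ⟨q, hq⟩
    · have hqo : Odd ((k : ℤ) * q) := by rw [← hq]; exact ⟨a, rfl⟩
      obtain ⟨⟨c, hc⟩, ⟨d, hd⟩⟩ := Int.odd_mul.1 hqo
      refine ⟨d, ?_⟩
      have h2 : ((k / 2 : ℕ) : ℤ) = c := by push_cast; omega
      rw [h2]
      rw [hd] at hq
      have : (k : ℤ) * (2 * d + 1) = 2 * (k * d) + k := by ring
      omega
    · rcases Int.even_or_odd' q with ⟨d, hd | hd⟩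
      · exact absurd ⟨d, by rw [hd] at hq; nlinarith⟩ hw1
      · refine ⟨d, ?_⟩
        rw [hd] at hq
        have h3 : (k : ℤ) * (2 * d + 1) = 2 * (k * d) + k := by ring
        push_cast
        omega

theorem glueGraph_existsUnique {X : Type*} [Finite X] {σ τ : X → X}
    (hσ : Function.Involutive σ) (hτ : Function.Involutive τ)
    (hne : ∀ x, ¬ (σ x = x ∧ τ x = x)) (v : X) (hv : σ v = v ∨ τ v = v) :
    ∃! w, w ≠ v ∧ (glueGraph σ τ).Reachable v w ∧ (σ w = w ∨ τ w = w) := by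
  rcases hv with hv | hv
  · have := glueGraph_existsUnique_aux hτ hσ (fun x h => hne x h.symm) v hv
    rw [glueGraph_comm] at this
    simpa only [or_comm] using this
  · exact glueGraph_existsUnique_aux hσ hτ hne v hv

/-! ### Brauer diagrams -/

/-- An `m`-diagram: two rows of `m` dots, the top row `Sum.inl` and the bottom row `Sum.inr`,
joined by `m` edges so that every dot lies on exactly one edge. The dot at the other end of the
edge through `v` is `mate v`. -/
@[ext]
structure BrauerDiagram (m : ℕ) where
  mate : Fin m ⊕ Fin m → Fin m ⊕ Fin m
  mate_mate : ∀ v, mate (mate v) = v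
  mate_ne : ∀ v, mate v ≠ v

namespace BrauerDiagram

variable {m : ℕ}

/-- The three rows of dots obtained by placing one diagram above another one: top row,
identified middle row, bottom row. -/
abbrev Rows (m : ℕ) : Type := Fin m ⊕ (Fin m ⊕ Fin m)

/-- The upper diagram drawn in the top and the middle row. -/
def upper (d : BrauerDiagram m) : Rows m → Rows m
  | Sum.inl a => Sum.map id Sum.inl (d.mate (Sum.inl a))
  | Sum.inr (Sum.inl a) => Sum.map id Sum.inl (d.mate (Sum.inr a))
  | Sum.inr (Sum.inr a) => Sum.inr (Sum.inr a)

/-- The lower diagram drawn in the middle and the bottom row. -/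
def lower (d : BrauerDiagram m) : Rows m → Rows m
  | Sum.inl a => Sum.inl a
  | Sum.inr v => Sum.inr (d.mate v)

/-- The outer dots (top and bottom row) among the three rows. -/
def outer : Fin m ⊕ Fin m → Rows m := Sum.map id Sum.inr

/-- The picture obtained by placing `d` above `e`. -/
def stack (d e : BrauerDiagram m) : SimpleGraph (Rows m) :=
  glueGraph d.upper e.lower

theorem upper_involutive (d : BrauerDiagram m) : Function.Involutive d.upper := by
  have key : ∀ v, d.upper (Sum.map id Sum.inl v) = Sum.map id Sum.inl (d.mate v) := by
    rintro (a | a) <;> rfl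
  rintro (a | a | a)
  · change d.upper (Sum.map id Sum.inl (d.mate (Sum.inl a))) = _
    rw [key, d.mate_mate]; rfl
  · change d.upper (Sum.map id Sum.inl (d.mate (Sum.inr a))) = _
    rw [key, d.mate_mate]; rfl
  · rfl

theorem lower_involutive (d : BrauerDiagram m) : Function.Involutive d.lower := by
  rintro (a | a)
  · rfl
  · simp [lower, d.mate_mate]

theorem upper_eq_self (d : BrauerDiagram m) (v : Rows m) :
    d.upper v = v ↔ ∃ a, v = Sum.inr (Sum.inr a) := by
  have key : ∀ v, Sum.map id Sum.inl (d.mate v) ≠ (Sum.map id Sum.inl v : Rows m) := by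
    intro v h
    exact d.mate_ne v ((Sum.map_injective.2 ⟨Function.injective_id, Sum.inl_injective⟩) h)
  rcases v with a | a | a
  · simpa [upper] using key (Sum.inl a)
  · simpa [upper] using key (Sum.inr a)
  · simp [upper]

theorem lower_eq_self (d : BrauerDiagram m) (v : Rows m) :
    d.lower v = v ↔ ∃ a, v = Sum.inl a := by
  rcases v with a | a
  · simp [lower]
  · simpa [lower] using d.mate_ne a

theorem outer_injective : Function.Injective (outer : Fin m ⊕ Fin m → Rows m) :=
  Sum.map_injective.2 ⟨Function.injective_id, Sum.inr_injective⟩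

theorem fixed_iff_outer (d e : BrauerDiagram m) (v : Rows m) :
    (d.upper v = v ∨ e.lower v = v) ↔ ∃ w, v = outer w := by
  rw [upper_eq_self, lower_eq_self]
  constructor
  · rintro (⟨a, rfl⟩ | ⟨a, rfl⟩)
    · exact ⟨Sum.inr a, rfl⟩
    · exact ⟨Sum.inl a, rfl⟩
  · rintro ⟨a | a, rfl⟩
    · exact Or.inr ⟨a, rfl⟩
    · exact Or.inl ⟨a, rfl⟩

theorem stack_existsUnique (d e : BrauerDiagram m) (v : Fin m ⊕ Fin m) :
    ∃! w, w ≠ v ∧ (d.stack e).Reachable (outer v) (outer w) := by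
  have hne : ∀ x, ¬ (d.upper x = x ∧ e.lower x = x) := by
    rintro x ⟨h1, h2⟩
    obtain ⟨a, rfl⟩ := (d.upper_eq_self x).1 h1
    obtain ⟨b, hb⟩ := (e.lower_eq_self _).1 h2
    simp at hb
  obtain ⟨w, ⟨h1, h2, h3⟩, h4⟩ := glueGraph_existsUnique d.upper_involutive e.lower_involutive
    hne (outer v) ((fixed_iff_outer d e _).2 ⟨v, rfl⟩)
  obtain ⟨w, rfl⟩ := (fixed_iff_outer d e _).1 h3
  refine ⟨w, ⟨fun h => h1 (h ▸ rfl), h2⟩, fun y hy => outer_injective (h4 _ ⟨?_, hy.2, ?_⟩)⟩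
  · exact fun h => hy.1 (outer_injective h)
  · exact (fixed_iff_outer d e _).2 ⟨y, rfl⟩

/-- The diagram obtained by placing `d` above `e` and removing the middle row and the loops:
two outer dots are joined when a path joins them in the picture. -/
noncomputable def comp (d e : BrauerDiagram m) : BrauerDiagram m where
  mate v := (d.stack_existsUnique e v).choose
  mate_mate v := by
    set w := (d.stack_existsUnique e v).choose with hw
    have h := (d.stack_existsUnique e v).choose_spec.1
    exact ((d.stack_existsUnique e w).choose_spec.2 v ⟨h.1.symm, h.2.symm⟩).symm
  mate_ne v := (d.stack_existsUnique e v).choose_spec.1.1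

/-- The number of closed loops in the picture with `d` placed above `e`: the connected components
that contain no outer dot. -/
noncomputable def loops (d e : BrauerDiagram m) : ℕ :=
  Nat.card {c : (d.stack e).ConnectedComponent //
    ∀ v, (d.stack e).connectedComponentMk (outer v) ≠ c}

theorem comp_mate_reachable (d e : BrauerDiagram m) (v : Fin m ⊕ Fin m) :
    (d.stack e).Reachable (outer v) (outer ((d.comp e).mate v)) :=
  (d.stack_existsUnique e v).choose_spec.1.2

theorem reachable_outer (d e : BrauerDiagram m) {v w : Fin m ⊕ Fin m}
    (h : (d.stack e).Reachable (outer v) (outer w)) : w = v ∨ w = (d.comp e).mate v := by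
  by_cases hw : w = v
  · exact Or.inl hw
  · exact Or.inr ((d.stack_existsUnique e v).choose_spec.2 w ⟨hw, h⟩)

/-- The identity diagram. -/
def one (m : ℕ) : BrauerDiagram m where
  mate := Sum.swap
  mate_mate := Sum.swap_swap
  mate_ne := by rintro (a | a) <;> simp

/-- The diagram of the transposition of `a` and `b`. -/
def transp (a b : Fin m) : BrauerDiagram m where
  mate v := Sum.swap (Sum.map (Equiv.swap a b) (Equiv.swap a b) v)
  mate_mate := by rintro (c | c) <;> simp
  mate_ne := by rintro (c | c) <;> simp

/-- The diagram with an edge joining the dots `a` and `b` of the top row, an edge joining the dots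
`a` and `b` of the bottom row, and vertical edges elsewhere. -/
def contr (a b : Fin m) (hab : a ≠ b) : BrauerDiagram m where
  mate
    | Sum.inl c => if c = a then Sum.inl b else if c = b then Sum.inl a else Sum.inr c
    | Sum.inr c => if c = a then Sum.inr b else if c = b then Sum.inr a else Sum.inl c
  mate_mate := by
    rintro (c | c) <;> by_cases h1 : c = a <;> by_cases h2 : c = b <;>
      simp_all [hab.symm]
  mate_ne := by
    rintro (c | c) <;> by_cases h1 : c = a <;> by_cases h2 : c = b <;>
      simp_all [hab.symm]

/-! ### Associativity of the composition, by counting two-colourings -/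

open Classical in
/-- The matrix of compatibility of colourings of the top and of the bottom row. -/
noncomputable def colour (d : BrauerDiagram m) :
    Matrix (Fin m → Bool) (Fin m → Bool) ℕ :=
  Matrix.of fun i j => if ∀ v, Sum.elim i j (d.mate v) = Sum.elim i j v then 1 else 0

open Classical in
theorem colour_apply (d : BrauerDiagram m) (i j : Fin m → Bool) :
    d.colour i j = if ∀ v, Sum.elim i j (d.mate v) = Sum.elim i j v then 1 else 0 := rfl

theorem colour_smul_injective {d e : BrauerDiagram m} {p q : ℕ}
    (h : 2 ^ p • d.colour = 2 ^ q • e.colour) : d = e ∧ p = q := by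
  have h' : ∀ i j, 2 ^ p * d.colour i j = 2 ^ q * e.colour i j := fun i j => by
    simpa using congrFun (congrFun h i) j
  constructor
  · ext1; funext v
    let x : Fin m ⊕ Fin m → Bool := fun w => decide (w = v ∨ w = d.mate v)
    have hx : Sum.elim (fun a => x (Sum.inl a)) (fun a => x (Sum.inr a)) = x := by
      funext w; rcases w with w | w <;> rfl
    have h1 := h' (fun a => x (Sum.inl a)) (fun a => x (Sum.inr a))
    simp only [colour_apply, hx] at h1
    rw [if_pos] at h1
    · have h2 : ∀ w, x (e.mate w) = x w := by
        by_contra hc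
        rw [if_neg hc] at h1
        simp at h1
      have h3 := h2 v
      simp only [x, true_or, decide_true, decide_eq_true_eq] at h3
      rcases h3 with h3 | h3
      · exact absurd h3 (e.mate_ne v)
      · exact h3.symm
    · intro w
      simp only [x, decide_eq_decide]
      constructor
      · rintro (h | h)
        · right; rw [← h, d.mate_mate]
        · left; rw [← d.mate_mate w, h, d.mate_mate]
      · rintro (rfl | rfl)
        · exact Or.inr rfl
        · exact Or.inl (d.mate_mate v)
  · have h1 := h' (fun _ => true) (fun _ => true)
    have hx : (Sum.elim (fun _ => true) (fun _ => true) : Fin m ⊕ Fin m → Bool) = fun _ => true := by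
      funext w; rcases w with w | w <;> rfl
    simp only [colour_apply, hx] at h1
    simpa using h1

theorem colour_one : (one m).colour = 1 := by
  ext i j
  rw [colour_apply, Matrix.one_apply]
  congr 1
  simp only [eq_iff_iff]
  constructor
  · intro h; funext a; simpa [one] using (h (Sum.inl a)).symm
  · rintro rfl (a | a) <;> rfl

theorem compatible_iff (d e : BrauerDiagram m) (i k j : Fin m → Bool) :
    ((∀ v, Sum.elim i k (d.mate v) = Sum.elim i k v) ∧
      (∀ v, Sum.elim k j (e.mate v) = Sum.elim k j v)) ↔
    ∀ v w, (d.stack e).Reachable v w →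
      Sum.elim i (Sum.elim k j) v = Sum.elim i (Sum.elim k j) w := by
  have h0 : ∀ v : Fin m ⊕ Fin m,
      Sum.elim i (Sum.elim k j) (Sum.map id Sum.inl v) = Sum.elim i k v := by
    rintro (a | a) <;> rfl
  have h1 : ∀ v : Fin m ⊕ Fin m, d.upper (Sum.map id Sum.inl v) = Sum.map id Sum.inl (d.mate v) := by
    rintro (a | a) <;> rfl
  constructor
  · rintro ⟨hd, he⟩ v w hvw
    refine glueGraph_reachable_induction d.upper_involutive e.lower_involutive
      (fun w => Sum.elim i (Sum.elim k j) v = Sum.elim i (Sum.elim k j) w) ?_ ?_ hvw rfl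
    · intro u hu
      rw [hu]
      rcases u with a | a | a
      · have := hd (Sum.inl a); rw [← h0, ← h0, ← h1] at this; exact this.symm
      · have := hd (Sum.inr a); rw [← h0, ← h0, ← h1] at this; exact this.symm
      · rfl
    · intro u hu
      rw [hu]
      rcases u with a | a
      · rfl
      · exact (he a).symm
  · intro h
    constructor
    · intro v
      rw [← h0, ← h0, ← h1]
      exact (h _ _ (glueGraph_reachable_left _ _ _)).symm
    · intro v
      exact (h (Sum.inr v) _ (glueGraph_reachable_right _ _ _)).symm

/-- The number of colourings of the middle row compatible with given ones of the outer rows. -/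
theorem card_middle (d e : BrauerDiagram m) (i j : Fin m → Bool)
    (h : ∀ v, Sum.elim i j ((d.comp e).mate v) = Sum.elim i j v) :
    Nat.card {k : Fin m → Bool // (∀ v, Sum.elim i k (d.mate v) = Sum.elim i k v) ∧
      (∀ v, Sum.elim k j (e.mate v) = Sum.elim k j v)} = 2 ^ d.loops e := by
  classical
  let G := d.stack e
  let I := {c : G.ConnectedComponent // ∀ v, G.connectedComponentMk (outer v) ≠ c}
  let F : (I → Bool) → G.ConnectedComponent → Bool := fun g c =>
    if hc : ∀ v, G.connectedComponentMk (outer v) ≠ c then g ⟨c, hc⟩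
    else Sum.elim i j (not_forall.1 hc).choose
  have hF : ∀ g u, F g (G.connectedComponentMk (outer u)) = Sum.elim i j u := by
    intro g u
    have hc : ¬ ∀ v, G.connectedComponentMk (outer v) ≠ G.connectedComponentMk (outer u) :=
      fun hc => hc u rfl
    simp only [F, dif_neg hc]
    have h1 := not_not.1 (not_forall.1 hc).choose_spec
    rcases reachable_outer d e (SimpleGraph.ConnectedComponent.eq.1 h1.symm) with h2 | h2
    · rw [h2]
    · rw [h2, h]
  have helim : ∀ g, Sum.elim i (Sum.elim (fun a => F g (G.connectedComponentMk
      (Sum.inr (Sum.inl a)))) j) = fun v => F g (G.connectedComponentMk v) := by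
    intro g
    funext v
    rcases v with a | a | a
    · exact (hF g (Sum.inl a)).symm
    · rfl
    · exact (hF g (Sum.inr a)).symm
  let E : {k : Fin m → Bool // (∀ v, Sum.elim i k (d.mate v) = Sum.elim i k v) ∧
      (∀ v, Sum.elim k j (e.mate v) = Sum.elim k j v)} ≃ (I → Bool) :=
    { toFun := fun k c => Sum.elim i (Sum.elim k.1 j) c.1.out
      invFun := fun g => ⟨fun a => F g (G.connectedComponentMk (Sum.inr (Sum.inl a))), by
        rw [compatible_iff, helim]
        intro v w hvw
        exact congrArg (F g) (SimpleGraph.ConnectedComponent.eq.2 hvw)⟩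
      left_inv := by
        rintro ⟨k, hk⟩
        have hk' := (compatible_iff d e i k j).1 hk
        ext1
        funext a
        by_cases hc : ∀ v, G.connectedComponentMk (outer v) ≠
            G.connectedComponentMk (Sum.inr (Sum.inl a))
        · simp only [F, dif_pos hc]
          exact hk' _ (Sum.inr (Sum.inl a)) (SimpleGraph.ConnectedComponent.eq.1 (Quot.out_eq _))
        · obtain ⟨u, hu⟩ := not_forall.1 hc
          have hu := not_not.1 hu
          simp only [← hu, hF]
          have := hk' _ _ (SimpleGraph.ConnectedComponent.eq.1 hu)
          rcases u with u | u <;> exact this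
      right_inv := by
        intro g
        funext c
        simp only [helim]
        have : G.connectedComponentMk c.1.out = c.1 := Quot.out_eq _
        rw [this]
        simp only [F]
        rw [dif_pos c.2] }
  rw [Nat.card_congr E, Nat.card_fun]
  simp [loops, I, G]

theorem colour_mul (d e : BrauerDiagram m) :
    d.colour * e.colour = 2 ^ d.loops e • (d.comp e).colour := by
  classical
  ext i j
  rw [Matrix.mul_apply, Matrix.smul_apply]
  simp only [colour_apply, ← ite_and, mul_ite, mul_one, mul_zero]
  rw [Finset.sum_boole]
  split_ifs with h
  · rw [← card_middle d e i j h, Nat.card_eq_fintype_card, Fintype.card_subtype]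
    simp [and_comm]
  · simp only [Nat.cast_id, smul_zero, Finset.card_eq_zero, Finset.filter_eq_empty_iff]
    rintro k - hk
    apply h
    have hk' := (compatible_iff d e i k j).1 (by tauto)
    intro v
    have := hk' _ _ (comp_mate_reachable d e v)
    have h2 : ∀ u, Sum.elim i (Sum.elim k j) (outer u) = Sum.elim i j u := by
      rintro (u | u) <;> rfl
    rw [h2, h2] at this
    exact this.symm

theorem comp_assoc_loops (d e f : BrauerDiagram m) :
    (d.comp e).comp f = d.comp (e.comp f) ∧
      d.loops e + (d.comp e).loops f = e.loops f + d.loops (e.comp f) := by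
  apply colour_smul_injective
  have h := mul_assoc d.colour e.colour f.colour
  rw [colour_mul, colour_mul, Matrix.smul_mul, Matrix.mul_smul, colour_mul, colour_mul,
    smul_smul, smul_smul, ← pow_add, ← pow_add] at h
  exact h

theorem one_comp_loops (d : BrauerDiagram m) : (one m).comp d = d ∧ (one m).loops d = 0 := by
  apply colour_smul_injective
  rw [← colour_mul, colour_one, one_mul, pow_zero, one_smul]

theorem comp_one_loops (d : BrauerDiagram m) : d.comp (one m) = d ∧ d.loops (one m) = 0 := by
  apply colour_smul_injective
  rw [← colour_mul, colour_one, mul_one, pow_zero, one_smul]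

end BrauerDiagram

/-! ### The Brauer algebra -/

/-- The Brauer algebra over `R` with parameter `ω`: formal linear combinations of `m`-diagrams. -/
def BrauerAlgebra (R : Type*) [CommRing R] (_ω : R) (m : ℕ) : Type _ := BrauerDiagram m →₀ R

namespace BrauerAlgebra

section Ring

variable {R : Type*} [CommRing R] {ω : R} {m : ℕ}

noncomputable instance : AddCommGroup (BrauerAlgebra R ω m) :=
  inferInstanceAs (AddCommGroup (BrauerDiagram m →₀ R))

noncomputable instance : Module R (BrauerAlgebra R ω m) :=
  inferInstanceAs (Module R (BrauerDiagram m →₀ R))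

/-- A diagram as an element of the algebra. -/
noncomputable def diagram (d : BrauerDiagram m) : BrauerAlgebra R ω m := Finsupp.single d 1

/-- The coefficient of an element at a diagram. -/
def coeff (x : BrauerAlgebra R ω m) (d : BrauerDiagram m) : R :=
  (show BrauerDiagram m →₀ R from x) d

theorem hom_ext {M : Type*} [AddCommMonoid M] [Module R M] {f g : BrauerAlgebra R ω m →ₗ[R] M}
    (h : ∀ d, f (diagram d) = g (diagram d)) : f = g :=
  Finsupp.lhom_ext' fun d => LinearMap.ext_ring (h d)

/-- The linear map with prescribed values on the diagrams. -/
noncomputable def extend {M : Type*} [AddCommMonoid M] [Module R M] (f : BrauerDiagram m → M) :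
    BrauerAlgebra R ω m →ₗ[R] M :=
  Finsupp.linearCombination R f

theorem extend_diagram {M : Type*} [AddCommMonoid M] [Module R M] (f : BrauerDiagram m → M)
    (d : BrauerDiagram m) : extend f (diagram d : BrauerAlgebra R ω m) = f d :=
  (Finsupp.linearCombination_single R 1 d).trans (one_smul R _)

/-- The product: `d` times `e` is `ω ^ s` times the composed diagram, where `s` is the number of
closed loops, extended bilinearly. -/
noncomputable def mulMap (R : Type*) [CommRing R] (ω : R) (m : ℕ) :
    BrauerAlgebra R ω m →ₗ[R] BrauerAlgebra R ω m →ₗ[R] BrauerAlgebra R ω m :=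
  extend fun d => extend fun e => (ω ^ d.loops e) • diagram (d.comp e)

theorem mulMap_diagram (d e : BrauerDiagram m) :
    mulMap R ω m (diagram d) (diagram e) = (ω ^ d.loops e) • diagram (d.comp e) := by
  rw [mulMap, extend_diagram, extend_diagram]

theorem mulMap_assoc (x y z : BrauerAlgebra R ω m) :
    mulMap R ω m (mulMap R ω m x y) z = mulMap R ω m x (mulMap R ω m y z) := by
  have h : (LinearMap.compr₂ (mulMap R ω m) (mulMap R ω m)) =
      (LinearMap.llcomp R _ _ _).compl₂ (mulMap R ω m) ∘ₗ (mulMap R ω m) := by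
    refine hom_ext fun d => hom_ext fun e => hom_ext fun f => ?_
    obtain ⟨h1, h2⟩ := BrauerDiagram.comp_assoc_loops d e f
    simp only [LinearMap.compr₂_apply, LinearMap.comp_apply, LinearMap.compl₂_apply,
      LinearMap.llcomp_apply, mulMap_diagram, map_smul, LinearMap.smul_apply, smul_smul,
      ← pow_add, h1, h2]
  exact LinearMap.congr_fun (LinearMap.congr_fun (LinearMap.congr_fun h x) y) z

noncomputable instance : Mul (BrauerAlgebra R ω m) := ⟨fun x y => mulMap R ω m x y⟩

noncomputable instance : One (BrauerAlgebra R ω m) := ⟨diagram (BrauerDiagram.one m)⟩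

theorem mul_def (x y : BrauerAlgebra R ω m) : x * y = mulMap R ω m x y := rfl

theorem one_def : (1 : BrauerAlgebra R ω m) = diagram (BrauerDiagram.one m) := rfl

theorem diagram_mul_diagram (d e : BrauerDiagram m) :
    (diagram d * diagram e : BrauerAlgebra R ω m) = (ω ^ d.loops e) • diagram (d.comp e) :=
  mulMap_diagram d e

noncomputable instance : Ring (BrauerAlgebra R ω m) :=
  { (inferInstance : AddCommGroup (BrauerAlgebra R ω m)) with
    mul := (· * ·)
    one := 1
    left_distrib := fun x y z => map_add (mulMap R ω m x) y z
    right_distrib := fun x y z => LinearMap.map_add₂ (mulMap R ω m) x y z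
    zero_mul := fun x => LinearMap.map_zero₂ (mulMap R ω m) x
    mul_zero := fun x => map_zero (mulMap R ω m x)
    mul_assoc := mulMap_assoc
    one_mul := fun x => by
      have h : mulMap R ω m (diagram (BrauerDiagram.one m)) = LinearMap.id := hom_ext fun d => by
        obtain ⟨h1, h2⟩ := d.one_comp_loops
        simp [mulMap_diagram, h1, h2]
      exact LinearMap.congr_fun h x
    mul_one := fun x => by
      have h : (mulMap R ω m).flip (diagram (BrauerDiagram.one m)) = LinearMap.id :=
        hom_ext fun d => by
          obtain ⟨h1, h2⟩ := d.comp_one_loops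
          simp [mulMap_diagram, h1, h2]
      exact LinearMap.congr_fun h x }

noncomputable instance : Algebra R (BrauerAlgebra R ω m) :=
  Algebra.ofModule (fun r x y => LinearMap.map_smul₂ (mulMap R ω m) r x y)
    (fun r x y => map_smul (mulMap R ω m x) r y)

end Ring

/-- The element `s_{ab}` of the Brauer algebra. -/
noncomputable def s {R : Type*} [CommRing R] {ω : R} {m : ℕ} (a b : Fin m) :
    BrauerAlgebra R ω m := diagram (BrauerDiagram.transp a b)

/-- The element `ε_{ab}` of the Brauer algebra. -/
noncomputable def eps {R : Type*} [CommRing R] {ω : R} {m : ℕ} (a b : Fin m) (hab : a ≠ b) :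
    BrauerAlgebra R ω m := diagram (BrauerDiagram.contr a b hab)

/-! ### Jucys–Murphy elements and primitive idempotents -/

section Field

variable {K : Type*} [Field K] {ω : K} {m : ℕ}

/-- The Jucys–Murphy element `x_b = (ω - 1) / 2 + ∑_{a < b} (s_{ab} - ε_{ab})`. -/
noncomputable def jucysMurphy (ω : K) (b : Fin m) : BrauerAlgebra K ω m :=
  algebraMap K _ ((ω - 1) / 2) + ∑ a : {a : Fin m // a < b}, (s a.1 b - eps a.1 b a.2.ne)

/-- Extension of scalars from `K` to the field `K(u)` of rational functions, coefficient by
coefficient. -/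
noncomputable def toRatFunc (x : BrauerAlgebra K ω m) :
    BrauerAlgebra (RatFunc K) (RatFunc.C ω) m :=
  Finsupp.mapRange RatFunc.C (map_zero _) x

/-- All coefficients of `x` (rational functions over `K`) are well-defined at the point `c`. -/
def RegularAt {w : RatFunc K} (c : K) (x : BrauerAlgebra (RatFunc K) w m) : Prop :=
  ∀ d, (x.coeff d).denom.eval c ≠ 0

/-- Evaluation at the point `c` of the coefficients of `x`. The result lies in the Brauer algebra
over `K` whose parameter is any given `ω`. -/
noncomputable def evalCoeff {w : RatFunc K} (ω c : K) (x : BrauerAlgebra (RatFunc K) w m) :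
    BrauerAlgebra K ω m :=
  Finsupp.mapRange (RatFunc.eval (RingHom.id K) c) (RatFunc.eval_zero _ _) x

/-- The element `u - x` over the field `K(u)`. -/
noncomputable def uSub (x : BrauerAlgebra K ω m) : BrauerAlgebra (RatFunc K) (RatFunc.C ω) m :=
  algebraMap (RatFunc K) _ RatFunc.X - toRatFunc x

/-- The element `E * (u - c) / (u - x)` over the field `K(u)`. -/
noncomputable def fraction (E x : BrauerAlgebra K ω m) (c : K) :
    BrauerAlgebra (RatFunc K) (RatFunc.C ω) m :=
  toRatFunc E * ((RatFunc.X - RatFunc.C c : RatFunc K) • Ring.inverse (uSub x))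

/-- The content `(ω - 1) / 2 + j - i` of the box in row `i` and column `j`. -/
noncomputable def content (ω : K) (box : ℕ × ℕ) : K := (ω - 1) / 2 + box.2 - box.1

/-- The idempotent attached to the first `r` boxes of a standard tableau with `m` boxes. The
tableau is given by the list `T` of its boxes, `T a` being the box (row, column) that is added at
the step `a`. The recurrence is `E_T = E_U (u - c) / (u - x)` evaluated at `u = c`, where `U` is
`T` without the last box, `c` is the content of that box and `x` the Jucys–Murphy element of that
step. All the steps take place in the algebra on `m` dots, which contains the smaller ones. -/
noncomputable def idempotentStep (ω : K) (T : Fin m → ℕ × ℕ) :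
    (r : ℕ) → r ≤ m → BrauerAlgebra K ω m
  | 0, _ => 1
  | r + 1, h =>
    evalCoeff ω (content ω (T ⟨r, h⟩))
      (fraction (idempotentStep ω T r (Nat.le_of_succ_le h)) (jucysMurphy ω ⟨r, h⟩)
        (content ω (T ⟨r, h⟩)))

/-- The primitive idempotent `E_T`. -/
noncomputable def primitiveIdempotent (ω : K) (T : Fin m → ℕ × ℕ) : BrauerAlgebra K ω m :=
  idempotentStep ω T m le_rfl

/-- The recurrence for `E_T` makes sense: at each step `u - x` is invertible and the fraction has
no pole at the point of evaluation. -/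
def IdempotentDefined (ω : K) (T : Fin m → ℕ × ℕ) : Prop :=
  ∀ (r : ℕ) (h : r < m), IsUnit (uSub (jucysMurphy ω ⟨r, h⟩)) ∧
    RegularAt (content ω (T ⟨r, h⟩))
      (fraction (idempotentStep ω T r h.le) (jucysMurphy ω ⟨r, h⟩) (content ω (T ⟨r, h⟩)))

/-- The only standard tableau of the row shape `(m)`; rows and columns are counted from zero. -/
def rowTableau (m : ℕ) : Fin m → ℕ × ℕ := fun a => (0, a)

end Field

/-- The symmetrizer in the Brauer algebra over `ℂ(ω)` with the indeterminate parameter `ω`. -/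
noncomputable def genericSymmetrizer (m : ℕ) :
    BrauerAlgebra (RatFunc ℂ) RatFunc.X m :=
  primitiveIdempotent RatFunc.X (rowTableau m)

/-- The symmetrizer in the Brauer algebra over `ℂ` with the parameter specialized to `ω`. -/
noncomputable def symmetrizer (ω : ℂ) (m : ℕ) : BrauerAlgebra ℂ ω m :=
  evalCoeff ω ω (genericSymmetrizer m)

end BrauerAlgebra

/-! ### The action on tensors and the characteristic map -/

namespace SymplecticTensor

open BrauerAlgebra

/-- The algebra `End(V)^{⊗ m}` with `V = R^N`, realized by the matrices of operators on `V^{⊗ m}`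
in the canonical basis `e_{i_1} ⊗ … ⊗ e_{i_m}`. -/
abbrev TensorEnd (R : Type*) (N m : ℕ) : Type _ := Matrix (Fin m → Fin N) (Fin m → Fin N) R

section Ring

variable {R : Type*} [CommRing R] {N m : ℕ}

/-- The tensor product `A_1 ⊗ … ⊗ A_m`. -/
def tensor (A : Fin m → Matrix (Fin N) (Fin N) R) : TensorEnd R N m :=
  Matrix.of fun i j => ∏ a, A a (i a) (j a)

/-- `X_a = 1^{⊗ (a - 1)} ⊗ X ⊗ 1^{⊗ (m - a)}`. -/
def onFactor (a : Fin m) (X : Matrix (Fin N) (Fin N) R) : TensorEnd R N m :=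
  tensor (Function.update 1 a X)

/-- `1 ⊗ … ⊗ X ⊗ … ⊗ Y ⊗ … ⊗ 1` with `X` in the place `a` and `Y` in the place `b`. -/
def onFactors (a b : Fin m) (X Y : Matrix (Fin N) (Fin N) R) : TensorEnd R N m :=
  tensor (Function.update (Function.update 1 a X) b Y)

/-- `P_{ab}`, the sum over `i, j` of `e_{ij}` in the place `a` and `e_{ji}` in the place `b`. -/
def P (a b : Fin m) : TensorEnd R N m :=
  ∑ i : Fin N, ∑ j : Fin N, onFactors a b (Matrix.single i j 1) (Matrix.single j i 1)

/-- The sign `ε_i`, equal to `1` for the first `n` indices and to `-1` for the last `n` ones. -/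
def sgn (n : ℕ) (i : Fin (2 * n)) : R := if (i : ℕ) < n then 1 else -1

/-- `Q_{ab}`, the sum over `i, j` of `ε_i ε_j` times `e_{ij}` in the place `a` and `e_{i'j'}` in
the place `b`, where `i ↦ i'` reverses the order of the indices. -/
def Q (n : ℕ) (a b : Fin m) : TensorEnd R (2 * n) m :=
  ∑ i : Fin (2 * n), ∑ j : Fin (2 * n), (sgn n i * sgn n j : R) •
    onFactors a b (Matrix.single i j 1) (Matrix.single i.rev j.rev 1)

end Ring

/-- `ρ` is the action of the Brauer algebra with parameter `-2n` on the tensor space of `ℂ^{2n}`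
given by `s_{ab} ↦ -P_{ab}` and `ε_{ab} ↦ -Q_{ab}`. -/
def IsBrauerAction (n m : ℕ)
    (ρ : BrauerAlgebra ℂ (-(2 * n : ℂ)) m →ₐ[ℂ] TensorEnd ℂ (2 * n) m) : Prop :=
  ∀ (a b : Fin m) (h : a < b), ρ (s a b) = -P a b ∧ ρ (eps a b h.ne) = -Q n a b

/-- The matrix `Y = diag(y_1, …, y_n, -y_n, …, -y_1)` with indeterminates `y_i`. -/
noncomputable def genericCartan (n : ℕ) :
    Matrix (Fin (2 * n)) (Fin (2 * n)) (MvPolynomial (Fin n) ℂ) :=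
  Matrix.diagonal fun i => if h : (i : ℕ) < n then MvPolynomial.X ⟨i, h⟩
    else -MvPolynomial.X ⟨i.rev, by rw [Fin.val_rev]; omega⟩

/-- The characteristic map `C ↦ (1 / m!) tr (C Y_1 ⋯ Y_m)`, a polynomial in `y_1, …, y_n`. -/
noncomputable def charMap (n m : ℕ)
    (ρ : BrauerAlgebra ℂ (-(2 * n : ℂ)) m →ₐ[ℂ] TensorEnd ℂ (2 * n) m)
    (x : BrauerAlgebra ℂ (-(2 * n : ℂ)) m) : MvPolynomial (Fin n) ℂ :=
  MvPolynomial.C ((m.factorial : ℂ)⁻¹) * Matrix.trace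
    ((ρ x).map MvPolynomial.C * (List.ofFn fun a => onFactor a (genericCartan n)).prod)

end SymplecticTensor

/-!
Over any commutative ring, put `U_0 = 1` and `U_{r+1} = U_r (y + 1) (y + ω + r - 2)`, where
`y = ∑_{a < r} (s_{ar} - ε_{ar})` is the Jucys–Murphy element without its constant term and `r` is
the number of earlier dots. If `S` absorbs the transpositions and kills the contractions of the
first `r` dots, then `S (y + 1) (y + ω + r - 2)` does the same for the first `r + 1` dots
(`IsRightSymmetric.step`); it is computed by means of the factorization
`S (ω + 2r - 2 - ∑ ε_{ar}) (1 + ∑ s_{ar})`. Hence `U_{r+1} y = r U_{r+1}`, a cubic relation for `y`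
next to `U_r`, from which the fraction in the recurrence is found explicitly: the symmetrizer is
`U_m` divided by `∏_{k < m} (k + 1) (ω + 2k - 2)`. This product does not vanish at `ω = -2n` for
`m ≤ n`, so the symmetrizer can be specialized (`genericSymmetrizer_regular`).

The entries of the action of a diagram are terms of a Pfaffian: list the edges of the diagram,
direct them, and multiply the product of the values of an alternating form on the edges by the sign
of this list, viewed as a permutation of the dots. The result does not depend on the list
(`IsFraming.pfaffianTerm_eq`), which makes the signs in `s_{ab} ↦ -P_{ab}` and
`ε_{ab} ↦ -Q_{ab}` consistent. Multiplicativity has to be checked for right factors `s_{ab}` and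
`ε_{ab}` only, since these generate the algebra (`adjoin_generators`); the same fact gives
uniqueness.

The trace of the symmetrizer times `Y_1 ⋯ Y_m` only involves diagonal entries. They vanish at words
with a repeated letter, and they are invariant under permutations of the word, because the
symmetrizer acts by a symmetric matrix (`transpose_symOp`). So the pairs of opposite letters may be
assumed to be completed at the end of the word. Then the factorization above gives a recursion among
the diagonal entries alone (`symOp_succ_apply_self`), whose product telescopes to
`(n - m + 1) / (m! (n - m + c + 1))`, with `c` the number of pairs of opposite letters. In the sum
over sets of letters, the sets that contain some letter without its opposite cancel in pairs, as
exchanging a letter with its opposite changes the sign of the product of the entries of `Y`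
(`sum_pairs_eq_sum_diagonal`). What is left for `m = 2l` are the sets of `l` pairs of opposite
letters, each of which contributes `∏ (-y_p²)`.
-/

/-! ### Right multiplication of diagrams by transpositions and contractions -/

namespace BrauerDiagram

variable {m : ℕ}

/-- To identify the composition it suffices to exhibit paths in the picture. -/
theorem comp_eq_of_reachable {d e f : BrauerDiagram m}
    (h : ∀ v, (d.stack e).Reachable (outer v) (outer (f.mate v))) : d.comp e = f := by
  ext1
  funext v
  rcases reachable_outer d e (h v) with h1 | h1
  · exact absurd h1 (f.mate_ne v)
  · exact h1.symm

/-- The embedding of the dots of the upper diagram into the three rows. -/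
abbrev upperDot (v : Fin m ⊕ Fin m) : Rows m := Sum.map id Sum.inl v

theorem reachable_upperDot (d e : BrauerDiagram m) (v : Fin m ⊕ Fin m) :
    (d.stack e).Reachable (upperDot v) (upperDot (d.mate v)) := by
  have h := glueGraph_reachable_left d.upper e.lower (upperDot v)
  rcases v with a | a <;> exact h

theorem reachable_lowerDot (d e : BrauerDiagram m) (v : Fin m ⊕ Fin m) :
    (d.stack e).Reachable (Sum.inr v) (Sum.inr (e.mate v)) :=
  glueGraph_reachable_right d.upper e.lower (Sum.inr v)

theorem loops_eq_zero {d e : BrauerDiagram m}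
    (h : ∀ a, ∃ w, (d.stack e).Reachable (Sum.inr (Sum.inl a)) (outer w)) : d.loops e = 0 := by
  have : IsEmpty {c : (d.stack e).ConnectedComponent //
      ∀ v, (d.stack e).connectedComponentMk (outer v) ≠ c} := by
    refine ⟨?_⟩
    rintro ⟨c, hc⟩
    induction c using SimpleGraph.ConnectedComponent.ind with
    | h v =>
      rcases v with a | a | a
      · exact hc (Sum.inl a) rfl
      · obtain ⟨w, hw⟩ := h a
        exact hc w (SimpleGraph.ConnectedComponent.eq.2 hw.symm)
      · exact hc (Sum.inr a) rfl
  exact Nat.card_of_isEmpty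

/-- The diagram obtained from `d` by interchanging the dots `a` and `b` of the bottom row. -/
def swapBottom (d : BrauerDiagram m) (a b : Fin m) : BrauerDiagram m where
  mate v := Sum.map id (Equiv.swap a b) (d.mate (Sum.map id (Equiv.swap a b) v))
  mate_mate v := by
    have h : ∀ w : Fin m ⊕ Fin m,
        Sum.map id (Equiv.swap a b) (Sum.map id (Equiv.swap a b) w) = w := by
      rintro (w | w) <;> simp
    rw [h, d.mate_mate, h]
  mate_ne v h := by
    have h2 : ∀ w : Fin m ⊕ Fin m,
        Sum.map id (Equiv.swap a b) (Sum.map id (Equiv.swap a b) w) = w := by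
      rintro (w | w) <;> simp
    have := congrArg (Sum.map id (Equiv.swap a b)) h
    rw [h2] at this
    exact d.mate_ne _ this

/-- The diagram obtained from `d` by joining the dots `a` and `b` of the bottom row, and joining
the two dots that were connected with them before. -/
def joinBottom (d : BrauerDiagram m) (a b : Fin m) (hab : a ≠ b) : BrauerDiagram m where
  mate v := if v = Sum.inr a then Sum.inr b else if v = Sum.inr b then Sum.inr a
    else if d.mate v = Sum.inr a then d.mate (Sum.inr b)
    else if d.mate v = Sum.inr b then d.mate (Sum.inr a) else d.mate v
  mate_mate v := by
    have h1 := d.mate_mate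
    have h2 := d.mate_ne
    have h3 : (Sum.inr a : Fin m ⊕ Fin m) ≠ Sum.inr b := fun h => hab (Sum.inr_injective h)
    grind
  mate_ne v := by
    have h1 := d.mate_mate
    have h2 := d.mate_ne
    have h3 : (Sum.inr a : Fin m ⊕ Fin m) ≠ Sum.inr b := fun h => hab (Sum.inr_injective h)
    grind

theorem reachable_upperDot_transp (d : BrauerDiagram m) (a b : Fin m) (v : Fin m ⊕ Fin m) :
    (d.stack (transp a b)).Reachable (upperDot v) (outer (Sum.map id (Equiv.swap a b) v)) := by
  rcases v with c | c
  · exact SimpleGraph.Reachable.refl _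
  · exact reachable_lowerDot d (transp a b) (Sum.inl c)

theorem comp_transp (d : BrauerDiagram m) (a b : Fin m) :
    d.comp (transp a b) = d.swapBottom a b := by
  refine comp_eq_of_reachable fun v => ?_
  have h : v = Sum.map id (Equiv.swap a b) (Sum.map id (Equiv.swap a b) v) := by
    rcases v with w | w <;> simp
  have h1 := reachable_upperDot_transp d a b (Sum.map id (Equiv.swap a b) v)
  rw [← h] at h1
  exact (h1.symm.trans (reachable_upperDot _ _ _)).trans (reachable_upperDot_transp _ _ _ _)

theorem loops_transp (d : BrauerDiagram m) (a b : Fin m) : d.loops (transp a b) = 0 :=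
  loops_eq_zero fun c => ⟨_, reachable_upperDot_transp d a b (Sum.inr c)⟩

theorem reachable_upperDot_contr (d : BrauerDiagram m) {a b : Fin m} (hab : a ≠ b)
    {v : Fin m ⊕ Fin m} (ha : v ≠ Sum.inr a) (hb : v ≠ Sum.inr b) :
    (d.stack (contr a b hab)).Reachable (upperDot v) (outer v) := by
  rcases v with c | c
  · exact SimpleGraph.Reachable.refl _
  · have h := reachable_lowerDot d (contr a b hab) (Sum.inl c)
    have hca : c ≠ a := fun h => ha (congrArg _ h)
    have hcb : c ≠ b := fun h => hb (congrArg _ h)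
    simpa [contr, outer, hca, hcb] using h

theorem reachable_contr_middle (d : BrauerDiagram m) {a b : Fin m} (hab : a ≠ b) :
    (d.stack (contr a b hab)).Reachable (upperDot (Sum.inr a)) (upperDot (Sum.inr b)) := by
  simpa [contr] using reachable_lowerDot d (contr a b hab) (Sum.inl a)

theorem reachable_contr_bottom (d : BrauerDiagram m) {a b : Fin m} (hab : a ≠ b) :
    (d.stack (contr a b hab)).Reachable (outer (Sum.inr a)) (outer (Sum.inr b)) := by
  simpa [contr, outer] using reachable_lowerDot d (contr a b hab) (Sum.inr a)

theorem comp_contr (d : BrauerDiagram m) {a b : Fin m} (hab : a ≠ b) :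
    d.comp (contr a b hab) = d.joinBottom a b hab := by
  refine comp_eq_of_reachable fun v => ?_
  have h1 := d.mate_mate
  have h2 := d.mate_ne
  have h3 : (Sum.inr a : Fin m ⊕ Fin m) ≠ Sum.inr b := fun h => hab (Sum.inr_injective h)
  simp only [joinBottom]
  split_ifs with ha hb hda hdb
  · rw [ha]; exact reachable_contr_bottom d hab
  · rw [hb]; exact (reachable_contr_bottom d hab).symm
  · have h4 := (reachable_upperDot_contr d hab ha hb).symm.trans (reachable_upperDot _ _ _)
    rw [hda] at h4
    refine (h4.trans (reachable_contr_middle d hab)).trans ((reachable_upperDot _ _ _).trans ?_)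
    exact reachable_upperDot_contr d hab (by grind) (by grind)
  · have h4 := (reachable_upperDot_contr d hab ha hb).symm.trans (reachable_upperDot _ _ _)
    rw [hdb] at h4
    refine (h4.trans (reachable_contr_middle d hab).symm).trans
      ((reachable_upperDot _ _ _).trans ?_)
    exact reachable_upperDot_contr d hab (by grind) (by grind)
  · exact ((reachable_upperDot_contr d hab ha hb).symm.trans (reachable_upperDot _ _ _)).trans
      (reachable_upperDot_contr d hab hda hdb)

theorem loops_contr_of_ne (d : BrauerDiagram m) {a b : Fin m} (hab : a ≠ b)
    (h : d.mate (Sum.inr a) ≠ Sum.inr b) : d.loops (contr a b hab) = 0 := by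
  have h1 := d.mate_mate
  have h2 := d.mate_ne
  have h3 : (Sum.inr a : Fin m ⊕ Fin m) ≠ Sum.inr b := fun h => hab (Sum.inr_injective h)
  have ha : (d.stack (contr a b hab)).Reachable (upperDot (Sum.inr a))
      (outer (d.mate (Sum.inr a))) :=
    (reachable_upperDot _ _ _).trans (reachable_upperDot_contr d hab (h2 _) h)
  refine loops_eq_zero fun c => ?_
  by_cases hca : c = a
  · subst hca; exact ⟨_, ha⟩
  by_cases hcb : c = b
  · subst hcb; exact ⟨_, (reachable_contr_middle d hab).symm.trans ha⟩
  · exact ⟨_, reachable_upperDot_contr d hab (v := Sum.inr c) (by simpa) (by simpa)⟩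

/-- If the dots `a` and `b` of the bottom row are joined in `d`, then placing `d` above the
contraction of `a` and `b` creates exactly one loop. The loops are counted by two-colourings. -/
theorem loops_contr_of_eq (d : BrauerDiagram m) {a b : Fin m} (hab : a ≠ b)
    (h : d.mate (Sum.inr a) = Sum.inr b) : d.loops (contr a b hab) = 1 := by
  classical
  have h1 := d.mate_mate
  have hcomp : d.comp (contr a b hab) = d := by
    rw [comp_contr]; ext1; funext v; simp only [joinBottom]
    have h2 := d.mate_ne
    have h3 : (Sum.inr a : Fin m ⊕ Fin m) ≠ Sum.inr b := fun h => hab (Sum.inr_injective h)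
    grind
  have key := card_middle d (contr a b hab) (fun _ => true) (fun _ => true) (by
    have hx : (Sum.elim (fun _ => true) (fun _ => true) : Fin m ⊕ Fin m → Bool) =
      fun _ => true := by
      funext w; rcases w with w | w <;> rfl
    simp [hx])
  have e : {k : Fin m → Bool //
      (∀ v, Sum.elim (fun _ => true) k (d.mate v) = Sum.elim (fun _ => true) k v) ∧
      (∀ v, Sum.elim k (fun _ => true) ((contr a b hab).mate v) =
        Sum.elim k (fun _ => true) v)} ≃ Bool :=
    { toFun := fun k => k.1 a
      invFun := fun t => ⟨fun c => if c = a ∨ c = b then t else true, by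
        constructor
        · intro v
          have h5 : ∀ v : Fin m ⊕ Fin m, Sum.elim (fun _ => true)
              (fun c => if c = a ∨ c = b then t else true) v =
              if v = Sum.inr a ∨ v = Sum.inr b then t else true := by
            rintro (v | v) <;> simp
          rw [h5, h5]
          have h2 := d.mate_ne
          congr 1
          grind
        · rintro (v | v)
          · simp only [contr]
            by_cases hva : v = a
            · simp [hva]
            · by_cases hvb : v = b <;> simp [hva, hvb, hab.symm]
          · simp only [contr]
            by_cases hva : v = a
            · simp [hva]
            · by_cases hvb : v = b <;> simp [hva, hvb, hab.symm]⟩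
      left_inv := by
        rintro ⟨k, hk1, hk2⟩
        ext1
        funext c
        by_cases hca : c = a
        · simp [hca]
        · have h6 := hk2 (Sum.inl c)
          by_cases hcb : c = b
          · subst hcb
            simpa [contr, hca] using h6
          · simpa [contr, hca, hcb] using h6
      right_inv := fun t => by simp }
  rw [Nat.card_congr e] at key
  have h7 : 2 ^ 1 = 2 ^ d.loops (contr a b hab) := by simpa using key
  exact (Nat.pow_right_injective le_rfl h7).symm

theorem comp_contr_of_eq (d : BrauerDiagram m) {a b : Fin m} (hab : a ≠ b)
    (h : d.mate (Sum.inr a) = Sum.inr b) : d.comp (contr a b hab) = d := by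
  rw [comp_contr]; ext1; funext v; simp only [joinBottom]
  have h1 := d.mate_mate
  have h2 := d.mate_ne
  have h3 : (Sum.inr a : Fin m ⊕ Fin m) ≠ Sum.inr b := fun h => hab (Sum.inr_injective h)
  grind

end BrauerDiagram

namespace BrauerAlgebra

open BrauerDiagram

variable {R : Type*} [CommRing R] {ω : R} {m : ℕ}

theorem diagram_mul_s (d : BrauerDiagram m) (a b : Fin m) :
    (diagram d * s a b : BrauerAlgebra R ω m) = diagram (d.swapBottom a b) := by
  rw [s, diagram_mul_diagram, loops_transp, comp_transp, pow_zero, one_smul]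

theorem diagram_mul_eps_of_ne (d : BrauerDiagram m) {a b : Fin m} (hab : a ≠ b)
    (h : d.mate (Sum.inr a) ≠ Sum.inr b) :
    (diagram d * eps a b hab : BrauerAlgebra R ω m) = diagram (d.joinBottom a b hab) := by
  rw [eps, diagram_mul_diagram, loops_contr_of_ne d hab h, comp_contr, pow_zero, one_smul]

theorem diagram_mul_eps_of_eq (d : BrauerDiagram m) {a b : Fin m} (hab : a ≠ b)
    (h : d.mate (Sum.inr a) = Sum.inr b) :
    (diagram d * eps a b hab : BrauerAlgebra R ω m) = ω • diagram d := by
  rw [eps, diagram_mul_diagram, loops_contr_of_eq d hab h, comp_contr_of_eq d hab h, pow_one]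

end BrauerAlgebra

/-! ### Relations between transpositions and contractions -/

namespace BrauerAlgebra

open BrauerDiagram

variable {R : Type*} [CommRing R] {ω : R} {m : ℕ}

theorem s_comm (a b : Fin m) : (s a b : BrauerAlgebra R ω m) = s b a := by
  rw [s, s]
  congr 1
  ext1
  funext v
  simp only [transp, Equiv.swap_comm]

theorem eps_comm {a b : Fin m} (hab : a ≠ b) :
    (eps a b hab : BrauerAlgebra R ω m) = eps b a hab.symm := by
  rw [eps, eps]
  congr 1
  ext1
  funext v
  simp only [contr]
  rcases v with v | v <;> grind

theorem s_mul_self (a b : Fin m) : (s a b * s a b : BrauerAlgebra R ω m) = 1 := by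
  conv_lhs => arg 1; rw [s]
  rw [diagram_mul_s, one_def]
  congr 1
  ext1
  funext v
  rcases v with v | v <;> simp [swapBottom, transp, BrauerDiagram.one]

theorem s_mul_s {a b c : Fin m} (hab : a ≠ b) (hac : a ≠ c) (hbc : b ≠ c) :
    (s a c * s b c : BrauerAlgebra R ω m) = s a b * s a c := by
  have h : ∀ a b : Fin m, (s a b : BrauerAlgebra R ω m) = diagram (transp a b) := fun _ _ => rfl
  rw [h a c, h a b, diagram_mul_s, ← h a c, diagram_mul_s]
  congr 1
  ext1
  funext v
  rcases v with v | v <;> simp only [swapBottom, transp, Sum.map_inl, Sum.map_inr, Sum.swap_inl,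
    Sum.swap_inr, id, Equiv.swap_apply_def] <;> grind

theorem eps_mul_self {a b : Fin m} (hab : a ≠ b) :
    (eps a b hab * eps a b hab : BrauerAlgebra R ω m) = ω • eps a b hab :=
  diagram_mul_eps_of_eq _ hab (by simp [contr])

theorem eps_mul_eps {a b c : Fin m} (hab : a ≠ b) (hac : a ≠ c) (hbc : b ≠ c) :
    (eps a c hac * eps b c hbc : BrauerAlgebra R ω m) = s a b * eps b c hbc := by
  have h1 : (eps a c hac * eps b c hbc : BrauerAlgebra R ω m) = _ :=
    diagram_mul_eps_of_ne (contr a c hac) hbc (by simp [contr]; grind)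
  have h2 : (s a b * eps b c hbc : BrauerAlgebra R ω m) = _ :=
    diagram_mul_eps_of_ne (transp a b) hbc (by simp [transp])
  rw [h1, h2]
  congr 1
  ext1
  funext v
  rcases v with v | v <;>
    simp only [joinBottom, contr, transp, Sum.map_inl, Sum.map_inr,
      Sum.swap_inl, Sum.swap_inr, Equiv.swap_apply_def] <;>
    grind

theorem s_mul_eps {a b c : Fin m} (hab : a ≠ b) (hac : a ≠ c) (hbc : b ≠ c) :
    (s a c * eps b c hbc : BrauerAlgebra R ω m) = eps a b hab * s a c := by
  have h1 : (s a c * eps b c hbc : BrauerAlgebra R ω m) = _ :=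
    diagram_mul_eps_of_ne (transp a c) hbc (by simp [transp])
  have h2 : (eps a b hab * s a c : BrauerAlgebra R ω m) = _ :=
    diagram_mul_s (contr a b hab) a c
  rw [h1, h2]
  congr 1
  ext1
  funext v
  rcases v with v | v <;>
    simp only [joinBottom, swapBottom, contr, transp, Sum.map_inl, Sum.map_inr,
      Sum.swap_inl, Sum.swap_inr, id, Equiv.swap_apply_def] <;>
    grind

theorem s_mul_eps_self {a b : Fin m} (hab : a ≠ b) :
    (s a b * eps a b hab : BrauerAlgebra R ω m) = eps a b hab := by
  have h1 : (s a b * eps a b hab : BrauerAlgebra R ω m) = _ :=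
    diagram_mul_eps_of_ne (transp a b) hab (by simp [transp])
  rw [h1, eps]
  congr 1
  ext1
  funext v
  rcases v with v | v <;>
    simp only [joinBottom, contr, transp, Sum.map_inl, Sum.map_inr,
      Sum.swap_inl, Sum.swap_inr, Equiv.swap_apply_def] <;>
    grind

theorem s_mul_eps_of_disjoint {a b c d : Fin m} (hac : a ≠ c) (had : a ≠ d)
    (hbc : b ≠ c) (hbd : b ≠ d) (hcd : c ≠ d) :
    (s a b * eps c d hcd : BrauerAlgebra R ω m) = eps c d hcd * s a b := by
  have h1 : (s a b * eps c d hcd : BrauerAlgebra R ω m) = _ :=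
    diagram_mul_eps_of_ne (transp a b) hcd (by simp [transp])
  have h2 : (eps c d hcd * s a b : BrauerAlgebra R ω m) = _ :=
    diagram_mul_s (contr c d hcd) a b
  rw [h1, h2]
  congr 1
  ext1
  funext v
  rcases v with v | v <;>
    simp only [joinBottom, swapBottom, contr, transp, Sum.map_inl, Sum.map_inr,
      Sum.swap_inl, Sum.swap_inr, id, Equiv.swap_apply_def] <;>
    grind

theorem eps_mul_eps_of_disjoint {a b c d : Fin m} (hab : a ≠ b) (hac : a ≠ c) (had : a ≠ d)
    (hbc : b ≠ c) (hbd : b ≠ d) (hcd : c ≠ d) :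
    (eps a b hab * eps c d hcd : BrauerAlgebra R ω m) = eps c d hcd * eps a b hab := by
  have h1 : (eps a b hab * eps c d hcd : BrauerAlgebra R ω m) = _ :=
    diagram_mul_eps_of_ne (contr a b hab) hcd (by simp [contr]; grind)
  have h2 : (eps c d hcd * eps a b hab : BrauerAlgebra R ω m) = _ :=
    diagram_mul_eps_of_ne (contr c d hcd) hab (by simp [contr]; grind)
  rw [h1, h2]
  congr 1
  ext1
  funext v
  rcases v with v | v <;>
    simp only [joinBottom, contr] <;>
    grind

theorem eps_mul_eps_mul_s {a b c : Fin m} (hab : a ≠ b) (hac : a ≠ c) (hbc : b ≠ c) :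
    (eps a c hac * (eps a b hab * s a c) : BrauerAlgebra R ω m) = s a b * eps b c hbc := by
  rw [← s_mul_eps hab hac hbc, ← mul_assoc]
  have h1 : (eps a c hac * s a c : BrauerAlgebra R ω m) = eps a c hac := by
    rw [eps, diagram_mul_s]
    congr 1
    ext1
    funext v
    rcases v with v | v <;> simp only [swapBottom, contr, Sum.map_inl, Sum.map_inr, id,
      Equiv.swap_apply_def] <;> grind
  rw [h1, eps_mul_eps hab]

theorem eps_mul_eps_mul_s' {a b c : Fin m} (hab : a ≠ b) (hac : a ≠ c) (hbc : b ≠ c) :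
    (eps b c hbc * (eps a b hab * s a c) : BrauerAlgebra R ω m) = eps b c hbc := by
  have h : (eps b c hbc * eps a b hab : BrauerAlgebra R ω m) = s c a * eps b a hab.symm := by
    rw [eps_comm hbc, eps_mul_eps hac.symm hbc.symm hab, eps_comm hab]
  rw [← mul_assoc, h, s_mul_eps hbc.symm hac.symm hab.symm, mul_assoc, s_comm a c, s_mul_self,
    mul_one, eps_comm hbc]

end BrauerAlgebra

/-! ### The recursion step of the symmetrizer -/

namespace BrauerAlgebra

open BrauerDiagram

variable {R : Type*} [CommRing R] {ω : R} {m : ℕ}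

/-- The sum of the transpositions `s_{ar}` over `a < r`. -/
noncomputable def transpSum (ω : R) (r : Fin m) : BrauerAlgebra R ω m :=
  ∑ a : {a : Fin m // a < r}, s a.1 r

/-- The sum of the contractions `ε_{ar}` over `a < r`. -/
noncomputable def contrSum (ω : R) (r : Fin m) : BrauerAlgebra R ω m :=
  ∑ a : {a : Fin m // a < r}, eps a.1 r a.2.ne

/-- The Jucys–Murphy element without its constant term, `∑_{a < r} (s_{ar} - ε_{ar})`. It makes
sense over any commutative ring. -/
noncomputable def reducedJM (ω : R) (r : Fin m) : BrauerAlgebra R ω m :=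
  transpSum ω r - contrSum ω r

/-- `S` behaves under right multiplication like a symmetrizer on the first `r` dots: it absorbs the
transpositions and kills the contractions of these dots. -/
def IsRightSymmetric (r : ℕ) (S : BrauerAlgebra R ω m) : Prop :=
  ∀ (a b : Fin m) (hab : a ≠ b), (a : ℕ) < r → (b : ℕ) < r →
    S * s a b = S ∧ S * eps a b hab = 0

theorem card_lt (r : Fin m) : Fintype.card {a : Fin m // a < r} = r := by
  have h : (Finset.univ.filter fun a : Fin m => a < r) = Finset.Iio r := by ext; simp
  rw [Fintype.card_subtype, h, Fin.card_Iio]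

variable {r : Fin m} {S : BrauerAlgebra R ω m}

theorem IsRightSymmetric.mul_s_mul_s (hS : IsRightSymmetric r S)
    (a b : {a : Fin m // a < r}) :
    S * s a.1 r * s b.1 r = if a = b then S else S * s a.1 r := by
  split_ifs with h
  · rw [h, mul_assoc, s_mul_self, mul_one]
  · have hab : a.1 ≠ b.1 := fun h' => h (Subtype.ext h')
    rw [mul_assoc, s_mul_s hab a.2.ne b.2.ne, ← mul_assoc, (hS _ _ hab a.2 b.2).1]

theorem IsRightSymmetric.mul_s_mul_eps (hS : IsRightSymmetric r S)
    (a b : {a : Fin m // a < r}) :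
    S * s a.1 r * eps b.1 r b.2.ne = if a = b then S * eps a.1 r a.2.ne else 0 := by
  split_ifs with h
  · rw [h, mul_assoc, s_mul_eps_self]
  · have hab : a.1 ≠ b.1 := fun h' => h (Subtype.ext h')
    rw [mul_assoc, s_mul_eps hab a.2.ne b.2.ne, ← mul_assoc, (hS _ _ hab a.2 b.2).2, zero_mul]

theorem IsRightSymmetric.mul_eps_mul_eps (hS : IsRightSymmetric r S)
    (a b : {a : Fin m // a < r}) :
    S * eps a.1 r a.2.ne * eps b.1 r b.2.ne =
      if a = b then ω • (S * eps a.1 r a.2.ne) else S * eps b.1 r b.2.ne := by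
  split_ifs with h
  · rw [h, mul_assoc, eps_mul_self, mul_smul_comm]
  · have hab : a.1 ≠ b.1 := fun h' => h (Subtype.ext h')
    rw [mul_assoc, eps_mul_eps hab a.2.ne b.2.ne, ← mul_assoc, (hS _ _ hab a.2 b.2).1]

theorem IsRightSymmetric.mul_transpSum_mul_transpSum (hS : IsRightSymmetric r S) :
    S * transpSum ω r * transpSum ω r =
      (r : R) • S + ((r : R) - 1) • (S * transpSum ω r) := by
  simp only [transpSum, Finset.mul_sum, Finset.sum_mul]
  have h : ∀ a b : {a : Fin m // a < r}, (if a = b then S else S * s a.1 r) =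
      S * s a.1 r + if a = b then S - S * s a.1 r else 0 := by
    intro a b; split_ifs <;> simp
  simp only [hS.mul_s_mul_s, h, Finset.sum_add_distrib,
    Finset.sum_ite_eq', Finset.mem_univ, if_true, Finset.sum_sub_distrib, Finset.sum_const,
    Finset.card_univ, card_lt, ← Nat.cast_smul_eq_nsmul R]
  module

theorem IsRightSymmetric.mul_transpSum_mul_contrSum (hS : IsRightSymmetric r S) :
    S * transpSum ω r * contrSum ω r = S * contrSum ω r := by
  simp only [transpSum, contrSum, Finset.mul_sum, Finset.sum_mul]
  simp_rw [hS.mul_s_mul_eps, Finset.sum_ite_eq', Finset.mem_univ, if_true]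

theorem IsRightSymmetric.mul_contrSum_mul_eps (hS : IsRightSymmetric r S)
    (b : {a : Fin m // a < r}) :
    S * contrSum ω r * eps b.1 r b.2.ne = (ω + r - 1) • (S * eps b.1 r b.2.ne) := by
  simp only [contrSum, Finset.mul_sum, Finset.sum_mul]
  simp_rw [hS.mul_eps_mul_eps]
  have h : ∀ a : {a : Fin m // a < r},
      (if a = b then ω • (S * eps a.1 r a.2.ne) else S * eps b.1 r b.2.ne) =
      S * eps b.1 r b.2.ne + if a = b then (ω - 1) • (S * eps b.1 r b.2.ne) else 0 := by
    intro a; split_ifs with h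
    · subst h; module
    · simp
  simp_rw [h, Finset.sum_add_distrib, Finset.sum_ite_eq', Finset.sum_const, Finset.mem_univ,
    if_true, Finset.card_univ, card_lt, ← Nat.cast_smul_eq_nsmul R]
  module

theorem IsRightSymmetric.mul_contrSum_mul_contrSum (hS : IsRightSymmetric r S) :
    S * contrSum ω r * contrSum ω r = (ω + r - 1) • (S * contrSum ω r) := by
  conv_lhs => arg 2; rw [contrSum]
  rw [Finset.mul_sum]
  simp_rw [hS.mul_contrSum_mul_eps]
  rw [contrSum, Finset.mul_sum, Finset.smul_sum]

/-- The quadratic expression in the Jucys–Murphy element factors modulo what `S` absorbs. -/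
theorem IsRightSymmetric.mul_quadratic (hS : IsRightSymmetric r S) :
    S * ((reducedJM ω r + 1) * (reducedJM ω r + algebraMap R _ (ω + r - 2))) =
      S * (algebraMap R _ (ω + 2 * r - 2) - contrSum ω r) * (1 + transpSum ω r) := by
  have h1 := hS.mul_transpSum_mul_transpSum
  have h2 := hS.mul_transpSum_mul_contrSum
  have h3 := hS.mul_contrSum_mul_contrSum
  simp only [reducedJM, Algebra.algebraMap_eq_smul_one, mul_add, add_mul, mul_sub, sub_mul,
    mul_one, one_mul, mul_smul_comm, smul_mul_assoc, ← mul_assoc, h1, h2, h3]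
  module

theorem s_mul_contrSum (a b : {a : Fin m // a < r}) (hab : a.1 ≠ b.1) :
    s a.1 b.1 * contrSum ω r = contrSum ω r * s a.1 b.1 := by
  rw [contrSum, Finset.mul_sum, Finset.sum_mul]
  refine Fintype.sum_equiv (Equiv.swap a b) _ _ fun c => ?_
  have hconj : ∀ a b : {a : Fin m // a < r}, a.1 ≠ b.1 →
      (s a.1 b.1 * eps a.1 r a.2.ne : BrauerAlgebra R ω m) = eps b.1 r b.2.ne * s a.1 b.1 := by
    intro a b hab
    rw [s_comm, eps_comm, s_mul_eps b.2.ne hab.symm a.2.ne.symm]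
  by_cases hca : c = a
  · rw [hca, Equiv.swap_apply_left]
    exact hconj a b hab
  by_cases hcb : c = b
  · rw [hcb, Equiv.swap_apply_right, s_comm]
    exact hconj b a hab.symm
  · rw [Equiv.swap_apply_of_ne_of_ne hca hcb]
    exact s_mul_eps_of_disjoint (fun h => hca (Subtype.ext h.symm)) a.2.ne
      (fun h => hcb (Subtype.ext h.symm)) b.2.ne _

theorem IsRightSymmetric.mul_contrSum_mul_s (hS : IsRightSymmetric r S)
    (a b : {a : Fin m // a < r}) (hab : a.1 ≠ b.1) :
    S * contrSum ω r * s a.1 b.1 = S * contrSum ω r := by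
  rw [mul_assoc, ← s_mul_contrSum a b hab, ← mul_assoc, (hS _ _ hab a.2 b.2).1]

/-- The elements `1` and `s_{ar}` represent the cosets of the symmetric group on `r` dots in the one
on `r + 1` dots, so multiplication with their sum extends the invariance of `T`. -/
theorem mul_transp_coset (T : BrauerAlgebra R ω m)
    (hT : ∀ a b : {a : Fin m // a < r}, a.1 ≠ b.1 → T * s a.1 b.1 = T)
    (b : {a : Fin m // a < r}) :
    T * (1 + transpSum ω r) * s b.1 r = T * (1 + transpSum ω r) := by
  have h : ∀ a : {a : Fin m // a < r}, T * s a.1 r * s b.1 r =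
      T * s a.1 r + if a = b then T - T * s b.1 r else 0 := by
    intro a
    split_ifs with h
    · rw [h, mul_assoc, s_mul_self, mul_one, add_sub_cancel]
    · have hab : a.1 ≠ b.1 := fun h' => h (Subtype.ext h')
      rw [mul_assoc, s_mul_s hab a.2.ne b.2.ne, ← mul_assoc, hT _ _ hab, add_zero]
  simp only [transpSum, mul_add, add_mul, mul_one, Finset.mul_sum, Finset.sum_mul, h,
    Finset.sum_add_distrib, Finset.sum_ite_eq', Finset.mem_univ, if_true]
  abel

theorem IsRightSymmetric.mul_contrSum_mul_s_mul_eps (hS : IsRightSymmetric r S)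
    {a b : {a : Fin m // a < r}} (hab : a.1 ≠ b.1) :
    S * contrSum ω r * (s a.1 r * eps b.1 r b.2.ne) = (2 : R) • (S * eps b.1 r b.2.ne) := by
  have h : ∀ c : {a : Fin m // a < r},
      S * eps c.1 r c.2.ne * (eps a.1 b.1 hab * s a.1 r) =
        (if c = a then S * eps b.1 r b.2.ne else 0) +
          if c = b then S * eps b.1 r b.2.ne else 0 := by
    intro c
    by_cases hca : c = a
    · have hcb : c ≠ b := fun h => hab (by rw [← hca, h])
      rw [if_pos hca, if_neg hcb, hca, mul_assoc, eps_mul_eps_mul_s hab a.2.ne b.2.ne, ← mul_assoc,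
        (hS _ _ hab a.2 b.2).1, add_zero]
    by_cases hcb : c = b
    · rw [if_neg hca, if_pos hcb, hcb, mul_assoc, eps_mul_eps_mul_s' hab a.2.ne b.2.ne, zero_add]
    · rw [if_neg hca, if_neg hcb, mul_assoc, ← mul_assoc (eps _ _ _),
        eps_mul_eps_of_disjoint c.2.ne (fun h => hca (Subtype.ext h))
          (fun h => hcb (Subtype.ext h)) a.2.ne.symm b.2.ne.symm hab, ← mul_assoc, ← mul_assoc,
        (hS _ _ hab a.2 b.2).2, zero_mul, zero_mul, add_zero]
  rw [s_mul_eps hab a.2.ne b.2.ne, contrSum, Finset.mul_sum, Finset.sum_mul]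
  simp_rw [h, Finset.sum_add_distrib, Finset.sum_ite_eq', Finset.mem_univ, if_true]
  module

/-- The step of the recursion preserves the characteristic property of the symmetrizer. -/
theorem IsRightSymmetric.step (hS : IsRightSymmetric r S) :
    IsRightSymmetric (r + 1)
      (S * ((reducedJM ω r + 1) * (reducedJM ω r + algebraMap R _ (ω + r - 2)))) := by
  rw [hS.mul_quadratic]
  set T := S * (algebraMap R _ (ω + 2 * r - 2) - contrSum ω r) with hT
  have hTs : ∀ a b : {a : Fin m // a < r}, a.1 ≠ b.1 → T * s a.1 b.1 = T := by
    intro a b hab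
    rw [hT, mul_sub, sub_mul, hS.mul_contrSum_mul_s a b hab, mul_assoc, Algebra.commutes,
      ← mul_assoc, (hS _ _ hab a.2 b.2).1]
  have h1 := mul_transp_coset T hTs
  have h2 : ∀ b : {a : Fin m // a < r}, T * (1 + transpSum ω r) * eps b.1 r b.2.ne = 0 := by
    intro b
    have h3 : ∀ a : {a : Fin m // a < r}, T * s a.1 r * eps b.1 r b.2.ne =
        (if a = b then T * eps b.1 r b.2.ne + (2 : R) • (S * eps b.1 r b.2.ne) else 0) -
          (2 : R) • (S * eps b.1 r b.2.ne) := by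
      intro a
      by_cases hab : a = b
      · rw [if_pos hab, hab, mul_assoc, s_mul_eps_self, add_sub_cancel_right]
      · have hab' : a.1 ≠ b.1 := fun h' => hab (Subtype.ext h')
        rw [if_neg hab, mul_assoc, hT, mul_sub, sub_mul, hS.mul_contrSum_mul_s_mul_eps hab',
          s_mul_eps hab' a.2.ne b.2.ne, Algebra.algebraMap_eq_smul_one, mul_smul_comm, mul_one,
          smul_mul_assoc, ← mul_assoc, (hS _ _ hab' a.2 b.2).2, zero_mul, smul_zero]
    have h4 : T * eps b.1 r b.2.ne = ((r : R) - 1) • (S * eps b.1 r b.2.ne) := by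
      rw [hT, mul_sub, sub_mul, hS.mul_contrSum_mul_eps, Algebra.algebraMap_eq_smul_one,
        mul_smul_comm, mul_one, smul_mul_assoc]
      module
    simp only [transpSum, mul_add, add_mul, mul_one, Finset.mul_sum, Finset.sum_mul, h3,
      Finset.sum_sub_distrib, Finset.sum_ite_eq', Finset.mem_univ, if_true, Finset.sum_const,
      Finset.card_univ, card_lt, ← Nat.cast_smul_eq_nsmul R, h4]
    module
  intro a b hab ha hb
  have hcase : ∀ a : Fin m, (a : ℕ) < r + 1 → a = r ∨ a < r := by
    intro a ha
    rcases Nat.lt_succ_iff_lt_or_eq.1 ha with h | h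
    · exact Or.inr h
    · exact Or.inl (Fin.ext h)
  rcases hcase a ha with rfl | ha <;> rcases hcase b hb with rfl | hb
  · exact absurd rfl hab
  · rw [s_comm, eps_comm]
    exact ⟨h1 ⟨b, hb⟩, h2 ⟨b, hb⟩⟩
  · exact ⟨h1 ⟨a, ha⟩, h2 ⟨a, ha⟩⟩
  · have hs : (s a b : BrauerAlgebra R ω m) = s a r * s b r * s a r := by
      rw [s_mul_s hab ha.ne hb.ne, mul_assoc, s_mul_self, mul_one]
    have he : (eps a b hab : BrauerAlgebra R ω m) = s a r * eps b r hb.ne * s a r := by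
      rw [s_mul_eps hab ha.ne hb.ne, mul_assoc, s_mul_self, mul_one]
    rw [hs, he, ← mul_assoc, ← mul_assoc, ← mul_assoc, ← mul_assoc, h1 ⟨a, ha⟩, h1 ⟨b, hb⟩,
      h1 ⟨a, ha⟩, h2 ⟨b, hb⟩, zero_mul]
    exact ⟨rfl, rfl⟩

/-- Each of the `r` transpositions in the Jucys–Murphy element contributes `1`. -/
theorem IsRightSymmetric.mul_reducedJM {S : BrauerAlgebra R ω m}
    (hS : IsRightSymmetric (r + 1) S) : S * reducedJM ω r = (r : R) • S := by
  have h : ∀ a : {a : Fin m // a < r}, S * s a.1 r = S ∧ S * eps a.1 r a.2.ne = 0 :=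
    fun a => hS _ _ a.2.ne (Nat.lt_succ_of_lt a.2) (Nat.lt_succ_self _)
  rw [reducedJM, transpSum, contrSum, mul_sub, Finset.mul_sum, Finset.mul_sum,
    Finset.sum_congr rfl fun a _ => (h a).1, Finset.sum_congr rfl fun a _ => (h a).2]
  simp [card_lt, ← Nat.cast_smul_eq_nsmul R]

/-! ### The symmetrizer without denominators -/

/-- The symmetrizer on the first `r` dots, up to a scalar, over an arbitrary commutative ring. -/
noncomputable def rawSymmetrizer (ω : R) : (r : ℕ) → r ≤ m → BrauerAlgebra R ω m
  | 0, _ => 1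
  | r + 1, h => rawSymmetrizer ω r (Nat.le_of_succ_le h) *
      ((reducedJM ω ⟨r, h⟩ + 1) * (reducedJM ω ⟨r, h⟩ + algebraMap R _ (ω + r - 2)))

/-- The scalar by which `rawSymmetrizer` differs from an idempotent. -/
noncomputable def symmetrizerDenom (ω : R) (r : ℕ) : R :=
  ∏ k ∈ Finset.range r, ((k + 1) * (ω + 2 * k - 2))

theorem isRightSymmetric_rawSymmetrizer (ω : R) : ∀ (r : ℕ) (h : r ≤ m),
    IsRightSymmetric r (rawSymmetrizer ω r h)
  | 0, _ => fun _ _ _ ha _ => absurd ha (Nat.not_lt_zero _)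
  | r + 1, h => (isRightSymmetric_rawSymmetrizer ω r (Nat.le_of_succ_le h)).step (r := ⟨r, h⟩)

/-- The Jucys–Murphy element is annihilated by a cubic polynomial after multiplication with the
symmetrizer. After the shift by `(ω - 1) / 2`, its roots are the contents of the two boxes that can
be added to the row, and the negative of the content of the last box of the row. -/
theorem rawSymmetrizer_mul_cubic (ω : R) (r : ℕ) (h : r < m) :
    rawSymmetrizer ω r h.le * ((reducedJM ω ⟨r, h⟩ + 1) *
      (reducedJM ω ⟨r, h⟩ + algebraMap R _ (ω + r - 2))) *
        (reducedJM ω ⟨r, h⟩ - algebraMap R _ r) = 0 := by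
  have h1 := (isRightSymmetric_rawSymmetrizer ω (r + 1) h).mul_reducedJM (r := ⟨r, h⟩)
  rw [rawSymmetrizer] at h1
  rw [mul_sub, h1, ← Algebra.commutes, ← Algebra.smul_def, sub_self]

end BrauerAlgebra

/-! ### Base change -/

namespace BrauerAlgebra

open BrauerDiagram

instance {m : ℕ} : Finite (BrauerDiagram m) :=
  Finite.of_injective BrauerDiagram.mate fun _ _ h => BrauerDiagram.ext h

instance {R : Type*} [CommRing R] {ω : R} {m : ℕ} : Module.Finite R (BrauerAlgebra R ω m) :=
  inferInstanceAs (Module.Finite R (BrauerDiagram m →₀ R))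

section

variable {R R' : Type*} [CommRing R] [CommRing R'] {ω : R} {ω' : R'} {m : ℕ}

theorem ext_coeff {x y : BrauerAlgebra R ω m} (h : ∀ d, x.coeff d = y.coeff d) : x = y :=
  Finsupp.ext h

theorem coeff_add (x y : BrauerAlgebra R ω m) (d : BrauerDiagram m) :
    (x + y).coeff d = x.coeff d + y.coeff d := rfl

theorem coeff_smul (c : R) (x : BrauerAlgebra R ω m) (d : BrauerDiagram m) :
    (c • x).coeff d = c * x.coeff d := rfl

theorem induction_diagram {p : BrauerAlgebra R ω m → Prop} (x : BrauerAlgebra R ω m)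
    (h0 : p 0) (hadd : ∀ x y, p x → p y → p (x + y))
    (h : ∀ (c : R) (d : BrauerDiagram m), p (c • diagram d)) : p x := by
  refine Finsupp.induction_linear (motive := p) x h0 hadd fun d c => ?_
  have : (Finsupp.single d c : BrauerDiagram m →₀ R) = c • Finsupp.single d 1 := by simp
  rw [this]
  exact h c d

/-- Applying a ring homomorphism to the coefficients, as an additive map. -/
noncomputable def baseChangeAdd (φ : R →+* R') (ω : R) (ω' : R') (m : ℕ) :
    BrauerAlgebra R ω m →+ BrauerAlgebra R' ω' m :=
  Finsupp.mapRange.addMonoidHom φ.toAddMonoidHom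

theorem baseChangeAdd_smul (φ : R →+* R') (c : R) (x : BrauerAlgebra R ω m) :
    baseChangeAdd φ ω ω' m (c • x) = φ c • baseChangeAdd φ ω ω' m x :=
  ext_coeff fun d => map_mul φ c (x.coeff d)

theorem baseChangeAdd_diagram (φ : R →+* R') (d : BrauerDiagram m) :
    baseChangeAdd φ ω ω' m (diagram d) = diagram d := by
  refine (Finsupp.mapRange_single (f := φ) (hf := map_zero φ) (a := d) (b := 1)).trans ?_
  rw [map_one]
  rfl

/-- Applying to the coefficients a ring homomorphism that maps the parameter `ω` to `ω'`. -/
noncomputable def baseChange (φ : R →+* R') (hω : φ ω = ω') :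
    BrauerAlgebra R ω m →+* BrauerAlgebra R' ω' m :=
  { baseChangeAdd φ ω ω' m with
    map_one' := baseChangeAdd_diagram φ _
    map_mul' := fun x y => by
      change baseChangeAdd φ ω ω' m (x * y) =
        baseChangeAdd φ ω ω' m x * baseChangeAdd φ ω ω' m y
      induction x using induction_diagram with
      | h0 => simp
      | hadd x x' hx hx' => rw [add_mul, map_add, map_add, hx, hx', add_mul]
      | h c d =>
        induction y using induction_diagram with
        | h0 => simp
        | hadd y y' hy hy' => rw [mul_add, map_add, map_add, hy, hy', mul_add]
        | h c' e =>
          simp only [smul_mul_assoc, mul_smul_comm, baseChangeAdd_smul, diagram_mul_diagram,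
            baseChangeAdd_diagram, map_pow, hω] }

theorem coeff_baseChange (φ : R →+* R') (hω : φ ω = ω') (x : BrauerAlgebra R ω m)
    (d : BrauerDiagram m) : (baseChange φ hω x).coeff d = φ (x.coeff d) :=
  rfl

theorem baseChange_smul (φ : R →+* R') (hω : φ ω = ω') (c : R) (x : BrauerAlgebra R ω m) :
    baseChange φ hω (c • x) = φ c • baseChange φ hω x :=
  baseChangeAdd_smul φ c x

theorem baseChange_diagram (φ : R →+* R') (hω : φ ω = ω') (d : BrauerDiagram m) :
    baseChange φ hω (diagram d) = diagram d :=
  baseChangeAdd_diagram φ d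

theorem baseChange_algebraMap (φ : R →+* R') (hω : φ ω = ω') (c : R) :
    baseChange φ hω (algebraMap R (BrauerAlgebra R ω m) c) = algebraMap R' _ (φ c) := by
  rw [Algebra.algebraMap_eq_smul_one, baseChange_smul, map_one, Algebra.algebraMap_eq_smul_one]

theorem baseChange_reducedJM (φ : R →+* R') (hω : φ ω = ω') (r : Fin m) :
    baseChange φ hω (reducedJM ω r) = reducedJM ω' r := by
  simp only [reducedJM, transpSum, contrSum, map_sub, map_sum, s, eps, baseChange_diagram]

theorem baseChange_rawSymmetrizer (φ : R →+* R') (hω : φ ω = ω') : ∀ (r : ℕ) (h : r ≤ m),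
    baseChange φ hω (rawSymmetrizer ω r h) = rawSymmetrizer ω' r h
  | 0, _ => map_one _
  | r + 1, h => by
    rw [rawSymmetrizer, rawSymmetrizer, map_mul, map_mul, map_add, map_add, map_one,
      baseChange_reducedJM, baseChange_algebraMap, baseChange_rawSymmetrizer]
    simp [hω, map_ofNat]

theorem map_symmetrizerDenom (φ : R →+* R') (hω : φ ω = ω') (r : ℕ) :
    φ (symmetrizerDenom ω r) = symmetrizerDenom ω' r := by
  simp [symmetrizerDenom, map_prod, hω, map_ofNat]

end

/-! ### The recurrence over rational functions -/

section Field

variable {K : Type*} [Field K] {ω : K} {m : ℕ}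

theorem toRatFunc_eq_baseChange (x : BrauerAlgebra K ω m) :
    toRatFunc x = baseChange RatFunc.C rfl x := rfl

/-- A fraction is regular where its denominator, in any representation, does not vanish. -/
theorem RatFunc_regular_of_mul_eq {f : RatFunc K} {p q : Polynomial K} {c : K}
    (h : algebraMap _ _ q * f = algebraMap _ _ p) (hq : q.eval c ≠ 0) :
    f.denom.eval c ≠ 0 ∧ RatFunc.eval (RingHom.id K) c f = p.eval c / q.eval c := by
  have hq0 : q ≠ 0 := by rintro rfl; simp at hq
  have hq1 : (algebraMap (Polynomial K) (RatFunc K) q) ≠ 0 := by simpa using hq0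
  have hf : f = algebraMap _ _ p / algebraMap _ _ q := by
    rw [← h, mul_div_cancel_left₀ _ hq1]
  have hd : f.denom.eval c ≠ 0 := by
    obtain ⟨w, hw⟩ := (RatFunc.denom_dvd hq0).2 ⟨p, hf⟩
    rw [hw, Polynomial.eval_mul] at hq
    exact left_ne_zero_of_mul hq
  refine ⟨hd, ?_⟩
  have h1 : f.num * q = p * f.denom := by
    have := RatFunc.num_div_denom f
    have hd0 : (algebraMap (Polynomial K) (RatFunc K) f.denom) ≠ 0 := by
      simpa using f.denom_ne_zero
    rw [div_eq_iff hd0] at this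
    apply RatFunc.algebraMap_injective K
    rw [map_mul, map_mul, this, ← h]
    ring
  have h2 := congrArg (Polynomial.eval c) h1
  rw [Polynomial.eval_mul, Polynomial.eval_mul] at h2
  rw [RatFunc.eval, Polynomial.eval₂_id, Polynomial.eval₂_id, div_eq_div_iff hd hq, h2]

/-- The element `u - x` is invertible because `x` is a root of a nonzero polynomial over `K`, which
does not vanish at the indeterminate `u`. -/
theorem isUnit_uSub (x : BrauerAlgebra K ω m) : IsUnit (uSub x) := by
  have hx : IsIntegral K x := IsIntegral.of_finite K x
  set p := minpoly K x with hp
  by_contra hu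
  have hmem : (RatFunc.X : RatFunc K) ∈ spectrum (RatFunc K) (toRatFunc x) := by
    rw [spectrum.mem_iff]; exact hu
  have h1 := spectrum.subset_polynomial_aeval (toRatFunc x) (p.map RatFunc.C)
    ⟨_, hmem, rfl⟩
  have h2 : Polynomial.aeval (toRatFunc x) (p.map RatFunc.C) = 0 := by
    have h3 : baseChange (ω' := RatFunc.C ω) RatFunc.C rfl (Polynomial.aeval x p) = 0 := by
      rw [hp, minpoly.aeval, map_zero]
    rw [← h3, Polynomial.aeval_def, Polynomial.aeval_def, Polynomial.hom_eval₂,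
      Polynomial.eval₂_map, toRatFunc_eq_baseChange]
    congr 1
    ext1 c
    exact (baseChange_algebraMap (ω := ω) (m := m) RatFunc.C rfl c).symm
  rw [h2, spectrum.mem_iff, sub_zero] at h1
  apply h1
  refine IsUnit.map (algebraMap (RatFunc K) _) (isUnit_iff_ne_zero.2 ?_)
  change Polynomial.eval RatFunc.X (p.map RatFunc.C) ≠ 0
  rw [Polynomial.eval_map, ← RatFunc.algebraMap_eq_C, ← Polynomial.aeval_def,
    RatFunc.aeval_X_left_eq_algebraMap]
  simpa using minpoly.ne_zero hx

/-- Newton's interpolation formula for a cubic polynomial, which expresses `1 / (u - y)` on an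
element `e` annihilated by that polynomial in `y`. -/
theorem newton_identity {F A : Type*} [CommRing F] [Ring A] [Algebra F A] {e y : A} {a b c : F}
    (u : F)
    (h : e * ((y - algebraMap F A a) * (y - algebraMap F A b)) * (y - algebraMap F A c) = 0) :
    ((u - a) * (u - b)) • ((u - c) • e) =
      (e * ((y - algebraMap F A a) * (y - algebraMap F A b)) +
        ((u - c) • (e * (y - algebraMap F A b)) + ((u - c) * (u - a)) • e)) *
          (algebraMap F A u - y) := by
  simp only [Algebra.algebraMap_eq_smul_one, add_mul, mul_sub, sub_mul, mul_one, one_mul,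
    mul_smul_comm, smul_mul_assoc, ← mul_assoc] at h ⊢
  refine sub_eq_zero.1 (Eq.trans ?_ h)
  module

/-- If `E` is annihilated by a cubic polynomial in `x` with the simple root `c`, the fraction has no
pole at `c`, and its value is given by the quotient of that polynomial by `x - c`. -/
theorem fraction_regular {E x : BrauerAlgebra K ω m} {a b c : K}
    (h : E * ((x - algebraMap K _ a) * (x - algebraMap K _ b)) * (x - algebraMap K _ c) = 0)
    (ha : c - a ≠ 0) (hb : c - b ≠ 0) :
    RegularAt c (fraction E x c) ∧ evalCoeff ω c (fraction E x c) =
      ((c - a) * (c - b))⁻¹ • (E * ((x - algebraMap K _ a) * (x - algebraMap K _ b))) := by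
  set t : BrauerAlgebra K ω m →+* BrauerAlgebra (RatFunc K) (RatFunc.C ω) m :=
    baseChange RatFunc.C rfl with ht
  set U : RatFunc K := RatFunc.X
  have htx : uSub x = algebraMap _ _ U - t x := rfl
  have hta : ∀ k : K, t (algebraMap K _ k) = algebraMap _ _ (RatFunc.C k) :=
    fun k => baseChange_algebraMap _ _ k
  have hfr : fraction E x c * uSub x = (U - RatFunc.C c) • t E := by
    rw [fraction, mul_smul_comm, smul_mul_assoc, mul_assoc, Ring.inverse_mul_cancel _
      (isUnit_uSub x), mul_one]
    rfl
  have h' : t E * ((t x - algebraMap _ _ (RatFunc.C a)) * (t x - algebraMap _ _ (RatFunc.C b))) *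
      (t x - algebraMap _ _ (RatFunc.C c)) = 0 := by
    rw [← hta, ← hta, ← hta, ← map_sub, ← map_sub, ← map_sub, ← map_mul, ← map_mul, ← map_mul, h,
      map_zero]
  have key : ((U - RatFunc.C a) * (U - RatFunc.C b)) • fraction E x c =
      t (E * ((x - algebraMap K _ a) * (x - algebraMap K _ b))) +
        ((U - RatFunc.C c) • t (E * (x - algebraMap K _ b)) +
        ((U - RatFunc.C c) * (U - RatFunc.C a)) • t E) := by
    refine (isUnit_uSub x).mul_right_cancel ?_
    rw [smul_mul_assoc, hfr, htx]
    simp only [map_mul, map_sub, hta]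
    exact newton_identity _ h'
  set F := E * ((x - algebraMap K _ a) * (x - algebraMap K _ b)) with hF
  set G := E * (x - algebraMap K _ b)
  have hreg : ∀ d, ((fraction E x c).coeff d).denom.eval c ≠ 0 ∧
      RatFunc.eval (RingHom.id K) c ((fraction E x c).coeff d) =
        F.coeff d / ((c - a) * (c - b)) := by
    intro d
    have hk := congrArg (fun z : BrauerAlgebra (RatFunc K) (RatFunc.C ω) m => z.coeff d) key
    simp only [coeff_smul, coeff_add, ht, coeff_baseChange] at hk
    have h1 := RatFunc_regular_of_mul_eq (c := c) (f := (fraction E x c).coeff d)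
      (q := (Polynomial.X - Polynomial.C a) * (Polynomial.X - Polynomial.C b))
      (p := Polynomial.C (F.coeff d) + ((Polynomial.X - Polynomial.C c) * Polynomial.C (G.coeff d) +
        (Polynomial.X - Polynomial.C c) * (Polynomial.X - Polynomial.C a) *
          Polynomial.C (E.coeff d)))
      (by simpa only [map_mul, map_sub, map_add, RatFunc.algebraMap_X, RatFunc.algebraMap_C]
        using hk)
      (by simpa using ⟨ha, hb⟩)
    simpa using h1
  refine ⟨fun d => (hreg d).1, ext_coeff fun d => ?_⟩
  rw [coeff_smul]
  refine (hreg d).2.trans ?_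
  rw [div_eq_inv_mul]

theorem jucysMurphy_eq (ω : K) (r : Fin m) :
    jucysMurphy ω r = algebraMap K _ ((ω - 1) / 2) + reducedJM ω r := by
  rw [jucysMurphy, reducedJM, transpSum, contrSum, ← Finset.sum_sub_distrib]

/-- One step of the recurrence of the row tableau. The roots of the cubic polynomial other than the
content `c` are `(ω - 1) / 2 - 1` and `(ω - 1) / 2 - (ω + r - 2)`. -/
theorem fraction_rowTableau (ω : K) {r : ℕ} {h : r ≤ m}
    (hE : idempotentStep ω (rowTableau m) r h = (symmetrizerDenom ω r)⁻¹ • rawSymmetrizer ω r h)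
    (hr : r < m) (h0 : ((r : K) + 1) * (ω + 2 * r - 2) ≠ 0) :
    RegularAt (content ω (rowTableau m ⟨r, hr⟩))
      (fraction (idempotentStep ω (rowTableau m) r h) (jucysMurphy ω ⟨r, hr⟩)
        (content ω (rowTableau m ⟨r, hr⟩))) ∧
    idempotentStep ω (rowTableau m) (r + 1) hr =
      (symmetrizerDenom ω (r + 1))⁻¹ • rawSymmetrizer ω (r + 1) hr := by
  have hc : content ω (rowTableau m ⟨r, hr⟩) = (ω - 1) / 2 + r := by
    simp [content, rowTableau]
  set x := jucysMurphy ω ⟨r, hr⟩ with hx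
  have hxa : x - algebraMap K _ ((ω - 1) / 2 - 1) = reducedJM ω ⟨r, hr⟩ + 1 := by
    rw [hx, jucysMurphy_eq, map_sub, map_one]; abel
  have hxb : x - algebraMap K _ ((ω - 1) / 2 - (ω + r - 2)) =
      reducedJM ω ⟨r, hr⟩ + algebraMap K _ (ω + r - 2) := by
    rw [hx, jucysMurphy_eq, map_sub]; abel
  have hxc : x - algebraMap K _ ((ω - 1) / 2 + r) =
      reducedJM ω ⟨r, hr⟩ - algebraMap K _ r := by
    rw [hx, jucysMurphy_eq, map_add]; abel
  have h1 : (ω - 1) / 2 + r - ((ω - 1) / 2 - 1) = r + 1 := by ring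
  have h2 : (ω - 1) / 2 + r - ((ω - 1) / 2 - (ω + r - 2)) = ω + 2 * r - 2 := by ring
  have hstep : idempotentStep ω (rowTableau m) (r + 1) hr =
    evalCoeff ω (content ω (rowTableau m ⟨r, hr⟩))
      (fraction (idempotentStep ω (rowTableau m) r h) x (content ω (rowTableau m ⟨r, hr⟩))) := rfl
  rw [hstep, hc]
  have key := fraction_regular (E := idempotentStep ω (rowTableau m) r h) (x := x)
    (a := (ω - 1) / 2 - 1) (b := (ω - 1) / 2 - (ω + r - 2)) (c := (ω - 1) / 2 + r)
    (by
      rw [hxa, hxb, hxc, hE, smul_mul_assoc, smul_mul_assoc, rawSymmetrizer_mul_cubic, smul_zero])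
    (by rw [h1]; exact left_ne_zero_of_mul h0) (by rw [h2]; exact right_ne_zero_of_mul h0)
  refine ⟨key.1, key.2.trans ?_⟩
  rw [hxa, hxb, h1, h2, hE, smul_mul_assoc, smul_smul, ← mul_inv, symmetrizerDenom,
    symmetrizerDenom, Finset.prod_range_succ, mul_comm (_ * _) (Finset.prod _ _)]
  rfl

/-- The recurrence of the row tableau produces the normalized symmetrizer, provided that the
denominators do not vanish. -/
theorem idempotentStep_rowTableau (ω : K) : ∀ (r : ℕ) (h : r ≤ m), symmetrizerDenom ω r ≠ 0 →
    idempotentStep ω (rowTableau m) r h = (symmetrizerDenom ω r)⁻¹ • rawSymmetrizer ω r h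
  | 0, _, _ => by simp [idempotentStep, symmetrizerDenom, rawSymmetrizer]
  | r + 1, h, hD => by
    rw [symmetrizerDenom, Finset.prod_range_succ] at hD
    exact (fraction_rowTableau ω (idempotentStep_rowTableau ω r (Nat.le_of_succ_le h)
      (left_ne_zero_of_mul hD)) h (right_ne_zero_of_mul hD)).2

end Field

/-! ### The generic symmetrizer and its specialization -/

theorem factor_generic_ne_zero (k : ℕ) :
    ((k : RatFunc ℂ) + 1) * ((RatFunc.X : RatFunc ℂ) + 2 * k - 2) ≠ 0 := by
  have h : ((k : RatFunc ℂ) + 1) * ((RatFunc.X : RatFunc ℂ) + 2 * k - 2) =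
      algebraMap (Polynomial ℂ) (RatFunc ℂ)
        (((k : Polynomial ℂ) + 1) * (Polynomial.X + Polynomial.C (2 * k - 2 : ℂ))) := by
    simp only [map_mul, map_add, map_sub, map_natCast, map_one, map_ofNat, RatFunc.algebraMap_X]
    ring
  rw [h, Ne, map_eq_zero_iff _ (RatFunc.algebraMap_injective ℂ)]
  exact mul_ne_zero (Nat.cast_add_one_ne_zero k) (Polynomial.X_add_C_ne_zero _)

theorem symmetrizerDenom_generic_ne_zero (r : ℕ) :
    symmetrizerDenom (RatFunc.X : RatFunc ℂ) r ≠ 0 :=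
  Finset.prod_ne_zero_iff.2 fun k _ => factor_generic_ne_zero k

theorem idempotentDefined_generic (m : ℕ) :
    IdempotentDefined (RatFunc.X : RatFunc ℂ) (rowTableau m) := fun r h =>
  ⟨isUnit_uSub _, (fraction_rowTableau _ (idempotentStep_rowTableau _ r h.le
    (symmetrizerDenom_generic_ne_zero r)) h (factor_generic_ne_zero r)).1⟩

/-- The symmetrizer without denominators is defined over `ℂ[X]`, so only the zeros of the scalar
`symmetrizerDenom` can be poles of the generic symmetrizer. -/
theorem genericSymmetrizer_regular {c : ℂ} {m : ℕ} (hc : symmetrizerDenom c m ≠ 0) :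
    RegularAt c (genericSymmetrizer m) ∧
      symmetrizer c m = (symmetrizerDenom c m)⁻¹ • rawSymmetrizer c m le_rfl := by
  have hg : genericSymmetrizer m =
      (symmetrizerDenom RatFunc.X m)⁻¹ • rawSymmetrizer RatFunc.X m le_rfl :=
    idempotentStep_rowTableau _ m le_rfl (symmetrizerDenom_generic_ne_zero m)
  set D : Polynomial ℂ := symmetrizerDenom Polynomial.X m
  set U : BrauerAlgebra (Polynomial ℂ) Polynomial.X m :=
    rawSymmetrizer Polynomial.X m le_rfl with hU
  have hX : algebraMap (Polynomial ℂ) (RatFunc ℂ) Polynomial.X = RatFunc.X := RatFunc.algebraMap_X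
  have hD : algebraMap (Polynomial ℂ) (RatFunc ℂ) D = symmetrizerDenom RatFunc.X m :=
    map_symmetrizerDenom _ hX m
  have hDc : D.eval c = symmetrizerDenom c m :=
    map_symmetrizerDenom (Polynomial.evalRingHom c) Polynomial.eval_X m
  have hreg : ∀ d, ((genericSymmetrizer m).coeff d).denom.eval c ≠ 0 ∧
      RatFunc.eval (RingHom.id ℂ) c ((genericSymmetrizer m).coeff d) =
        (U.coeff d).eval c / D.eval c := by
    intro d
    refine RatFunc_regular_of_mul_eq ?_ (by rwa [hDc])
    rw [hg, coeff_smul, hD, mul_inv_cancel_left₀ (symmetrizerDenom_generic_ne_zero m),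
      ← baseChange_rawSymmetrizer (algebraMap (Polynomial ℂ) (RatFunc ℂ)) hX, coeff_baseChange]
  refine ⟨fun d => (hreg d).1, ext_coeff fun d => (hreg d).2.trans ?_⟩
  have hXc : Polynomial.evalRingHom c Polynomial.X = c := Polynomial.eval_X
  rw [coeff_smul, hDc, div_eq_inv_mul,
    ← baseChange_rawSymmetrizer (Polynomial.evalRingHom c) hXc, coeff_baseChange]
  rfl

end BrauerAlgebra

/-! ### The generators of the Brauer algebra -/

namespace BrauerDiagram

variable {m : ℕ}

/-- The diagram without horizontal edges that is given by a permutation. -/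
def ofPerm (τ : Equiv.Perm (Fin m)) : BrauerDiagram m where
  mate
    | Sum.inl a => Sum.inr (τ.symm a)
    | Sum.inr a => Sum.inl (τ a)
  mate_mate := by rintro (a | a) <;> simp
  mate_ne := by rintro (a | a) <;> simp

theorem exists_ofPerm (d : BrauerDiagram m) (h : ∀ c, (d.mate (Sum.inr c)).isLeft) :
    ∃ τ, d = ofPerm τ := by
  choose f hf using fun c => Sum.isLeft_iff.1 (h c)
  have hinj : Function.Injective f := fun a b hab => by
    have h1 : d.mate (Sum.inr a) = d.mate (Sum.inr b) := by rw [hf, hf, hab]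
    have h2 := congrArg d.mate h1
    rw [d.mate_mate, d.mate_mate] at h2
    exact Sum.inr_injective h2
  refine ⟨Equiv.ofBijective f (Finite.injective_iff_bijective.1 hinj), ?_⟩
  ext1
  funext v
  rcases v with a | a
  · obtain ⟨c, rfl⟩ := (Finite.injective_iff_bijective.1 hinj).2 a
    have h1 : (Equiv.ofBijective f (Finite.injective_iff_bijective.1 hinj)).symm (f c) = c :=
      Equiv.ofBijective_symm_apply_apply f _ c
    rw [← hf, d.mate_mate, hf]
    simp only [ofPerm, h1]
  · exact hf a

/-- The diagram obtained from `d` by joining the dots `p`, `q` of the top row with the dots `a`, `b`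
of the bottom row. -/
def cross (d : BrauerDiagram m) (p q a b : Fin m) (hp : d.mate (Sum.inl p) = Sum.inl q)
    (ha : d.mate (Sum.inr a) = Sum.inr b) : BrauerDiagram m where
  mate v := if v = Sum.inl p then Sum.inr a else if v = Sum.inl q then Sum.inr b
    else if v = Sum.inr a then Sum.inl p else if v = Sum.inr b then Sum.inl q else d.mate v
  mate_mate v := by
    have h1 := d.mate_mate
    have h2 := d.mate_ne
    grind
  mate_ne v := by
    have h1 := d.mate_mate
    have h2 := d.mate_ne
    grind

theorem joinBottom_cross (d : BrauerDiagram m) {p q a b : Fin m}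
    (hp : d.mate (Sum.inl p) = Sum.inl q) (ha : d.mate (Sum.inr a) = Sum.inr b) (hab : a ≠ b) :
    (d.cross p q a b hp ha).joinBottom a b hab = d := by
  have h1 := d.mate_mate
  have h2 := d.mate_ne
  ext1
  funext v
  simp only [joinBottom, cross]
  grind

theorem exists_top_edge (d : BrauerDiagram m) {a b : Fin m} (ha : d.mate (Sum.inr a) = Sum.inr b) :
    ∃ p q, d.mate (Sum.inl p) = Sum.inl q := by
  by_contra! hc
  have h : ∀ p, ∃ q, d.mate (Sum.inl p) = Sum.inr q := by
    intro p
    rcases h : d.mate (Sum.inl p) with q | q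
    · exact absurd h (hc p q)
    · exact ⟨q, rfl⟩
  choose g hg using h
  have hinj : Function.Injective g := fun x y hxy => by
    have h1 : d.mate (Sum.inl x) = d.mate (Sum.inl y) := by rw [hg, hg, hxy]
    have h2 := congrArg d.mate h1
    rw [d.mate_mate, d.mate_mate] at h2
    exact Sum.inl_injective h2
  obtain ⟨p, hp⟩ := (Finite.injective_iff_bijective.1 hinj).2 a
  have h2 := congrArg d.mate (hg p)
  rw [d.mate_mate, hp, ha] at h2
  cases h2

end BrauerDiagram

namespace BrauerAlgebra

open BrauerDiagram

variable {R : Type*} [CommRing R] {ω : R} {m : ℕ}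

/-- The set of the elements `s_{ab}` and `ε_{ab}` with `a < b`. -/
def generators (R : Type*) [CommRing R] (ω : R) (m : ℕ) : Set (BrauerAlgebra R ω m) :=
  {x | ∃ (a b : Fin m) (h : a < b), x = s a b ∨ x = eps a b h.ne}

theorem s_mem_adjoin {a b : Fin m} (hab : a ≠ b) :
    s a b ∈ Algebra.adjoin R (generators R ω m) := by
  rcases lt_or_gt_of_ne hab with h | h
  · exact Algebra.subset_adjoin ⟨a, b, h, Or.inl rfl⟩
  · rw [s_comm]
    exact Algebra.subset_adjoin ⟨b, a, h, Or.inl rfl⟩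

theorem eps_mem_adjoin {a b : Fin m} (hab : a ≠ b) :
    eps a b hab ∈ Algebra.adjoin R (generators R ω m) := by
  rcases lt_or_gt_of_ne hab with h | h
  · exact Algebra.subset_adjoin ⟨a, b, h, Or.inr rfl⟩
  · rw [eps_comm]
    exact Algebra.subset_adjoin ⟨b, a, h, Or.inr rfl⟩

theorem diagram_ofPerm_mem_adjoin (τ : Equiv.Perm (Fin m)) :
    diagram (ofPerm τ) ∈ Algebra.adjoin R (generators R ω m) := by
  induction τ using Equiv.Perm.swap_induction_on' with
  | one =>
    have h : diagram (ofPerm 1) = (1 : BrauerAlgebra R ω m) := by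
      rw [one_def]
      congr 1
      ext1
      funext v
      rcases v with a | a <;> rfl
    rw [h]
    exact one_mem _
  | mul_swap τ a b hab ih =>
    have h : diagram (ofPerm (τ * Equiv.swap a b)) =
        (diagram (ofPerm τ) * s a b : BrauerAlgebra R ω m) := by
      rw [diagram_mul_s]
      congr 1
      ext1
      funext v
      rcases v with c | c <;> simp [ofPerm, swapBottom, Equiv.Perm.mul_def]
    rw [h]
    exact mul_mem ih (s_mem_adjoin hab)

/-- A diagram with a bottom edge `{a, b}` is the product of a diagram with fewer bottom edges and
the contraction of `a` and `b`; a diagram without bottom edges is a permutation. -/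
theorem diagram_mem_adjoin (d : BrauerDiagram m) :
    diagram d ∈ Algebra.adjoin R (generators R ω m) := by
  induction hn : (Finset.univ.filter fun c => (d.mate (Sum.inr c)).isRight).card
    using Nat.strong_induction_on generalizing d with
  | _ n ih =>
    by_cases h : ∀ c, (d.mate (Sum.inr c)).isLeft
    · obtain ⟨τ, rfl⟩ := exists_ofPerm d h
      exact diagram_ofPerm_mem_adjoin τ
    · push Not at h
      obtain ⟨a, ha⟩ := h
      obtain ⟨b, hb⟩ := Sum.isRight_iff.1 (Sum.not_isLeft.1 ha)
      obtain ⟨p, q, hp⟩ := exists_top_edge d hb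
      have hab : a ≠ b := fun h => d.mate_ne (Sum.inr a) (by rw [hb, h])
      have h1 : (diagram (d.cross p q a b hp hb) * eps a b hab : BrauerAlgebra R ω m) =
          diagram d := by
        rw [diagram_mul_eps_of_ne _ _ (by simp [cross]), joinBottom_cross]
      rw [← h1]
      refine mul_mem (ih _ ?_ _ rfl) (eps_mem_adjoin hab)
      rw [← hn]
      refine Finset.card_lt_card (Finset.ssubset_iff_of_subset ?_ |>.2 ⟨a, ?_, ?_⟩)
      · intro c hc
        simp only [Finset.mem_filter, Finset.mem_univ, true_and, cross] at hc ⊢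
        have h3 : ∀ x : Fin m, (Sum.inl x : Fin m ⊕ Fin m).isRight = false := fun _ => rfl
        grind
      · simp [hb]
      · simp [cross]

theorem adjoin_generators : Algebra.adjoin R (generators R ω m) = ⊤ := by
  refine eq_top_iff.2 fun x _ => ?_
  induction x using induction_diagram with
  | h0 => exact zero_mem _
  | hadd x y hx hy => exact add_mem (hx trivial) (hy trivial)
  | h c d => exact Subalgebra.smul_mem _ (diagram_mem_adjoin d) c

end BrauerAlgebra

/-! ### Framings of a diagram and their signs -/

namespace BrauerDiagram

variable {m : ℕ}

/-- A framing of a diagram: a permutation of the dots that transforms the identity diagram into the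
given one. It numbers the edges and directs them. -/
def IsFraming (d : BrauerDiagram m) (π : Equiv.Perm (Fin m ⊕ Fin m)) : Prop :=
  ∀ v, d.mate (π v) = π v.swap

/-- Involutions without fixed points have the same cycle type. -/
theorem isConj_of_involutive {α : Type*} [Fintype α] [DecidableEq α] {σ τ : Equiv.Perm α}
    (hσ : ∀ v, σ (σ v) = v) (hτ : ∀ v, τ (τ v) = v) (hσ' : ∀ v, σ v ≠ v) (hτ' : ∀ v, τ v ≠ v) :
    IsConj σ τ := by
  rcases isEmpty_or_nonempty α with h | ⟨⟨x⟩⟩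
  · rw [Subsingleton.elim σ τ]
  · have key : ∀ ρ : Equiv.Perm α, (∀ v, ρ (ρ v) = v) → (∀ v, ρ v ≠ v) →
        ∃ k, ρ.cycleType = Multiset.replicate k 2 ∧ k * 2 = Fintype.card α := by
      intro ρ h1 h2
      have h3 : orderOf ρ = 2 :=
        orderOf_eq_prime (Equiv.ext fun v => by simpa [pow_two] using h1 v)
          (fun h => h2 x (by rw [h]; rfl))
      obtain ⟨k, hk⟩ := Equiv.Perm.cycleType_prime_order (h3 ▸ Nat.prime_two)
      rw [h3] at hk
      refine ⟨_, hk, ?_⟩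
      have h4 := Equiv.Perm.sum_cycleType ρ
      rw [hk, Multiset.sum_replicate, smul_eq_mul] at h4
      rw [h4, ← Finset.card_univ]
      congr 1
      ext v
      simpa using h2 v
    obtain ⟨k, hk, hk'⟩ := key σ hσ hσ'
    obtain ⟨l, hl, hl'⟩ := key τ hτ hτ'
    rw [Equiv.Perm.isConj_iff_cycleType_eq, hk, hl]
    congr 1
    omega

theorem exists_isFraming (d : BrauerDiagram m) : ∃ π, d.IsFraming π := by
  let σ : Equiv.Perm (Fin m ⊕ Fin m) := Function.Involutive.toPerm d.mate d.mate_mate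
  let τ : Equiv.Perm (Fin m ⊕ Fin m) := Function.Involutive.toPerm Sum.swap Sum.swap_swap
  obtain ⟨π, hπ⟩ := isConj_iff.1 (isConj_of_involutive (σ := τ) (τ := σ) Sum.swap_swap d.mate_mate
    (by rintro (v | v) <;> exact fun h => by cases h) d.mate_ne)
  refine ⟨π, fun v => ?_⟩
  have := congrArg (fun ρ : Equiv.Perm (Fin m ⊕ Fin m) => ρ (π v)) hπ
  rw [Equiv.Perm.mul_apply, Equiv.Perm.mul_apply, Equiv.Perm.coe_inv,
    Equiv.symm_apply_apply] at this
  exact this.symm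

/-- Reversing the direction of an edge changes a framing into a framing. -/
theorem IsFraming.flip {d : BrauerDiagram m} {π : Equiv.Perm (Fin m ⊕ Fin m)} (h : d.IsFraming π)
    (k : Fin m) : d.IsFraming (π * Equiv.swap (Sum.inl k) (Sum.inr k)) := by
  intro v
  rw [Equiv.Perm.mul_apply, Equiv.Perm.mul_apply, h]
  congr 1
  rcases v with v | v <;> simp only [Sum.swap_inl, Sum.swap_inr, Equiv.swap_apply_def] <;> grind

/-- In a suitable framing, the edge at a given dot ends there. -/
theorem exists_isFraming_inr (d : BrauerDiagram m) (x : Fin m ⊕ Fin m) :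
    ∃ π k, d.IsFraming π ∧ π (Sum.inr k) = x ∧ π (Sum.inl k) = d.mate x := by
  obtain ⟨π, hπ⟩ := d.exists_isFraming
  rcases hk : π.symm x with k | k
  · have hx : π (Sum.inl k) = x := by rw [← hk, Equiv.apply_symm_apply]
    refine ⟨π * Equiv.swap (Sum.inl k) (Sum.inr k), k, hπ.flip k, ?_, ?_⟩
    · rw [Equiv.Perm.mul_apply, Equiv.swap_apply_right, hx]
    · rw [Equiv.Perm.mul_apply, Equiv.swap_apply_left, ← hx, hπ]; rfl
  · have hx : π (Sum.inr k) = x := by rw [← hk, Equiv.apply_symm_apply]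
    exact ⟨π, k, hπ, hx, by rw [← hx, hπ]; rfl⟩

/-- In a suitable framing, the edges at two given dots that are not joined end at the first dot and
start at the second one. -/
theorem exists_isFraming_inr_inl (d : BrauerDiagram m) {x y : Fin m ⊕ Fin m} (hxy : y ≠ x)
    (hxy' : d.mate x ≠ y) :
    ∃ π k l, d.IsFraming π ∧ k ≠ l ∧ π (Sum.inr k) = x ∧ π (Sum.inl k) = d.mate x ∧
      π (Sum.inl l) = y ∧ π (Sum.inr l) = d.mate y := by
  obtain ⟨π, k, hπ, hk, hk'⟩ := d.exists_isFraming_inr x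
  have hne : ∀ l, π (Sum.inl l) = y ∨ π (Sum.inr l) = y → k ≠ l := by
    rintro l hl rfl
    rw [hk, hk'] at hl
    rcases hl with hl | hl
    · exact hxy' hl
    · exact hxy hl.symm
  rcases hl : π.symm y with l | l
  · have hy : π (Sum.inl l) = y := by rw [← hl, Equiv.apply_symm_apply]
    exact ⟨π, k, l, hπ, hne l (Or.inl hy), hk, hk', hy, by rw [← hy, hπ]; rfl⟩
  · have hy : π (Sum.inr l) = y := by rw [← hl, Equiv.apply_symm_apply]
    have hkl := hne l (Or.inr hy)
    refine ⟨π * Equiv.swap (Sum.inl l) (Sum.inr l), k, l, hπ.flip l, hkl, ?_, ?_, ?_, ?_⟩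
    · rw [Equiv.Perm.mul_apply, Equiv.swap_apply_of_ne_of_ne (by simp) (by simpa), hk]
    · rw [Equiv.Perm.mul_apply, Equiv.swap_apply_of_ne_of_ne (by simpa) (by simp), hk']
    · rw [Equiv.Perm.mul_apply, Equiv.swap_apply_left, hy]
    · rw [Equiv.Perm.mul_apply, Equiv.swap_apply_right, ← hy, hπ]; rfl

/-- The Pfaffian-type term of a permutation of the dots: its sign times the product of a form over
the directed edges. -/
def pfaffianTerm {R : Type*} [CommRing R] (B : Fin m ⊕ Fin m → Fin m ⊕ Fin m → R)
    (π : Equiv.Perm (Fin m ⊕ Fin m)) : R :=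
  ((Equiv.Perm.sign π : ℤ) : R) * ∏ k, B (π (Sum.inl k)) (π (Sum.inr k))

/-- A permutation that commutes with the interchange of the rows permutes the vertical edges and
reverses some of them. The permutation of the edges acts on both rows and has sign `1`, and each
reversal changes both the sign and the value of the form. -/
theorem sign_mul_prod_of_comm_swap {R : Type*} [CommRing R]
    {B : Fin m ⊕ Fin m → Fin m ⊕ Fin m → R} (hB : ∀ x y, B y x = -B x y)
    (h : Equiv.Perm (Fin m ⊕ Fin m)) (hh : ∀ v, h v.swap = (h v).swap) :
    pfaffianTerm B h = ∏ k, B (Sum.inl k) (Sum.inr k) := by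
  let idx : Fin m ⊕ Fin m → Fin m := Sum.elim id id
  have hidx : ∀ v w, idx v = idx w → v = w ∨ v = w.swap := by
    rintro (v | v) (w | w) hvw <;> simp_all [idx]
  have hinj : Function.Injective fun k => idx (h (Sum.inl k)) := by
    intro k l hkl
    rcases hidx _ _ hkl with h1 | h1
    · exact Sum.inl_injective (h.injective h1)
    · rw [← hh] at h1
      cases h.injective h1
  let τ : Equiv.Perm (Fin m) := Equiv.ofBijective _ (Finite.injective_iff_bijective.1 hinj)
  have hτ : ∀ k, τ k = idx (h (Sum.inl k)) := fun _ => rfl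
  let c : Fin m → Bool := fun k => (h (Sum.inl k)).isRight
  let e : Fin m × Bool ≃ Fin m ⊕ Fin m := (Equiv.prodComm _ _).trans (Equiv.boolProdEquivSum _)
  let f : Equiv.Perm (Fin m × Bool) :=
    Equiv.prodCongrRight fun k => if c k then Equiv.swap false true else 1
  have hl : ∀ k, h (Sum.inl k) = if c k then Sum.inr (τ k) else Sum.inl (τ k) := by
    intro k
    rcases hk : h (Sum.inl k) with x | x <;> simp [c, hτ, hk, idx]
  have hr : ∀ k, h (Sum.inr k) = if c k then Sum.inl (τ k) else Sum.inr (τ k) := by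
    intro k
    rw [← Sum.swap_inl, hh, hl]
    split_ifs <;> rfl
  have hdecomp : h = Equiv.sumCongr τ τ * (e.symm.trans f).trans e := by
    ext1 v
    rcases v with k | k
    · by_cases hk : c k
      · simp [hl, hk, f, e]
      · simp [hl, hk, f, e]
    · by_cases hk : c k
      · simp [hr, hk, f, e]
      · simp [hr, hk, f, e]
  have hsign : ((Equiv.Perm.sign h : ℤ) : R) = ∏ k, if c k then -1 else 1 := by
    rw [hdecomp, map_mul, Equiv.Perm.sign_sumCongr, Int.units_mul_self, one_mul,
      Equiv.Perm.sign_symm_trans_trans, Equiv.Perm.sign_prodCongrRight]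
    push_cast
    refine Finset.prod_congr rfl fun k _ => ?_
    split_ifs <;> simp
  have hprod : ∀ k, B (h (Sum.inl k)) (h (Sum.inr k)) =
      (if c k then -1 else 1) * B (Sum.inl (τ k)) (Sum.inr (τ k)) := by
    intro k
    rw [hl, hr]
    split_ifs
    · rw [hB, neg_one_mul]
    · rw [one_mul]
  have hsq : (∏ k, if c k then (-1 : R) else 1) * (∏ k, if c k then (-1 : R) else 1) = 1 := by
    rw [← Finset.prod_mul_distrib]
    refine Finset.prod_eq_one fun k _ => ?_
    split_ifs <;> simp
  rw [pfaffianTerm, hsign, Finset.prod_congr rfl fun k _ => hprod k, Finset.prod_mul_distrib,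
    ← mul_assoc, hsq, one_mul]
  exact Equiv.prod_comp τ fun k => B (Sum.inl k) (Sum.inr k)

/-- For an antisymmetric form, the Pfaffian term does not depend on the framing of a diagram. -/
theorem IsFraming.pfaffianTerm_eq {R : Type*} [CommRing R]
    {B : Fin m ⊕ Fin m → Fin m ⊕ Fin m → R} (hB : ∀ x y, B y x = -B x y) {d : BrauerDiagram m}
    {π ρ : Equiv.Perm (Fin m ⊕ Fin m)} (hπ : d.IsFraming π) (hρ : d.IsFraming ρ) :
    pfaffianTerm B ρ = pfaffianTerm B π := by
  have hh : ∀ v, (π⁻¹ * ρ) v.swap = ((π⁻¹ * ρ) v).swap := by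
    intro v
    apply π.injective
    rw [← hπ]
    simp only [Equiv.Perm.mul_apply, Equiv.Perm.coe_inv, Equiv.apply_symm_apply]
    exact (hρ v).symm
  have h1 := sign_mul_prod_of_comm_swap (B := fun x y => B (π x) (π y))
    (fun x y => hB _ _) (π⁻¹ * ρ) hh
  rw [pfaffianTerm, pfaffianTerm, ← h1, pfaffianTerm, ← mul_assoc]
  have h2 : ((Equiv.Perm.sign π : ℤ) : R) * ((Equiv.Perm.sign (π⁻¹ * ρ) : ℤ) : R) =
      ((Equiv.Perm.sign ρ : ℤ) : R) := by
    rw [← Int.cast_mul, ← Units.val_mul, ← map_mul, mul_inv_cancel_left]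
  rw [h2]
  simp only [Equiv.Perm.mul_apply, Equiv.Perm.coe_inv, Equiv.apply_symm_apply]

/-! ### Framings of products -/

theorem isFraming_one : (one m).IsFraming 1 := fun _ => rfl

theorem IsFraming.swapBottom {d : BrauerDiagram m} {π : Equiv.Perm (Fin m ⊕ Fin m)}
    (h : d.IsFraming π) (a b : Fin m) :
    (d.swapBottom a b).IsFraming (Equiv.sumCongr 1 (Equiv.swap a b) * π) := by
  intro v
  have h2 : ∀ w : Fin m ⊕ Fin m,
      Sum.map id (Equiv.swap a b) (Sum.map id (Equiv.swap a b) w) = w := by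
    rintro (w | w) <;> simp
  change Sum.map id (Equiv.swap a b) (d.mate (Sum.map id (Equiv.swap a b)
    (Sum.map id (Equiv.swap a b) (π v)))) = Sum.map id (Equiv.swap a b) (π v.swap)
  rw [h2, h]

/-- The three-cycle that turns the directed edges `p → a` and `b → q` into `p → q` and `a → b`. -/
def rejoin (k l : Fin m) : Equiv.Perm (Fin m ⊕ Fin m) :=
  Equiv.swap (Sum.inr k) (Sum.inr l) * Equiv.swap (Sum.inl l) (Sum.inr l)

theorem sign_rejoin {k l : Fin m} (hkl : k ≠ l) : Equiv.Perm.sign (rejoin k l) = 1 := by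
  rw [rejoin, map_mul, Equiv.Perm.sign_swap (by simpa), Equiv.Perm.sign_swap (by simp)]
  rfl

theorem rejoin_apply {k l : Fin m} (hkl : k ≠ l) :
    rejoin k l (Sum.inl k) = Sum.inl k ∧ rejoin k l (Sum.inr k) = Sum.inr l ∧
      rejoin k l (Sum.inl l) = Sum.inr k ∧ rejoin k l (Sum.inr l) = Sum.inl l ∧
      ∀ x, x ≠ k → x ≠ l → rejoin k l (Sum.inl x) = Sum.inl x ∧
        rejoin k l (Sum.inr x) = Sum.inr x := by
  simp only [rejoin, Equiv.Perm.mul_apply, Equiv.swap_apply_def]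
  grind

theorem IsFraming.joinBottom {d : BrauerDiagram m} {π : Equiv.Perm (Fin m ⊕ Fin m)}
    (h : d.IsFraming π) {a b k l : Fin m} (hab : a ≠ b) (hkl : k ≠ l)
    (ha : π (Sum.inr k) = Sum.inr a) (hb : π (Sum.inl l) = Sum.inr b) :
    (d.joinBottom a b hab).IsFraming (π * rejoin k l) := by
  obtain ⟨h1, h2, h3, h4, h5⟩ := rejoin_apply hkl
  have hl : ∀ x, d.mate (π (Sum.inl x)) = π (Sum.inr x) := fun x => h _
  have hr : ∀ x, d.mate (π (Sum.inr x)) = π (Sum.inl x) := fun x => h _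
  have hinj := π.injective
  intro v
  rw [Equiv.Perm.mul_apply, Equiv.Perm.mul_apply]
  simp only [BrauerDiagram.joinBottom, ← ha, ← hb, hl, hr, hinj.eq_iff]
  rcases v with x | x
  · rw [Sum.swap_inl]
    by_cases hx : x = k
    · subst hx; simp [h1, h2, hkl, hl]
    by_cases hx' : x = l
    · subst hx'; simp [h3, h4]
    · rw [(h5 x hx hx').1, (h5 x hx hx').2]
      simp [hx, hx', hl, hinj.eq_iff]
  · rw [Sum.swap_inr]
    by_cases hx : x = k
    · subst hx; simp [h1, h2, hkl.symm, hr, hinj.eq_iff]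
    by_cases hx' : x = l
    · subst hx'; simp [h3, h4]
    · rw [(h5 x hx hx').1, (h5 x hx hx').2]
      simp [hx, hx', hr, hinj.eq_iff]

end BrauerDiagram

/-! ### Right multiplication by `P` and `Q` -/

namespace SymplecticTensor

open BrauerAlgebra BrauerDiagram

section

variable {R : Type*} [CommRing R] {N m : ℕ}

theorem onFactors_apply {a b : Fin m} (hab : a ≠ b) (X Y : Matrix (Fin N) (Fin N) R)
    (i j : Fin m → Fin N) :
    onFactors a b X Y i j = X (i a) (j a) * Y (i b) (j b) *
      if i = Function.update (Function.update j a (i a)) b (i b) then 1 else 0 := by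
  have h1 : ∏ c ∈ (Finset.univ.erase a).erase b, (1 : Matrix (Fin N) (Fin N) R) (i c) (j c) =
      if i = Function.update (Function.update j a (i a)) b (i b) then 1 else 0 := by
    simp only [Matrix.one_apply, Finset.prod_ite_zero, Finset.prod_const_one]
    congr 1
    simp only [Finset.mem_erase, Finset.mem_univ, and_true, funext_iff, Function.update_apply,
      eq_iff_iff]
    grind
  rw [← h1, onFactors, tensor, Matrix.of_apply,
    ← Finset.mul_prod_erase _ _ (Finset.mem_univ a),
    ← Finset.mul_prod_erase _ _ (Finset.mem_erase.2 ⟨hab.symm, Finset.mem_univ b⟩), ← mul_assoc]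
  congr 1
  · simp [hab]
  · refine Finset.prod_congr rfl fun c hc => ?_
    simp only [Finset.mem_erase, Finset.mem_univ, and_true] at hc
    rw [Function.update_of_ne hc.1, Function.update_of_ne hc.2]
    rfl

theorem mul_onFactors_apply (M : TensorEnd R N m) {a b : Fin m} (hab : a ≠ b)
    (X Y : Matrix (Fin N) (Fin N) R) (i j : Fin m → Fin N) :
    (M * onFactors a b X Y) i j = ∑ u, ∑ v,
      M i (Function.update (Function.update j a u) b v) * (X u (j a) * Y v (j b)) := by
  rw [Matrix.mul_apply, ← Finset.sum_product']
  simp only [onFactors_apply hab, mul_ite, mul_one, mul_zero]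
  rw [← Finset.sum_filter]
  refine Finset.sum_nbij' (fun k => (k a, k b))
    (fun p => Function.update (Function.update j a p.1) b p.2) ?_ ?_ ?_ ?_ ?_
  · intro k _; simp
  · intro p _; simp [hab]
  · intro k hk; exact (Finset.mem_filter.1 hk).2.symm
  · intro p _; simp [hab]
  · intro k hk
    simp only
    rw [← (Finset.mem_filter.1 hk).2]

theorem mul_P_apply (M : TensorEnd R N m) {a b : Fin m} (hab : a ≠ b) (i j : Fin m → Fin N) :
    (M * (P a b : TensorEnd R N m)) i j = M i (j ∘ Equiv.swap a b) := by
  have hj : j ∘ Equiv.swap a b = Function.update (Function.update j a (j b)) b (j a) := by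
    funext c
    simp only [Function.comp, Equiv.swap_apply_def, Function.update_apply]
    grind
  simp only [P, Finset.mul_sum, Matrix.sum_apply, mul_onFactors_apply M hab, Matrix.single_apply]
  rw [Finset.sum_eq_single (j b), Finset.sum_eq_single (j a), Finset.sum_eq_single (j b),
    Finset.sum_eq_single (j a), hj]
  · simp
  all_goals first
    | (intro x _ hx; simp [hx, hx.symm])
    | simp

/-- The symplectic form, with values `ε_u` at `(u, u')`. -/
def form (n : ℕ) (u v : Fin (2 * n)) : R := if v = u.rev then sgn n u else 0

theorem sgn_rev (n : ℕ) (u : Fin (2 * n)) : (sgn n u.rev : R) = -sgn n u := by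
  simp only [sgn, Fin.val_rev]
  split_ifs <;> first | omega | simp

theorem sgn_mul_self (n : ℕ) (u : Fin (2 * n)) : (sgn n u * sgn n u : R) = 1 := by
  simp only [sgn]
  split_ifs <;> simp

theorem mul_Q_apply {n : ℕ} (M : TensorEnd R (2 * n) m) {a b : Fin m} (hab : a ≠ b)
    (i j : Fin m → Fin (2 * n)) :
    (M * (Q n a b : TensorEnd R (2 * n) m)) i j = form n (j a) (j b) *
      ∑ u, sgn n u * M i (Function.update (Function.update j a u) b u.rev) := by
  simp only [Q, Finset.mul_sum, Matrix.sum_apply, Matrix.mul_smul, Matrix.smul_apply,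
    mul_onFactors_apply M hab, Matrix.single_apply]
  refine Finset.sum_congr rfl fun p _ => ?_
  rw [Finset.sum_eq_single (j a), Finset.sum_eq_single p, Finset.sum_eq_single p.rev]
  · simp only [form, smul_eq_mul, true_and, if_true, mul_ite, mul_one, mul_zero, ite_mul,
      zero_mul]
    simp only [eq_comm]
    split_ifs
    · ring
    · rfl
  · intro x _ hx; simp [hx.symm]
  · simp
  · intro x _ hx; refine Finset.sum_eq_zero fun y _ => ?_; simp [hx.symm]
  · simp
  · intro x _ hx
    simp [hx]
  · simp

end

/-! ### The action of a diagram -/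

section

variable {R : Type*} [CommRing R] {n m : ℕ}

/-- The form on the labels of dots: a label of a dot of the top row is `Sum.inl u`, one of a dot of
the bottom row is `Sum.inr u`. Horizontal edges carry the symplectic form, an edge directed
downwards forces equal labels, and an edge directed upwards does so with a sign. -/
def labelForm (n : ℕ) : Fin (2 * n) ⊕ Fin (2 * n) → Fin (2 * n) ⊕ Fin (2 * n) → R
  | Sum.inl u, Sum.inl v => form n u v
  | Sum.inr u, Sum.inr v => form n u v
  | Sum.inl u, Sum.inr v => if u = v then 1 else 0
  | Sum.inr u, Sum.inl v => if u = v then -1 else 0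

theorem form_antisymm (u v : Fin (2 * n)) : (form n v u : R) = -form n u v := by
  simp only [form]
  by_cases h : v = u.rev
  · subst h; simp [sgn_rev]
  · have h' : u ≠ v.rev := by rintro rfl; simp at h
    simp [h, h']

theorem labelForm_antisymm (x y : Fin (2 * n) ⊕ Fin (2 * n)) :
    (labelForm n y x : R) = -labelForm n x y := by
  rcases x with u | u <;> rcases y with v | v <;> simp only [labelForm]
  · exact form_antisymm u v
  · simp only [eq_comm (a := v)]; split_ifs <;> simp
  · simp only [eq_comm (a := v)]; split_ifs <;> simp
  · exact form_antisymm u v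

/-- Contraction of two edges that end at the bottom row. -/
theorem sum_labelForm_mul_labelForm (x y : Fin (2 * n) ⊕ Fin (2 * n)) :
    ∑ u, sgn n u * (labelForm n x (Sum.inr u) * labelForm n (Sum.inr u.rev) y) =
      -(labelForm n x y : R) := by
  rcases x with v | v
  · rw [Finset.sum_eq_single v]
    · rcases y with w | w
      · simp only [labelForm, form, if_true, eq_comm (a := w)]
        split_ifs <;> simp
      · by_cases h : v = w <;> simp [labelForm, form, h, sgn_rev, sgn_mul_self, eq_comm (a := w)]
    · intro u _ hu; simp [labelForm, hu.symm]
    · simp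
  · rw [Finset.sum_eq_single v.rev]
    · rcases y with w | w
      · by_cases h : v = w <;> simp [labelForm, form, h, sgn_rev, sgn_mul_self]
      · simp only [labelForm, form, if_true, Fin.rev_rev, sgn_rev]
        rw [← mul_assoc, neg_mul, sgn_mul_self, neg_one_mul]
    · intro u _ hu; simp [labelForm, form, hu]
    · simp

/-- The form on the dots of a diagram whose rows are labelled by `i` and `j`. -/
def dotForm (n : ℕ) (i j : Fin m → Fin (2 * n)) (x y : Fin m ⊕ Fin m) : R :=
  labelForm n (Sum.map i j x) (Sum.map i j y)

theorem dotForm_antisymm (i j : Fin m → Fin (2 * n)) (x y : Fin m ⊕ Fin m) :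
    (dotForm n i j y x : R) = -dotForm n i j x y := labelForm_antisymm _ _

/-- The operator by which a diagram acts on the tensor space. It is defined by means of some
framing, the choice of which is irrelevant (`diagramAction_apply`). -/
noncomputable def diagramAction (R : Type*) [CommRing R] (n : ℕ) (d : BrauerDiagram m) :
    TensorEnd R (2 * n) m :=
  Matrix.of fun i j => pfaffianTerm (dotForm n i j) d.exists_isFraming.choose

theorem diagramAction_apply {d : BrauerDiagram m} {π : Equiv.Perm (Fin m ⊕ Fin m)}
    (h : d.IsFraming π) (i j : Fin m → Fin (2 * n)) :
    diagramAction R n d i j = pfaffianTerm (dotForm n i j) π :=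
  h.pfaffianTerm_eq (dotForm_antisymm i j) d.exists_isFraming.choose_spec

theorem diagramAction_one : diagramAction R n (BrauerDiagram.one m) = 1 := by
  ext i j
  rw [diagramAction_apply isFraming_one, pfaffianTerm, Matrix.one_apply]
  simp [dotForm, labelForm, Finset.prod_ite_zero, funext_iff]

theorem diagramAction_swapBottom (d : BrauerDiagram m) {a b : Fin m} (hab : a ≠ b) :
    diagramAction R n (d.swapBottom a b) = diagramAction R n d * -P a b := by
  obtain ⟨π, hπ⟩ := d.exists_isFraming
  ext i j
  rw [Matrix.mul_neg, Matrix.neg_apply, mul_P_apply _ hab, diagramAction_apply hπ,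
    diagramAction_apply (hπ.swapBottom a b), pfaffianTerm, pfaffianTerm, map_mul,
    Equiv.Perm.sign_sumCongr, Equiv.Perm.sign_swap hab]
  have h : ∀ x : Fin m ⊕ Fin m, Sum.map i j (Equiv.sumCongr 1 (Equiv.swap a b) x) =
      Sum.map i (j ∘ Equiv.swap a b) x := by
    rintro (x | x) <;> rfl
  have hs : (((Equiv.Perm.sign (1 : Equiv.Perm (Fin m)) * -1 * Equiv.Perm.sign π : ℤˣ) : ℤ) : R) =
      -((Equiv.Perm.sign π : ℤ) : R) := by simp
  simp only [dotForm, Equiv.Perm.mul_apply, h]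
  rw [hs, neg_mul]

theorem map_update_update_of_ne (i j : Fin m → Fin (2 * n)) {a b : Fin m} {x : Fin m ⊕ Fin m}
    (ha : x ≠ Sum.inr a) (hb : x ≠ Sum.inr b) (u v : Fin (2 * n)) :
    Sum.map i (Function.update (Function.update j a u) b v) x = Sum.map i j x := by
  rcases x with x | x
  · rfl
  · have ha' : x ≠ a := fun h => ha (by rw [h])
    have hb' : x ≠ b := fun h => hb (by rw [h])
    simp [ha', hb']

theorem diagramAction_mul_Q_of_eq (d : BrauerDiagram m) {a b : Fin m} (hab : a ≠ b)
    (h : d.mate (Sum.inr a) = Sum.inr b) :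
    diagramAction R n d * -Q n a b = (-(2 * n : R)) • diagramAction R n d := by
  obtain ⟨π, k, hπ, hk, hk'⟩ := d.exists_isFraming_inr (Sum.inr b)
  rw [← h, d.mate_mate] at hk'
  ext i j
  rw [Matrix.mul_neg, Matrix.neg_apply, mul_Q_apply _ hab, Matrix.smul_apply]
  simp only [diagramAction_apply hπ, pfaffianTerm]
  rw [← Finset.mul_prod_erase _ _ (Finset.mem_univ k)]
  have h1 : ∀ u, sgn n u * (((Equiv.Perm.sign π : ℤ) : R) * ∏ l,
      dotForm n i (Function.update (Function.update j a u) b u.rev)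
        (π (Sum.inl l)) (π (Sum.inr l))) = ((Equiv.Perm.sign π : ℤ) : R) *
      ∏ l ∈ Finset.univ.erase k, dotForm n i j (π (Sum.inl l)) (π (Sum.inr l)) := by
    intro u
    have h2 : (dotForm n i (Function.update (Function.update j a u) b u.rev)
        (π (Sum.inl k)) (π (Sum.inr k)) : R) = sgn n u := by
      simp [dotForm, hk, hk', labelForm, form, hab]
    have h3 : ∀ l ∈ Finset.univ.erase k,
        (dotForm n i (Function.update (Function.update j a u) b u.rev)
          (π (Sum.inl l)) (π (Sum.inr l)) : R) = dotForm n i j (π (Sum.inl l)) (π (Sum.inr l)) := by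
      intro l hl
      have hl := Finset.ne_of_mem_erase hl
      rw [dotForm, dotForm, map_update_update_of_ne, map_update_update_of_ne] <;>
        simp [← hk, ← hk', hl]
    rw [← Finset.mul_prod_erase _ _ (Finset.mem_univ k), h2, Finset.prod_congr rfl h3]
    linear_combination (((Equiv.Perm.sign π : ℤ) : R) *
      ∏ l ∈ Finset.univ.erase k, dotForm n i j (π (Sum.inl l)) (π (Sum.inr l))) *
        sgn_mul_self (R := R) n u
  have h4 : (dotForm n i j (π (Sum.inl k)) (π (Sum.inr k)) : R) = form n (j a) (j b) := by
    rw [hk, hk']; rfl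
  simp only [h1, Finset.sum_const, Finset.card_univ, Fintype.card_fin, h4, nsmul_eq_mul,
    smul_eq_mul]
  push_cast
  ring

theorem diagramAction_mul_Q_of_ne (d : BrauerDiagram m) {a b : Fin m} (hab : a ≠ b)
    (h : d.mate (Sum.inr a) ≠ Sum.inr b) :
    diagramAction R n d * -Q n a b = diagramAction R n (d.joinBottom a b hab) := by
  obtain ⟨π, k, l, hπ, hkl, hk, hk', hl, hl'⟩ := d.exists_isFraming_inr_inl
    (x := Sum.inr a) (y := Sum.inr b) (fun h => hab (Sum.inr_injective h).symm) h
  obtain ⟨r1, r2, r3, r4, r5⟩ := rejoin_apply hkl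
  ext i j
  rw [Matrix.mul_neg, Matrix.neg_apply, mul_Q_apply _ hab,
    diagramAction_apply (hπ.joinBottom hab hkl hk hl)]
  simp only [diagramAction_apply hπ, pfaffianTerm]
  have hmem : l ∈ Finset.univ.erase k := Finset.mem_erase.2 ⟨hkl.symm, Finset.mem_univ l⟩
  set rest : R := ∏ x ∈ (Finset.univ.erase k).erase l,
    dotForm n i j (π (Sum.inl x)) (π (Sum.inr x)) with hrest
  have h1 : ∀ u, ∏ x, (dotForm n i (Function.update (Function.update j a u) b u.rev)
      (π (Sum.inl x)) (π (Sum.inr x)) : R) =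
      labelForm n (Sum.map i j (π (Sum.inl k))) (Sum.inr u) *
        labelForm n (Sum.inr u.rev) (Sum.map i j (π (Sum.inr l))) * rest := by
    intro u
    rw [← Finset.mul_prod_erase _ _ (Finset.mem_univ k), ← Finset.mul_prod_erase _ _ hmem,
      ← mul_assoc]
    congr 1
    · congr 1
      · rw [dotForm, map_update_update_of_ne i j (x := π (Sum.inl k)) (by simp [← hk])
          (by simp [← hl, hkl]), hk]
        simp [hab]
      · rw [dotForm, map_update_update_of_ne i j (x := π (Sum.inr l)) (by simp [← hk, hkl.symm])
          (by simp [← hl]), hl]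
        simp
    · refine Finset.prod_congr rfl fun x hx => ?_
      simp only [Finset.mem_erase, Finset.mem_univ, and_true] at hx
      rw [dotForm, dotForm, map_update_update_of_ne, map_update_update_of_ne] <;>
        simp [← hk, ← hl, hx.1, hx.2]
  have h2 : ∏ x, (dotForm n i j ((π * rejoin k l) (Sum.inl x)) ((π * rejoin k l) (Sum.inr x)) : R) =
      labelForm n (Sum.map i j (π (Sum.inl k))) (Sum.map i j (π (Sum.inr l))) *
        form n (j a) (j b) * rest := by
    simp only [Equiv.Perm.mul_apply]
    rw [← Finset.mul_prod_erase _ _ (Finset.mem_univ k), ← Finset.mul_prod_erase _ _ hmem,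
      ← mul_assoc, r1, r2, r3, r4, hk, hl]
    congr 1
    refine Finset.prod_congr rfl fun x hx => ?_
    simp only [Finset.mem_erase, Finset.mem_univ, and_true] at hx
    rw [(r5 x hx.2 hx.1).1, (r5 x hx.2 hx.1).2]
  have h3 := sum_labelForm_mul_labelForm (R := R) (Sum.map i j (π (Sum.inl k)))
    (Sum.map i j (π (Sum.inr l)))
  rw [h2, map_mul, sign_rejoin hkl, mul_one]
  simp only [h1]
  have h4 : ∑ u, sgn n u * (((Equiv.Perm.sign π : ℤ) : R) *
      (labelForm n (Sum.map i j (π (Sum.inl k))) (Sum.inr u) *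
        labelForm n (Sum.inr u.rev) (Sum.map i j (π (Sum.inr l))) * rest)) =
      ((Equiv.Perm.sign π : ℤ) : R) * rest * ∑ u, sgn n u *
        (labelForm n (Sum.map i j (π (Sum.inl k))) (Sum.inr u) *
          labelForm n (Sum.inr u.rev) (Sum.map i j (π (Sum.inr l)))) := by
    rw [Finset.mul_sum]
    exact Finset.sum_congr rfl fun u _ => by ring
  rw [h4, h3]
  ring

end

/-! ### The action of the Brauer algebra -/

section

variable (n m : ℕ)

/-- The linear extension of the action of the diagrams. -/
noncomputable def linearAction :
    BrauerAlgebra ℂ (-(2 * n : ℂ)) m →ₗ[ℂ] TensorEnd ℂ (2 * n) m :=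
  BrauerAlgebra.extend (diagramAction ℂ n)

variable {n m}

theorem linearAction_diagram (d : BrauerDiagram m) :
    linearAction n m (diagram d) = diagramAction ℂ n d := extend_diagram _ d

theorem linearAction_one : linearAction n m 1 = 1 := by
  rw [one_def, linearAction_diagram, diagramAction_one]

theorem linearAction_mul_s {a b : Fin m} (hab : a ≠ b) (x : BrauerAlgebra ℂ (-(2 * n : ℂ)) m) :
    linearAction n m (x * s a b) = linearAction n m x * -P a b := by
  induction x using induction_diagram with
  | h0 => simp
  | hadd x y hx hy => rw [add_mul, map_add, map_add, hx, hy, add_mul]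
  | h c d =>
    rw [smul_mul_assoc, map_smul, map_smul, diagram_mul_s, linearAction_diagram,
      linearAction_diagram, diagramAction_swapBottom d hab, Matrix.smul_mul]

theorem linearAction_mul_eps {a b : Fin m} (hab : a ≠ b)
    (x : BrauerAlgebra ℂ (-(2 * n : ℂ)) m) :
    linearAction n m (x * eps a b hab) = linearAction n m x * -Q n a b := by
  induction x using induction_diagram with
  | h0 => simp
  | hadd x y hx hy => rw [add_mul, map_add, map_add, hx, hy, add_mul]
  | h c d =>
    rw [smul_mul_assoc, map_smul, map_smul, linearAction_diagram, Matrix.smul_mul]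
    by_cases h : d.mate (Sum.inr a) = Sum.inr b
    · rw [diagram_mul_eps_of_eq d hab h, map_smul, linearAction_diagram,
        diagramAction_mul_Q_of_eq d hab h]
    · rw [diagram_mul_eps_of_ne d hab h, linearAction_diagram, diagramAction_mul_Q_of_ne d hab h]

theorem linearAction_s {a b : Fin m} (hab : a ≠ b) : linearAction n m (s a b) = -P a b := by
  rw [← one_mul (s a b), linearAction_mul_s hab, linearAction_one, one_mul]

theorem linearAction_eps {a b : Fin m} (hab : a ≠ b) :
    linearAction n m (eps a b hab) = -Q n a b := by
  rw [← one_mul (eps a b hab), linearAction_mul_eps hab, linearAction_one, one_mul]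

theorem linearAction_mul (x y : BrauerAlgebra ℂ (-(2 * n : ℂ)) m) :
    linearAction n m (x * y) = linearAction n m x * linearAction n m y := by
  have hy : y ∈ Algebra.adjoin ℂ (generators ℂ (-(2 * n : ℂ)) m) := by
    rw [adjoin_generators]; trivial
  induction hy using Algebra.adjoin_induction generalizing x with
  | mem y hy =>
    obtain ⟨a, b, h, rfl | rfl⟩ := hy
    · rw [linearAction_mul_s h.ne, linearAction_s h.ne]
    · rw [linearAction_mul_eps h.ne, linearAction_eps h.ne]
  | algebraMap r =>
    rw [Algebra.algebraMap_eq_smul_one, mul_smul_comm, mul_one, map_smul, map_smul,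
      linearAction_one, mul_smul_comm, mul_one]
  | add y z _ _ hy hz => rw [mul_add, map_add, map_add, hy, hz, mul_add]
  | mul y z _ _ hy hz => rw [← mul_assoc, hz, hy, hz y, mul_assoc]

/-- The action of the Brauer algebra with parameter `-2n` on the tensor space of `ℂ^{2n}`. -/
noncomputable def brauerAction (n m : ℕ) :
    BrauerAlgebra ℂ (-(2 * n : ℂ)) m →ₐ[ℂ] TensorEnd ℂ (2 * n) m :=
  AlgHom.ofLinearMap (linearAction n m) linearAction_one linearAction_mul

theorem brauerAction_s {a b : Fin m} (hab : a ≠ b) : brauerAction n m (s a b) = -P a b :=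
  linearAction_s hab

theorem brauerAction_eps {a b : Fin m} (hab : a ≠ b) :
    brauerAction n m (eps a b hab) = -Q n a b :=
  linearAction_eps hab

theorem isBrauerAction_brauerAction : IsBrauerAction n m (brauerAction n m) :=
  fun _ _ h => ⟨brauerAction_s h.ne, brauerAction_eps h.ne⟩

theorem IsBrauerAction.unique {ρ ρ' : BrauerAlgebra ℂ (-(2 * n : ℂ)) m →ₐ[ℂ] TensorEnd ℂ (2 * n) m}
    (h : IsBrauerAction n m ρ) (h' : IsBrauerAction n m ρ') : ρ' = ρ := by
  refine AlgHom.ext_of_adjoin_eq_top adjoin_generators ?_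
  rintro _ ⟨a, b, hab, rfl | rfl⟩
  · rw [(h a b hab).1, (h' a b hab).1]
  · rw [(h a b hab).2, (h' a b hab).2]

end

end SymplecticTensor

/-! ### Diagonal entries of the symmetrizer on the tensor space -/

namespace SymplecticTensor

open BrauerAlgebra BrauerDiagram

section

variable {n m : ℕ}

theorem transpose_onFactors {N : ℕ} (a b : Fin m) (X Y : Matrix (Fin N) (Fin N) ℂ) :
    (onFactors a b X Y).transpose = onFactors a b X.transpose Y.transpose := by
  ext i j
  simp only [onFactors, tensor, Matrix.transpose_apply, Matrix.of_apply]
  refine Finset.prod_congr rfl fun c _ => ?_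
  simp only [Function.update_apply]
  split_ifs
  · rfl
  · rfl
  · simp [Matrix.one_apply, eq_comm]

theorem transpose_P {N : ℕ} (a b : Fin m) : (P a b : TensorEnd ℂ N m).transpose = P a b := by
  simp only [P, Matrix.transpose_sum, transpose_onFactors, Matrix.transpose_single]
  exact Finset.sum_comm

theorem transpose_Q (a b : Fin m) : (Q n a b : TensorEnd ℂ (2 * n) m).transpose = Q n a b := by
  simp only [Q, Matrix.transpose_sum, Matrix.transpose_smul, transpose_onFactors,
    Matrix.transpose_single]
  rw [Finset.sum_comm]
  simp only [mul_comm]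

/-- The operator by which the symmetrizer without denominators acts. -/
noncomputable def symOp (n : ℕ) (r : ℕ) (h : r ≤ m) : TensorEnd ℂ (2 * n) m :=
  brauerAction n m (rawSymmetrizer (-(2 * n : ℂ)) r h)

theorem brauerAction_transpSum (r : Fin m) : brauerAction n m (transpSum _ r) =
    ∑ a : {a : Fin m // a < r}, -P a.1 r := by
  rw [transpSum, map_sum]
  exact Finset.sum_congr rfl fun a _ => brauerAction_s a.2.ne

theorem brauerAction_contrSum (r : Fin m) : brauerAction n m (contrSum _ r) =
    ∑ a : {a : Fin m // a < r}, -Q n a.1 r := by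
  rw [contrSum, map_sum]
  exact Finset.sum_congr rfl fun a _ => brauerAction_eps a.2.ne

theorem symOp_swap {r : ℕ} (h : r ≤ m) {a b : Fin m} (hab : a ≠ b) (ha : (a : ℕ) < r)
    (hb : (b : ℕ) < r) (i j : Fin m → Fin (2 * n)) :
    symOp n r h i (j ∘ Equiv.swap a b) = -symOp n r h i j := by
  have h1 := congrArg (brauerAction n m)
    (isRightSymmetric_rawSymmetrizer (-(2 * n : ℂ)) r h a b hab ha hb).1
  rw [map_mul, brauerAction_s hab] at h1
  have h2 := congrFun (congrFun h1 i) j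
  rw [Matrix.mul_neg, Matrix.neg_apply, mul_P_apply _ hab] at h2
  rw [symOp, ← h2, neg_neg]

/-- The symmetrizer on the first `r` factors does not change the other ones. -/
theorem symOp_support : ∀ {r : ℕ} (h : r ≤ m) (i j : Fin m → Fin (2 * n)),
    symOp n r h i j ≠ 0 → ∀ c : Fin m, r ≤ c → i c = j c := by
  have key : ∀ {r : ℕ} (hr : r < m) (M : TensorEnd ℂ (2 * n) m),
      (∀ i j, M i j ≠ 0 → ∀ c : Fin m, r + 1 ≤ c → i c = j c) → ∀ t : ℂ, ∀ i j,
      (M * (brauerAction n m (reducedJM _ ⟨r, hr⟩) + algebraMap ℂ _ t)) i j ≠ 0 →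
        ∀ c : Fin m, r + 1 ≤ c → i c = j c := by
    intro r hr M hM t i j hij c hc
    by_contra hcon
    have hne : ∀ a : Fin m, a ≤ ⟨r, hr⟩ → c ≠ a := by
      rintro a ha rfl
      exact absurd (Fin.le_def.1 ha) (by simpa using hc)
    have h0 : ∀ j', j' c = j c → M i j' = 0 := by
      intro j' hj'
      by_contra hne
      exact hcon ((hM i j' hne c hc).trans hj')
    apply hij
    rw [reducedJM, map_sub, brauerAction_transpSum, brauerAction_contrSum, mul_add, mul_sub,
      Finset.mul_sum, Finset.mul_sum, Matrix.add_apply, Matrix.sub_apply, Matrix.sum_apply,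
      Matrix.sum_apply, Finset.sum_eq_zero, Finset.sum_eq_zero, Algebra.algebraMap_eq_smul_one,
      mul_smul_comm, mul_one, Matrix.smul_apply, h0 j rfl, sub_zero, smul_zero, add_zero]
    · intro a _
      rw [Matrix.mul_neg, Matrix.neg_apply, mul_Q_apply _ a.2.ne, Finset.sum_eq_zero, mul_zero,
        neg_zero]
      intro u _
      rw [h0, mul_zero]
      rw [Function.update_of_ne (hne _ le_rfl), Function.update_of_ne (hne _ a.2.le)]
    · intro a _
      rw [Matrix.mul_neg, Matrix.neg_apply, mul_P_apply _ a.2.ne, h0, neg_zero]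
      rw [Function.comp, Equiv.swap_apply_of_ne_of_ne (hne _ a.2.le) (hne _ le_rfl)]
  intro r
  induction r with
  | zero =>
    intro h i j hij c _
    rw [symOp, rawSymmetrizer, map_one, Matrix.one_apply] at hij
    rw [(ite_ne_right_iff.1 hij).1]
  | succ r ih =>
    intro h i j hij
    have h1 : symOp n (r + 1) h = symOp n r (Nat.le_of_succ_le h) *
        (brauerAction n m (reducedJM _ ⟨r, h⟩) + algebraMap ℂ _ 1) *
        (brauerAction n m (reducedJM _ ⟨r, h⟩) + algebraMap ℂ _ (-(2 * n : ℂ) + r - 2)) := by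
      rw [symOp, rawSymmetrizer, map_mul, map_mul, map_add, map_add, AlgHom.commutes, map_one,
        map_one, mul_assoc]
      rfl
    rw [h1] at hij
    exact key h _ (key h _ (fun i j hij c hc => ih _ i j hij c (Nat.le_of_succ_le hc)) _) _ i j hij

/-- The factorization of the recursion step, `G` being the product with the first factor. -/
theorem symOp_succ_apply {r : ℕ} (h : r < m) (i j : Fin m → Fin (2 * n)) (G : TensorEnd ℂ (2 * n) m)
    (hG : G = (-(2 * n : ℂ) + 2 * r - 2) • symOp n r h.le +
      ∑ a : {a : Fin m // a < ⟨r, h⟩}, symOp n r h.le * (Q n a.1 ⟨r, h⟩ : TensorEnd ℂ (2 * n) m)) :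
    symOp n (r + 1) h i j =
      G i j - ∑ b : {b : Fin m // b < ⟨r, h⟩}, G i (j ∘ Equiv.swap b.1 ⟨r, h⟩) := by
  have h1 := (isRightSymmetric_rawSymmetrizer (-(2 * n : ℂ)) r h.le).mul_quadratic (r := ⟨r, h⟩)
  have h2 : symOp n (r + 1) h = G * (1 + ∑ a : {a : Fin m // a < ⟨r, h⟩}, -P a.1 ⟨r, h⟩) := by
    rw [symOp, rawSymmetrizer]
    refine (congrArg _ h1).trans ?_
    rw [map_mul, map_mul, map_sub, map_add, map_one, AlgHom.commutes, brauerAction_transpSum,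
      brauerAction_contrSum, hG, mul_sub, Finset.mul_sum, Algebra.algebraMap_eq_smul_one,
      mul_smul_comm, mul_one]
    simp only [Matrix.mul_neg, Finset.sum_neg_distrib, sub_neg_eq_add]
    rfl
  rw [h2, mul_add, mul_one, Finset.mul_sum, Matrix.add_apply, Matrix.sum_apply, sub_eq_add_neg,
    ← Finset.sum_neg_distrib]
  congr 1
  refine Finset.sum_congr rfl fun b _ => ?_
  rw [Matrix.mul_neg, Matrix.neg_apply, mul_P_apply _ b.2.ne]

section

variable {r : ℕ} (h : r < m) {i : Fin m → Fin (2 * n)}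

theorem symOp_apply_swap_eq_zero (hi : Function.Injective i) {b : Fin m} (hb : b < ⟨r, h⟩) :
    symOp n r h.le i (i ∘ Equiv.swap b ⟨r, h⟩) = 0 := by
  by_contra hne
  have h1 := symOp_support h.le _ _ hne ⟨r, h⟩ le_rfl
  rw [Function.comp, Equiv.swap_apply_right] at h1
  exact hb.ne (hi h1).symm

theorem symOp_mul_Q_apply {a : Fin m} (ha : a < ⟨r, h⟩) (i j : Fin m → Fin (2 * n)) :
    (symOp n r h.le * (Q n a ⟨r, h⟩ : TensorEnd ℂ (2 * n) m)) i j =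
      form n (j a) (j ⟨r, h⟩) * (sgn n (i ⟨r, h⟩).rev * symOp n r h.le i
        (Function.update (Function.update j a (i ⟨r, h⟩).rev) ⟨r, h⟩ (i ⟨r, h⟩))) := by
  rw [mul_Q_apply _ ha.ne, Finset.sum_eq_single (i ⟨r, h⟩).rev]
  · rw [Fin.rev_rev]
  · intro u _ hu
    have h0 : symOp n r h.le i (Function.update (Function.update j a u) ⟨r, h⟩ u.rev) = 0 := by
      by_contra hne
      have h1 := symOp_support h.le _ _ hne ⟨r, h⟩ le_rfl
      rw [Function.update_self] at h1
      exact hu (by rw [h1, Fin.rev_rev])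
    rw [h0, mul_zero]
  · simp

theorem symOp_mul_Q_apply_self {a : Fin m} (ha : a < ⟨r, h⟩) :
    (symOp n r h.le * (Q n a ⟨r, h⟩ : TensorEnd ℂ (2 * n) m)) i i =
      if i ⟨r, h⟩ = (i a).rev then symOp n r h.le i i else 0 := by
  rw [symOp_mul_Q_apply h ha, form]
  split_ifs with hr
  · have h1 : Function.update (Function.update i a (i ⟨r, h⟩).rev) ⟨r, h⟩ (i ⟨r, h⟩) = i := by
      rw [Function.update_comm ha.ne, Function.update_eq_self, hr, Fin.rev_rev,
        Function.update_eq_self]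
    rw [h1, hr, Fin.rev_rev, ← mul_assoc, sgn_mul_self, one_mul]
  · rw [zero_mul]

theorem symOp_mul_Q_apply_swap_self {a : Fin m} (ha : a < ⟨r, h⟩) :
    (symOp n r h.le * (Q n a ⟨r, h⟩ : TensorEnd ℂ (2 * n) m)) i (i ∘ Equiv.swap a ⟨r, h⟩) =
      -if i ⟨r, h⟩ = (i a).rev then symOp n r h.le i i else 0 := by
  rw [← symOp_mul_Q_apply_self h ha, symOp_mul_Q_apply h ha, symOp_mul_Q_apply h ha]
  have h1 : Function.update (Function.update (i ∘ Equiv.swap a ⟨r, h⟩) a (i ⟨r, h⟩).rev) ⟨r, h⟩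
      (i ⟨r, h⟩) = Function.update (Function.update i a (i ⟨r, h⟩).rev) ⟨r, h⟩ (i ⟨r, h⟩) := by
    funext c
    simp only [Function.update_apply, Function.comp, Equiv.swap_apply_def]
    grind
  rw [h1, Function.comp, Function.comp, Equiv.swap_apply_left, Equiv.swap_apply_right,
    form_antisymm, neg_mul]

/-- After the interchange of the letters in the places `b` and `r`, the contraction of the places
`a` and `r` contributes nothing if `i a` and `i b` are not opposite. It contributes nothing either
if the letter opposite to `i r` occurs before, as the contraction then repeats a letter. -/
theorem symOp_mul_Q_apply_swap (hi : Function.Injective i) {a b : Fin m} (ha : a < ⟨r, h⟩)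
    (hb : b < ⟨r, h⟩) (hab : a ≠ b)
    (hcase : (∃ c : Fin m, c < ⟨r, h⟩ ∧ i c = (i ⟨r, h⟩).rev) ∨ i b ≠ (i a).rev) :
    (symOp n r h.le * (Q n a ⟨r, h⟩ : TensorEnd ℂ (2 * n) m)) i (i ∘ Equiv.swap b ⟨r, h⟩) = 0 := by
  rw [symOp_mul_Q_apply h ha, Function.comp, Function.comp, Equiv.swap_apply_right,
    Equiv.swap_apply_of_ne_of_ne hab ha.ne, form]
  split_ifs with hform
  · obtain ⟨c, hc, hcr⟩ := hcase.resolve_right (not_not.2 hform)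
    have hrev : (i ⟨r, h⟩) = (i c).rev := by rw [hcr, Fin.rev_rev]
    have hca : c ≠ a := by
      rintro rfl
      exact hb.ne (hi (hform.trans hrev.symm))
    have hcb : c ≠ b := by
      rintro rfl
      refine ha.ne (hi ?_)
      rw [hrev, hform, Fin.rev_rev]
    set w := Function.update (Function.update (i ∘ Equiv.swap b ⟨r, h⟩) a (i ⟨r, h⟩).rev) ⟨r, h⟩
      (i ⟨r, h⟩) with hw
    have hwac : w a = w c := by
      rw [hw, Function.update_of_ne ha.ne, Function.update_self, Function.update_of_ne hc.ne,
        Function.update_of_ne hca, Function.comp, Equiv.swap_apply_of_ne_of_ne hcb hc.ne, hcr]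
    have hws : w ∘ Equiv.swap a c = w := by
      funext x
      simp only [Function.comp, Equiv.swap_apply_def]
      split_ifs with h1 h2
      · rw [h1, hwac]
      · rw [h2, hwac]
      · rfl
    have h0 := symOp_swap (n := n) h.le hca.symm ha hc i w
    rw [hws] at h0
    have h3 : symOp n r h.le i w = 0 := self_eq_neg.1 h0
    change _ * (_ * symOp n r h.le i w) = 0
    rw [h3, mul_zero, mul_zero]
  · rw [zero_mul]

/-- The diagonal entries satisfy a closed recursion if either the new letter is opposite to an
earlier one, or no two earlier letters are opposite. -/
theorem symOp_succ_apply_self (hi : Function.Injective i)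
    (hcase : (∃ c : Fin m, c < ⟨r, h⟩ ∧ i c = (i ⟨r, h⟩).rev) ∨
      ∀ a b : Fin m, a < ⟨r, h⟩ → b < ⟨r, h⟩ → i b ≠ (i a).rev) :
    symOp n (r + 1) h i i = (-(2 * n : ℂ) + 2 * r - 2 +
      2 * if ∃ c : Fin m, c < ⟨r, h⟩ ∧ i c = (i ⟨r, h⟩).rev then 1 else 0) *
        symOp n r h.le i i := by
  have hsum : ∑ a : {a : Fin m // a < ⟨r, h⟩},
      (if i ⟨r, h⟩ = (i a).rev then symOp n r h.le i i else 0) =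
        (if ∃ c : Fin m, c < ⟨r, h⟩ ∧ i c = (i ⟨r, h⟩).rev then 1 else 0) *
          symOp n r h.le i i := by
    split_ifs with hex
    · obtain ⟨c, hc, hcr⟩ := hex
      rw [Finset.sum_eq_single ⟨c, hc⟩, if_pos (by rw [hcr, Fin.rev_rev]), one_mul]
      · intro a _ hac
        refine if_neg fun hr => hac (Subtype.ext (hi ?_))
        rw [hcr, hr, Fin.rev_rev]
      · simp
    · rw [zero_mul]
      refine Finset.sum_eq_zero fun a _ => if_neg fun hr => hex ⟨a, a.2, ?_⟩
      rw [hr, Fin.rev_rev]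
  rw [symOp_succ_apply h i i _ rfl]
  simp only [Matrix.add_apply, Matrix.sum_apply, Matrix.smul_apply, smul_eq_mul]
  have h1 : ∀ b : {a : Fin m // a < ⟨r, h⟩},
      (-(2 * n : ℂ) + 2 * r - 2) * symOp n r h.le i (i ∘ Equiv.swap b.1 ⟨r, h⟩) +
        ∑ a : {a : Fin m // a < ⟨r, h⟩}, (symOp n r h.le *
          (Q n a.1 ⟨r, h⟩ : TensorEnd ℂ (2 * n) m)) i (i ∘ Equiv.swap b.1 ⟨r, h⟩) =
      -if i ⟨r, h⟩ = (i b).rev then symOp n r h.le i i else 0 := by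
    intro b
    rw [symOp_apply_swap_eq_zero h hi b.2, mul_zero, zero_add, Finset.sum_eq_single b,
      symOp_mul_Q_apply_swap_self h b.2]
    · intro a _ hab
      exact symOp_mul_Q_apply_swap h hi a.2 b.2 (fun h' => hab (Subtype.ext h'))
        (hcase.imp_right fun h' => h' _ _ a.2 b.2)
    · simp
  simp only [h1, fun a : {a : Fin m // a < ⟨r, h⟩} => symOp_mul_Q_apply_self (i := i) h a.2,
    Finset.sum_neg_distrib, hsum]
  ring

end

/-- The letter in the place `a` belongs to the second half of the alphabet and its opposite letter
also occurs in the word. -/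
def IsClosing (i : Fin m → Fin (2 * n)) (a : Fin m) : Prop :=
  n ≤ (i a : ℕ) ∧ ∃ c, i c = (i a).rev

theorem not_isClosing_of_rev {i : Fin m → Fin (2 * n)} {a c : Fin m} (h : n ≤ (i a : ℕ))
    (hc : i c = (i a).rev) : ¬IsClosing i c := by
  rintro ⟨h1, -⟩
  rw [hc, Fin.val_rev] at h1
  omega

theorem isClosing_or_isClosing_of_rev {i : Fin m → Fin (2 * n)} {a c : Fin m}
    (hc : i c = (i a).rev) : IsClosing i a ∨ IsClosing i c := by
  by_cases h : n ≤ (i a : ℕ)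
  · exact Or.inl ⟨h, c, hc⟩
  · refine Or.inr ⟨?_, a, by rw [hc, Fin.rev_rev]⟩
    rw [hc, Fin.val_rev]
    omega

open Classical in
/-- The diagonal entries at a word in which the closing letters come last. The places `a < r` with
closing letters change the product of the scalars `-2n + 2k - 2` to `-2n + 2k`, and the product
telescopes. -/
theorem symOp_apply_self_of_sorted (hm : m ≤ n) {i : Fin m → Fin (2 * n)}
    (hi : Function.Injective i) (hsort : ∀ a b, a ≤ b → IsClosing i a → IsClosing i b) :
    ∀ (r : ℕ) (h : r ≤ m), symOp n r h i i *
      ((n : ℂ) - (Finset.univ.filter fun a : Fin m => (a : ℕ) < r ∧ ¬IsClosing i a).card + 1) =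
        (∏ k ∈ Finset.range r, (-(2 * n : ℂ) + 2 * k - 2)) * ((n : ℂ) - r + 1) := by
  intro r
  induction r with
  | zero =>
    intro h
    simp [symOp, rawSymmetrizer]
  | succ r ih =>
    intro h
    have hIH := ih (Nat.le_of_succ_le h)
    rw [Finset.prod_range_succ]
    by_cases hr : IsClosing i ⟨r, h⟩
    · obtain ⟨hrn, c, hc⟩ := hr
      have hcr : c < ⟨r, h⟩ := by
        by_contra hcr
        exact not_isClosing_of_rev hrn hc (hsort _ _ (not_lt.1 hcr) ⟨hrn, c, hc⟩)
      have hex : ∃ c : Fin m, c < ⟨r, h⟩ ∧ i c = (i ⟨r, h⟩).rev := ⟨c, hcr, hc⟩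
      have hfilter : (Finset.univ.filter fun a : Fin m => (a : ℕ) < r + 1 ∧ ¬IsClosing i a) =
          Finset.univ.filter fun a : Fin m => (a : ℕ) < r ∧ ¬IsClosing i a := by
        refine Finset.filter_congr fun a _ => and_congr_left fun ha => ?_
        rw [Nat.lt_succ_iff_lt_or_eq, or_iff_left]
        rintro rfl
        exact ha ⟨hrn, c, hc⟩
      rw [hfilter, symOp_succ_apply_self h hi (Or.inl hex), if_pos hex]
      push_cast
      linear_combination (-(2 * n : ℂ) + 2 * r) * hIH
    · have hno : ∀ a : Fin m, a ≤ ⟨r, h⟩ → ¬IsClosing i a := fun a ha h' => hr (hsort _ _ ha h')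
      have hpair : ∀ a b : Fin m, a ≤ ⟨r, h⟩ → b ≤ ⟨r, h⟩ → i b ≠ (i a).rev := fun a b ha hb hab =>
        (isClosing_or_isClosing_of_rev hab).elim (hno a ha) (hno b hb)
      have hfilter : ∀ s : ℕ, s ≤ r + 1 →
          (Finset.univ.filter fun a : Fin m => (a : ℕ) < s ∧ ¬IsClosing i a).card = s := by
        intro s hs
        have h1 : (Finset.univ.filter fun a : Fin m => (a : ℕ) < s ∧ ¬IsClosing i a) =
            Finset.univ.filter fun a : Fin m => (a : ℕ) < s := by
          refine Finset.filter_congr fun a _ => and_iff_left_of_imp fun ha => hno a ?_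
          exact Fin.le_def.2 (Nat.lt_succ_iff.1 (ha.trans_le hs))
        rw [h1, Fin.card_filter_val_lt, min_eq_right (hs.trans h)]
      have hex : ¬∃ c : Fin m, c < ⟨r, h⟩ ∧ i c = (i ⟨r, h⟩).rev := by
        rintro ⟨c, hc, hcr⟩
        exact hpair _ _ le_rfl hc.le hcr
      -- All letters so far are not closing, so the induction hypothesis has the factor `n - r + 1`
      -- on both sides.
      have hne : (n : ℂ) - r + 1 ≠ 0 := by
        rw [← Nat.cast_sub (by omega)]
        exact Nat.cast_add_one_ne_zero _
      rw [hfilter r (Nat.le_succ r)] at hIH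
      rw [hfilter (r + 1) le_rfl, symOp_succ_apply_self h hi
        (Or.inr fun a b ha hb => hpair a b ha.le hb.le), if_neg hex, mul_right_cancel₀ hne hIH]
      ring

/-! ### Symmetry of the symmetrizer -/

/-- If `M` is invariant under the action of transpositions from the left and killed by the
contractions, then the symmetrizer multiplies it by a scalar. -/
theorem symOp_mul_eq_smul {M : TensorEnd ℂ (2 * n) m}
    (hP : ∀ a b : Fin m, a ≠ b → P a b * M = -M) (hQ : ∀ a b : Fin m, a ≠ b → Q n a b * M = 0) :
    ∀ (r : ℕ) (h : r ≤ m), symOp n r h * M = symmetrizerDenom (-(2 * n : ℂ)) r • M := by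
  intro r
  induction r with
  | zero =>
    intro h
    simp [symOp, rawSymmetrizer, symmetrizerDenom]
  | succ r ih =>
    intro h
    have hy : brauerAction n m (reducedJM _ ⟨r, h⟩) * M = (r : ℂ) • M := by
      have h1 : ∀ a : {a : Fin m // a < ⟨r, h⟩}, -P a.1 ⟨r, h⟩ * M = M := fun a => by
        rw [Matrix.neg_mul, hP _ _ a.2.ne, neg_neg]
      have h2 : ∀ a : {a : Fin m // a < ⟨r, h⟩}, -Q n a.1 ⟨r, h⟩ * M = 0 := fun a => by
        rw [Matrix.neg_mul, hQ _ _ a.2.ne, neg_zero]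
      rw [reducedJM, map_sub, brauerAction_transpSum, brauerAction_contrSum, sub_mul,
        Finset.sum_mul, Finset.sum_mul, Finset.sum_congr rfl fun a _ => h1 a,
        Finset.sum_congr rfl fun a _ => h2 a, Finset.sum_const_zero, sub_zero,
        Finset.sum_const, Finset.card_univ, card_lt, Nat.cast_smul_eq_nsmul]
    have h1 : symOp n (r + 1) h = symOp n r (Nat.le_of_succ_le h) *
        ((brauerAction n m (reducedJM _ ⟨r, h⟩) + algebraMap ℂ _ 1) *
        (brauerAction n m (reducedJM _ ⟨r, h⟩) + algebraMap ℂ _ (-(2 * n : ℂ) + r - 2))) := by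
      rw [symOp, rawSymmetrizer, map_mul, map_mul, map_add, map_add, AlgHom.commutes, map_one,
        map_one]
      rfl
    have h2 : ∀ t : ℂ, (brauerAction n m (reducedJM _ ⟨r, h⟩) + algebraMap ℂ _ t) * M =
        (r + t) • M := by
      intro t
      rw [add_mul, hy, ← Algebra.smul_def, add_smul]
    rw [h1, mul_assoc, mul_assoc, h2, mul_smul_comm, h2, mul_smul_comm, mul_smul_comm, ih,
      symmetrizerDenom, symmetrizerDenom, Finset.prod_range_succ, smul_smul, smul_smul]
    congr 1
    ring

theorem symmetrizerDenom_ne_zero {n r : ℕ} (h : r ≤ n) :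
    symmetrizerDenom (-(2 * n : ℂ)) r ≠ 0 := by
  refine Finset.prod_ne_zero_iff.2 fun k hk => mul_ne_zero (Nat.cast_add_one_ne_zero k) ?_
  have hk' : k ≤ n := (Finset.mem_range.1 hk).le.trans h
  have h1 : -(2 * n : ℂ) + 2 * k - 2 = -2 * ((n - k : ℕ) + 1) := by
    rw [Nat.cast_sub hk']
    ring
  rw [h1]
  exact mul_ne_zero (by norm_num) (Nat.cast_add_one_ne_zero _)

/-- Both the symmetrizer `Z` and its transpose have the invariance properties of `Z` on one side, so
that `Z Zᵀ` is a nonzero multiple of `Zᵀ`; and `Z Zᵀ` is a symmetric matrix. -/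
theorem transpose_symOp (hm : m ≤ n) :
    (symOp n m le_rfl : TensorEnd ℂ (2 * n) m).transpose = symOp n m le_rfl := by
  have habs : ∀ a b : Fin m, ∀ hab : a ≠ b,
      symOp n m le_rfl * P a b = -symOp n m le_rfl ∧ symOp n m le_rfl * Q n a b = 0 := by
    intro a b hab
    have h1 := isRightSymmetric_rawSymmetrizer (-(2 * n : ℂ)) m le_rfl a b hab a.2 b.2
    have h2 := congrArg (brauerAction n m) h1.1
    have h3 := congrArg (brauerAction n m) h1.2
    rw [map_mul, brauerAction_s hab, Matrix.mul_neg] at h2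
    rw [map_mul, brauerAction_eps hab, Matrix.mul_neg, map_zero] at h3
    exact ⟨neg_eq_iff_eq_neg.1 h2, neg_eq_zero.1 h3⟩
  have hZ := symOp_mul_eq_smul (M := (symOp n m le_rfl : TensorEnd ℂ (2 * n) m).transpose)
    (fun a b hab => by
      rw [← transpose_P a b, ← Matrix.transpose_mul, (habs a b hab).1, Matrix.transpose_neg])
    (fun a b hab => by
      rw [← transpose_Q a b, ← Matrix.transpose_mul, (habs a b hab).2, Matrix.transpose_zero])
    m le_rfl
  have hZ' := congrArg Matrix.transpose hZ
  rw [Matrix.transpose_mul, Matrix.transpose_transpose, hZ, Matrix.transpose_smul,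
    Matrix.transpose_transpose] at hZ'
  exact smul_right_injective _ (symmetrizerDenom_ne_zero hm) hZ'

theorem symOp_apply_self_comp_perm (hm : m ≤ n) (i : Fin m → Fin (2 * n))
    (σ : Equiv.Perm (Fin m)) :
    symOp n m le_rfl (i ∘ σ) (i ∘ σ) = symOp n m le_rfl i i := by
  have ht : ∀ x y : Fin m → Fin (2 * n), symOp n m le_rfl x y = symOp n m le_rfl y x :=
    fun x y => congrFun (congrFun (transpose_symOp hm) y) x
  induction σ using Equiv.Perm.swap_induction_on' with
  | one => rfl
  | mul_swap σ a b hab ih =>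
    rw [Equiv.Perm.coe_mul, ← Function.comp_assoc, symOp_swap le_rfl hab a.2 b.2,
      ht, symOp_swap le_rfl hab a.2 b.2, neg_neg, ih]

theorem symOp_apply_self_of_not_injective {i : Fin m → Fin (2 * n)}
    (hi : ¬Function.Injective i) : symOp n m le_rfl i i = 0 := by
  simp only [Function.Injective, not_forall] at hi
  obtain ⟨a, b, hab, hne⟩ := hi
  have hs : i ∘ Equiv.swap a b = i := by
    funext x
    simp only [Function.comp, Equiv.swap_apply_def]
    split_ifs with h1 h2
    · rw [h1, hab]
    · rw [h2, hab]
    · rfl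
  have h0 := symOp_swap (n := n) le_rfl hne a.2 b.2 i i
  rw [hs] at h0
  exact self_eq_neg.1 h0

theorem isClosing_comp (i : Fin m → Fin (2 * n)) (σ : Equiv.Perm (Fin m)) (a : Fin m) :
    IsClosing (i ∘ σ) a ↔ IsClosing i (σ a) :=
  and_congr_right fun _ => ⟨fun ⟨c, hc⟩ => ⟨σ c, hc⟩, fun ⟨c, hc⟩ => ⟨σ.symm c, by simpa using hc⟩⟩

open Classical in
/-- The diagonal entry at an arbitrary word without repetitions, reduced to the sorted case. -/
theorem symOp_apply_self (hm : m ≤ n) {i : Fin m → Fin (2 * n)} (hi : Function.Injective i) :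
    symOp n m le_rfl i i *
      ((n : ℂ) - (Finset.univ.filter fun a : Fin m => ¬IsClosing i a).card + 1) =
        (∏ k ∈ Finset.range m, (-(2 * n : ℂ) + 2 * k - 2)) * ((n : ℂ) - m + 1) := by
  set σ := Tuple.sort fun a => decide (IsClosing i a) with hσ
  have hmono := Tuple.monotone_sort fun a => decide (IsClosing i a)
  rw [← symOp_apply_self_comp_perm hm i σ, ← symOp_apply_self_of_sorted hm (hi.comp σ.injective)
    (fun a b hab ha => by
      rw [isClosing_comp] at ha ⊢
      have h1 := hmono hab
      simp only [Function.comp, ← hσ, decide_eq_true ha] at h1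
      exact of_decide_eq_true (top_le_iff.1 h1)) m le_rfl]
  congr 4
  refine (Finset.card_equiv σ fun a => ?_).symm
  simp [isClosing_comp]

end

end SymplecticTensor

/-! ### Sums over words and over pairs of subsets -/

section Words

variable {α : Type*} [Fintype α] [DecidableEq α] {m : ℕ}

theorem card_injective_image_eq {I : Finset α} (hI : I.card = m) :
    (Finset.univ.filter fun i : Fin m → α =>
      Function.Injective i ∧ Finset.univ.image i = I).card = m.factorial := by
  have h1 : m.factorial = Fintype.card (Fin m ≃ I) := by
    rw [Fintype.card_equiv (Fintype.equivOfCardEq (by simp [hI])), Fintype.card_fin]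
  rw [h1, ← Fintype.card_subtype]
  symm
  refine Fintype.card_congr (Equiv.ofBijective
    (fun f => ⟨fun a => (f a : α), Subtype.val_injective.comp f.injective, ?_⟩) ⟨?_, ?_⟩)
  · ext x
    simp only [Finset.mem_image, Finset.mem_univ, true_and]
    exact ⟨fun ⟨a, ha⟩ => ha ▸ (f a).2, fun hx => ⟨f.symm ⟨x, hx⟩, by simp⟩⟩
  · intro f g hfg
    exact Equiv.ext fun a => Subtype.ext (congrFun (Subtype.mk.inj hfg) a)
  · rintro ⟨i, hi, rfl⟩
    have hbij : Function.Bijective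
        fun a => (⟨i a, Finset.mem_image_of_mem _ (Finset.mem_univ a)⟩ :
          (Finset.univ.image i : Finset α)) := by
      refine ⟨fun a b hab => hi (Subtype.mk.inj hab), ?_⟩
      rintro ⟨x, hx⟩
      obtain ⟨a, -, rfl⟩ := Finset.mem_image.1 hx
      exact ⟨a, rfl⟩
    exact ⟨Equiv.ofBijective _ hbij, rfl⟩

/-- A function on words that vanishes if a letter is repeated and otherwise depends only on the set
of letters. -/
theorem sum_words_eq_sum_powersetCard {M : Type*} [AddCommMonoid M] (f : (Fin m → α) → M)
    (g : Finset α → M) (h0 : ∀ i, ¬Function.Injective i → f i = 0)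
    (h1 : ∀ i, Function.Injective i → f i = g (Finset.univ.image i)) :
    ∑ i, f i = m.factorial • ∑ I ∈ Finset.univ.powersetCard m, g I := by
  classical
  rw [← Finset.sum_filter_of_ne (p := Function.Injective)
    fun i _ hi => not_imp_comm.1 (h0 i) hi, Finset.smul_sum,
    ← Finset.sum_fiberwise_of_maps_to (g := fun i => Finset.univ.image i)
      (t := Finset.univ.powersetCard m)]
  · refine Finset.sum_congr rfl fun I hI => ?_
    rw [Finset.filter_filter, ← card_injective_image_eq (Finset.mem_powersetCard.1 hI).2,
      ← Finset.sum_const]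
    refine Finset.sum_congr rfl fun i hi => ?_
    obtain ⟨-, hi, hI⟩ := Finset.mem_filter.1 hi
    rw [h1 i hi, hI]
  · intro i hi
    rw [Finset.mem_powersetCard]
    refine ⟨Finset.subset_univ _, ?_⟩
    rw [Finset.card_image_of_injective _ (Finset.mem_filter.1 hi).2, Finset.card_fin]

end Words

section Pairs

variable {α : Type*} [DecidableEq α] {A B : Finset α} {p : α}

theorem symmDiff_singleton_of_mem (h : p ∈ A) : symmDiff A {p} = A.erase p := by
  ext x
  simp only [Finset.mem_symmDiff, Finset.mem_singleton, Finset.mem_erase]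
  grind

theorem symmDiff_singleton_of_notMem (h : p ∉ A) : symmDiff A {p} = insert p A := by
  ext x
  simp only [Finset.mem_symmDiff, Finset.mem_singleton, Finset.mem_insert]
  grind

theorem inter_symmDiff_singleton (h : p ∈ symmDiff A B) :
    symmDiff A {p} ∩ symmDiff B {p} = A ∩ B := by
  ext x
  simp only [Finset.mem_symmDiff, Finset.mem_singleton, Finset.mem_inter] at h ⊢
  grind

theorem symmDiff_symmDiff_singleton :
    symmDiff (symmDiff A {p}) (symmDiff B {p}) = symmDiff A B := by
  rw [symmDiff_symmDiff_symmDiff_comm, symmDiff_self, symmDiff_bot]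

theorem card_symmDiff_singleton_add (h : p ∈ symmDiff A B) :
    (symmDiff A {p}).card + (symmDiff B {p}).card = A.card + B.card := by
  rcases Finset.mem_symmDiff.1 h with ⟨h1, h2⟩ | ⟨h1, h2⟩ <;>
  · have := Finset.card_pos.2 ⟨p, h1⟩
    rw [symmDiff_singleton_of_mem h1, symmDiff_singleton_of_notMem h2,
      Finset.card_erase_of_mem h1, Finset.card_insert_of_notMem h2]
    omega

theorem prod_symmDiff_singleton_mul {R : Type*} [CommRing R] (y : α → R)
    (h : p ∈ symmDiff A B) :
    (∏ x ∈ symmDiff A {p}, y x) * ∏ x ∈ symmDiff B {p}, -y x =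
      -((∏ x ∈ A, y x) * ∏ x ∈ B, -y x) := by
  rcases Finset.mem_symmDiff.1 h with ⟨h1, h2⟩ | ⟨h1, h2⟩
  · rw [symmDiff_singleton_of_mem h1, symmDiff_singleton_of_notMem h2, Finset.prod_insert h2,
      ← Finset.mul_prod_erase A y h1]
    ring
  · rw [symmDiff_singleton_of_mem h1, symmDiff_singleton_of_notMem h2, Finset.prod_insert h2,
      ← Finset.mul_prod_erase B (fun x => -y x) h1]
    ring

/-- Pairs of different subsets cancel: removing the least element of the symmetric difference from
one subset and adding it to the other changes the sign. -/
theorem sum_pairs_eq_sum_diagonal {n l : ℕ} {R : Type*} [CommRing R] (β : ℕ → R) (y : Fin n → R) :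
    ∑ q ∈ (Finset.univ : Finset (Finset (Fin n) × Finset (Fin n))).filter
        (fun q => q.1.card + q.2.card = 2 * l),
      β (q.1 ∩ q.2).card * ((∏ p ∈ q.1, y p) * ∏ p ∈ q.2, -y p) =
    β l * (-1) ^ l * ∑ A ∈ Finset.univ.powersetCard l, ∏ p ∈ A, y p ^ 2 := by
  rw [← Finset.sum_filter_add_sum_filter_not _ (fun q => q.1 = q.2)]
  have hdiag : ∑ q ∈ ((Finset.univ : Finset (Finset (Fin n) × Finset (Fin n))).filter
      (fun q => q.1.card + q.2.card = 2 * l)).filter (fun q => q.1 = q.2),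
      β (q.1 ∩ q.2).card * ((∏ p ∈ q.1, y p) * ∏ p ∈ q.2, -y p) =
      β l * (-1) ^ l * ∑ A ∈ Finset.univ.powersetCard l, ∏ p ∈ A, y p ^ 2 := by
    rw [Finset.mul_sum]
    refine Finset.sum_nbij' (fun q => q.1) (fun A => (A, A)) ?_ ?_ ?_ ?_ ?_
    · rintro ⟨A, B⟩ hq
      simp only [Finset.mem_filter, Finset.mem_univ, true_and] at hq
      obtain ⟨hq, rfl⟩ := hq
      change A.card + A.card = 2 * l at hq
      refine Finset.mem_powersetCard.2 ⟨Finset.subset_univ _, ?_⟩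
      change A.card = l
      omega
    · intro A hA
      simp only [Finset.mem_filter, Finset.mem_univ, true_and, and_true]
      rw [(Finset.mem_powersetCard.1 hA).2, two_mul]
    · rintro ⟨A, B⟩ hq
      exact Prod.ext rfl (Finset.mem_filter.1 hq).2
    · intro A _; rfl
    · rintro ⟨A, B⟩ hq
      simp only [Finset.mem_filter, Finset.mem_univ, true_and] at hq
      obtain ⟨hq, rfl⟩ := hq
      have hA : A.card = l := by
        change A.card + A.card = 2 * l at hq
        omega
      rw [Finset.inter_self, hA, mul_assoc, ← Finset.prod_mul_distrib, ← hA, ← Finset.prod_const,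
        ← Finset.prod_mul_distrib]
      congr 1
      exact Finset.prod_congr rfl fun p _ => by ring
  rw [hdiag, add_eq_left]
  have hne : ∀ q : Finset (Fin n) × Finset (Fin n), q.1 ≠ q.2 → (symmDiff q.1 q.2).Nonempty :=
    fun q hq => Finset.nonempty_iff_ne_empty.2 fun h => hq (symmDiff_eq_bot.1 h)
  refine Finset.sum_involution
    (fun q hq => (symmDiff q.1 {(symmDiff q.1 q.2).min' (hne q (Finset.mem_filter.1 hq).2)},
      symmDiff q.2 {(symmDiff q.1 q.2).min' (hne q (Finset.mem_filter.1 hq).2)})) ?_ ?_ ?_ ?_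
  · rintro ⟨A, B⟩ hq
    have hp := Finset.min'_mem _ (hne (A, B) (Finset.mem_filter.1 hq).2)
    dsimp only at hp ⊢
    rw [inter_symmDiff_singleton hp, prod_symmDiff_singleton_mul y hp]
    ring
  · rintro ⟨A, B⟩ hq _ heq
    have h1 := congrArg Prod.fst heq
    simp at h1
  · rintro ⟨A, B⟩ hq
    have hp := Finset.min'_mem _ (hne (A, B) (Finset.mem_filter.1 hq).2)
    simp only [Finset.mem_filter, Finset.mem_univ, true_and] at hq hp ⊢
    rw [card_symmDiff_singleton_add hp]
    exact ⟨hq.1, fun h => hq.2 (symmDiff_left_injective _ h)⟩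
  · rintro ⟨A, B⟩ hq
    simp only [symmDiff_symmDiff_singleton, symmDiff_symmDiff_cancel_right]

end Pairs

/-! ### The trace -/

/-- The alphabet of size `2n` as two copies of the numbers below `n`: the first copy consists of the
letters of the first half, the second one of their opposite letters, so that `p` in the second copy
is the letter opposite to `p` in the first copy. -/
def oppositeLetters (n : ℕ) : Fin n ⊕ Fin n ≃ Fin (2 * n) :=
  ((Equiv.sumCongr (Equiv.refl _) Fin.revPerm).trans finSumFinEquiv).trans
    (finCongr (two_mul n).symm)

theorem val_oppositeLetters_inl {n : ℕ} (p : Fin n) :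
    (oppositeLetters n (Sum.inl p) : ℕ) = p := by
  simp [oppositeLetters]

theorem oppositeLetters_inr {n : ℕ} (p : Fin n) :
    oppositeLetters n (Sum.inr p) = (oppositeLetters n (Sum.inl p)).rev := by
  apply Fin.ext
  rw [Fin.val_rev, val_oppositeLetters_inl]
  simp [oppositeLetters, Fin.val_rev]
  omega

/-- The bijection between pairs of subsets and sets of letters, the second subset recording the
letters of the second half by their opposites. -/
def lettersOfPair (n : ℕ) : Finset (Fin n) × Finset (Fin n) ≃ Finset (Fin (2 * n)) :=
  Finset.sumEquiv.symm.toEquiv.trans (oppositeLetters n).finsetCongr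

theorem lettersOfPair_apply {n : ℕ} (q : Finset (Fin n) × Finset (Fin n)) :
    lettersOfPair n q = (q.1.disjSum q.2).map (oppositeLetters n).toEmbedding := rfl

theorem inl_mem_lettersOfPair {n : ℕ} {q : Finset (Fin n) × Finset (Fin n)} {p : Fin n} :
    oppositeLetters n (Sum.inl p) ∈ lettersOfPair n q ↔ p ∈ q.1 := by
  simp [lettersOfPair_apply]

theorem inr_mem_lettersOfPair {n : ℕ} {q : Finset (Fin n) × Finset (Fin n)} {p : Fin n} :
    oppositeLetters n (Sum.inr p) ∈ lettersOfPair n q ↔ p ∈ q.2 := by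
  simp [lettersOfPair_apply]

theorem card_closing_lettersOfPair {n : ℕ} (q : Finset (Fin n) × Finset (Fin n)) :
    ((lettersOfPair n q).filter
      fun x : Fin (2 * n) => n ≤ (x : ℕ) ∧ x.rev ∈ lettersOfPair n q).card = (q.1 ∩ q.2).card := by
  rw [← Finset.card_map ⟨fun p => oppositeLetters n (Sum.inr p),
    (oppositeLetters n).injective.comp Sum.inr_injective⟩]
  congr 1
  ext x
  obtain ⟨p | p, rfl⟩ := (oppositeLetters n).surjective x
  · have h1 : ∀ p' : Fin n, oppositeLetters n (Sum.inr p') ≠ oppositeLetters n (Sum.inl p) :=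
      fun p' h => Sum.inr_ne_inl ((oppositeLetters n).injective h)
    simp [val_oppositeLetters_inl, h1]
  · have h1 : n ≤ (oppositeLetters n (Sum.inr p) : ℕ) := by
      rw [oppositeLetters_inr, Fin.val_rev, val_oppositeLetters_inl]
      omega
    have h2 : (oppositeLetters n (Sum.inr p)).rev = oppositeLetters n (Sum.inl p) := by
      rw [oppositeLetters_inr, Fin.rev_rev]
    simp only [Finset.mem_filter, h1, h2, inl_mem_lettersOfPair, inr_mem_lettersOfPair,
      Finset.mem_map, Function.Embedding.coeFn_mk, EmbeddingLike.apply_eq_iff_eq,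
      Sum.inr.injEq, exists_eq_right, Finset.mem_inter, true_and]
    exact and_comm

namespace SymplecticTensor

open BrauerAlgebra

variable {n m : ℕ}

/-- The diagonal entries of `genericCartan`. -/
noncomputable def cartanEntry (n : ℕ) (i : Fin (2 * n)) : MvPolynomial (Fin n) ℂ :=
  if h : (i : ℕ) < n then MvPolynomial.X ⟨i, h⟩
    else -MvPolynomial.X ⟨i.rev, by rw [Fin.val_rev]; omega⟩

theorem cartanEntry_inl (p : Fin n) :
    cartanEntry n (oppositeLetters n (Sum.inl p)) = MvPolynomial.X p := by
  simp [cartanEntry, val_oppositeLetters_inl]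

theorem cartanEntry_inr (p : Fin n) :
    cartanEntry n (oppositeLetters n (Sum.inr p)) = -MvPolynomial.X p := by
  have h1 : ¬(oppositeLetters n (Sum.inr p) : ℕ) < n := by
    rw [oppositeLetters_inr, Fin.val_rev, val_oppositeLetters_inl]
    omega
  rw [cartanEntry, dif_neg h1]
  congr 2
  apply Fin.ext
  change ((oppositeLetters n (Sum.inr p)).rev : ℕ) = p
  rw [oppositeLetters_inr, Fin.rev_rev, val_oppositeLetters_inl]

theorem onFactor_diagonal {R : Type*} [CommRing R] {N : ℕ} (a : Fin m) (y : Fin N → R) :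
    onFactor a (Matrix.diagonal y) = Matrix.diagonal fun i => y (i a) := by
  ext i j
  rw [onFactor, tensor, Matrix.of_apply, ← Finset.mul_prod_erase _ _ (Finset.mem_univ a),
    Function.update_self]
  have h1 : ∀ c ∈ Finset.univ.erase a,
      (Function.update 1 a (Matrix.diagonal y) : Fin m → Matrix (Fin N) (Fin N) R) c (i c) (j c) =
        if i c = j c then 1 else 0 := by
    intro c hc
    rw [Function.update_of_ne (Finset.ne_of_mem_erase hc)]
    rfl
  rw [Finset.prod_congr rfl h1, Finset.prod_ite_zero]
  simp only [Matrix.diagonal_apply, Finset.prod_const_one]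
  by_cases hij : i = j
  · simp [hij]
  · rw [if_neg hij]
    split_ifs with h2 h3
    · refine absurd (funext fun c => ?_) hij
      by_cases hc : c = a
      · rw [hc, h2]
      · exact h3 c (Finset.mem_erase.2 ⟨hc, Finset.mem_univ c⟩)
    · rw [mul_zero]
    · rw [zero_mul]
    · rw [zero_mul]

theorem prod_onFactor_genericCartan :
    (List.ofFn fun a : Fin m => onFactor a (genericCartan n)).prod =
      Matrix.diagonal fun i => ∏ a, cartanEntry n (i a) := by
  have h1 : (fun a : Fin m => onFactor a (genericCartan n)) =
      Matrix.diagonalRingHom _ _ ∘ fun a i => cartanEntry n (i a) :=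
    funext fun a => onFactor_diagonal a _
  rw [h1, ← List.map_ofFn, ← map_list_prod, List.prod_ofFn]
  change Matrix.diagonal _ = _
  congr 1
  funext i
  rw [Finset.prod_apply]

theorem charMap_eq_sum (ρ : BrauerAlgebra ℂ (-(2 * n : ℂ)) m →ₐ[ℂ] TensorEnd ℂ (2 * n) m)
    (x : BrauerAlgebra ℂ (-(2 * n : ℂ)) m) :
    charMap n m ρ x = MvPolynomial.C ((m.factorial : ℂ)⁻¹) *
      ∑ i, MvPolynomial.C (ρ x i i) * ∏ a, cartanEntry n (i a) := by
  rw [charMap, prod_onFactor_genericCartan, Matrix.trace]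
  simp [Matrix.mul_diagonal]

theorem card_isClosing {i : Fin m → Fin (2 * n)} (hi : Function.Injective i)
    [DecidablePred (IsClosing i)] :
    (Finset.univ.filter fun a => IsClosing i a).card = ((Finset.univ.image i).filter
      fun x : Fin (2 * n) => n ≤ (x : ℕ) ∧ x.rev ∈ Finset.univ.image i).card := by
  rw [← Finset.card_image_of_injective _ hi, Finset.filter_image]
  congr 1
  ext x
  simp only [Finset.mem_image, Finset.mem_filter, Finset.mem_univ, true_and]
  simp [IsClosing]

open Classical in
/-- The diagonal entries of the symmetrizer depend only on the set of letters of the word. -/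
theorem brauerAction_symmetrizer_apply_self (hm : m ≤ n) {i : Fin m → Fin (2 * n)}
    (hi : Function.Injective i) :
    brauerAction n m (symmetrizer (-(2 * n : ℂ)) m) i i = (m.factorial : ℂ)⁻¹ *
      (((n : ℂ) - m + 1) / ((n : ℂ) - m + ((Finset.univ.image i).filter
        fun x : Fin (2 * n) => n ≤ (x : ℕ) ∧ x.rev ∈ Finset.univ.image i).card + 1)) := by
  have hD := symmetrizerDenom_ne_zero hm
  have hcard := Finset.card_filter_add_card_filter_not (s := (Finset.univ : Finset (Fin m)))
    (IsClosing i)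
  rw [Finset.card_fin, card_isClosing hi] at hcard
  have hz := symOp_apply_self hm hi
  set c := ((Finset.univ.image i).filter
    fun x : Fin (2 * n) => n ≤ (x : ℕ) ∧ x.rev ∈ Finset.univ.image i).card
  set z := (Finset.univ.filter fun a => ¬IsClosing i a).card
  have hzc : (n : ℂ) - z + 1 = (n : ℂ) - m + c + 1 := by
    rw [← hcard]
    push_cast
    ring
  have hne : (n : ℂ) - m + c + 1 ≠ 0 := by
    rw [← Nat.cast_sub hm, ← Nat.cast_add]
    exact Nat.cast_add_one_ne_zero _
  have hfac : symmetrizerDenom (-(2 * n : ℂ)) m =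
      m.factorial * ∏ k ∈ Finset.range m, (-(2 * n : ℂ) + 2 * k - 2) := by
    rw [symmetrizerDenom, Finset.prod_mul_distrib, ← Finset.prod_range_add_one_eq_factorial]
    push_cast
    rfl
  rw [hzc] at hz
  rw [(genericSymmetrizer_regular hD).2, map_smul, Matrix.smul_apply, smul_eq_mul]
  change _ * symOp n m le_rfl i i = _
  rw [hfac] at hD ⊢
  generalize ∏ k ∈ Finset.range m, (-(2 * n : ℂ) + 2 * k - 2) = E at hD hz ⊢
  have h1 := left_ne_zero_of_mul hD
  have h2 := right_ne_zero_of_mul hD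
  field_simp
  linear_combination hz

theorem brauerAction_symmetrizer_apply_self_of_not_injective (hm : m ≤ n)
    {i : Fin m → Fin (2 * n)} (hi : ¬Function.Injective i) :
    brauerAction n m (symmetrizer (-(2 * n : ℂ)) m) i i = 0 := by
  rw [(genericSymmetrizer_regular (symmetrizerDenom_ne_zero hm)).2, map_smul, Matrix.smul_apply]
  change _ • symOp n m le_rfl i i = _
  rw [symOp_apply_self_of_not_injective hi, smul_zero]

theorem charMap_symmetrizer {l : ℕ} (hl : 2 * l ≤ n) :
    charMap n (2 * l) (brauerAction n (2 * l)) (symmetrizer (-(2 * n : ℂ)) (2 * l)) =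
      MvPolynomial.C ((-1) ^ l * ((n : ℂ) - 2 * l + 1) /
          ((2 * l).factorial * ((n : ℂ) - l + 1))) *
        MvPolynomial.aeval (fun i => (MvPolynomial.X i : MvPolynomial (Fin n) ℂ) ^ 2)
          (MvPolynomial.esymm (Fin n) ℂ l) := by
  set β : ℕ → MvPolynomial (Fin n) ℂ := fun c => MvPolynomial.C
    (((2 * l).factorial : ℂ)⁻¹ * (((n : ℂ) - (2 * l : ℕ) + 1) / ((n : ℂ) - (2 * l : ℕ) + c + 1)))
    with hβ
  have hfac : ((2 * l).factorial : ℂ) ≠ 0 := Nat.cast_ne_zero.2 (Nat.factorial_ne_zero _)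
  rw [charMap_eq_sum, sum_words_eq_sum_powersetCard _
    (fun I => β (I.filter fun x : Fin (2 * n) => n ≤ (x : ℕ) ∧ x.rev ∈ I).card *
      ∏ x ∈ I, cartanEntry n x)]
  · have hpairs : ∑ I ∈ (Finset.univ : Finset (Fin (2 * n))).powersetCard (2 * l),
        β (I.filter fun x : Fin (2 * n) => n ≤ (x : ℕ) ∧ x.rev ∈ I).card *
          ∏ x ∈ I, cartanEntry n x =
        ∑ q ∈ (Finset.univ : Finset (Finset (Fin n) × Finset (Fin n))).filter
          (fun q => q.1.card + q.2.card = 2 * l), β (q.1 ∩ q.2).card *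
            ((∏ p ∈ q.1, MvPolynomial.X p) * ∏ p ∈ q.2, -MvPolynomial.X p) := by
      symm
      refine Finset.sum_equiv (lettersOfPair n) (fun q => ?_) fun q _ => ?_
      · rw [Finset.mem_powersetCard, lettersOfPair_apply, Finset.card_map, Finset.card_disjSum]
        simp
      · rw [card_closing_lettersOfPair, lettersOfPair_apply, Finset.prod_map,
          Finset.prod_disjSum]
        simp only [Equiv.coe_toEmbedding, cartanEntry_inl, cartanEntry_inr]
    rw [hpairs, sum_pairs_eq_sum_diagonal, nsmul_eq_mul, ← mul_assoc, ← map_natCast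
      (MvPolynomial.C (σ := Fin n) (R := ℂ)), ← MvPolynomial.C_mul, inv_mul_cancel₀ hfac, map_one,
      one_mul, MvPolynomial.esymm, map_sum, hβ]
    congr 1
    · rw [← map_one (MvPolynomial.C (σ := Fin n) (R := ℂ)), ← MvPolynomial.C_neg,
        ← MvPolynomial.C_pow, ← MvPolynomial.C_mul]
      congr 1
      have h1 : (n : ℂ) - (2 * l : ℕ) + l + 1 = (n : ℂ) - l + 1 := by
        push_cast
        ring
      rw [h1]
      push_cast
      rw [mul_div_assoc', inv_mul_eq_div, div_div, div_mul_eq_mul_div, mul_comm ((-1 : ℂ) ^ l)]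
    · exact Finset.sum_congr rfl fun A _ => by simp
  · intro i hi
    rw [brauerAction_symmetrizer_apply_self_of_not_injective hl hi, map_zero, zero_mul]
  · intro i hi
    rw [brauerAction_symmetrizer_apply_self hl hi, Finset.prod_image fun a _ b _ h => hi h]

end SymplecticTensor

theorem corollary4p5 (n l : ℕ) (hl : 2 * l ≤ n) :
    -- the symmetrizer is well-defined over `ℂ(ω)` and can be specialized to `ω = -2n`
    BrauerAlgebra.IdempotentDefined (RatFunc.X : RatFunc ℂ)
      (BrauerAlgebra.rowTableau (2 * l)) ∧
    BrauerAlgebra.RegularAt (-(2 * n : ℂ)) (BrauerAlgebra.genericSymmetrizer (2 * l)) ∧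
    -- there is exactly one action of the Brauer algebra, and the image is as stated
    ∃ ρ : BrauerAlgebra ℂ (-(2 * n : ℂ)) (2 * l) →ₐ[ℂ] SymplecticTensor.TensorEnd ℂ (2 * n) (2 * l),
      SymplecticTensor.IsBrauerAction n (2 * l) ρ ∧
      (∀ ρ', SymplecticTensor.IsBrauerAction n (2 * l) ρ' → ρ' = ρ) ∧
      SymplecticTensor.charMap n (2 * l) ρ
          (BrauerAlgebra.symmetrizer (-(2 * n : ℂ)) (2 * l)) =
        MvPolynomial.C ((-1) ^ l * ((n : ℂ) - 2 * l + 1) /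
            ((2 * l).factorial * ((n : ℂ) - l + 1))) *
          MvPolynomial.aeval (fun i => (MvPolynomial.X i : MvPolynomial (Fin n) ℂ) ^ 2)
            (MvPolynomial.esymm (Fin n) ℂ l) :=
  ⟨BrauerAlgebra.idempotentDefined_generic _, (BrauerAlgebra.genericSymmetrizer_regular
      (SymplecticTensor.symmetrizerDenom_ne_zero hl)).1,
    SymplecticTensor.brauerAction n (2 * l), SymplecticTensor.isBrauerAction_brauerAction,
    fun _ h => SymplecticTensor.isBrauerAction_brauerAction.unique h,
    SymplecticTensor.charMap_symmetrizer hl⟩
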